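/- \textbf{Setting.} An instance of $J2\,|\,op\le 2,\ \mathrm{shortest\ path}\,|\,C_{\max}$ consists of a finite directed multigraph $G=(V,A)$ with vertices $s,t$ and, for each arc $a_j\in A$, a job $J_j$ that is a chain of at most two operations, with at most one operation on each of the two machines $M_1,M_2$; the operation of $J_j$ on $M_i$ takes time $p_{ij}\ge 0$ ($p_{ij}=0$ below if there is no such operation). A feasible solution is a directed $s$-$t$ path $P$ together with a feasible two-machine job shop schedule of the set $J_P$ of jobs of the arcs of $P$ (each machine processes one job at a time, the operations of a job are processed in the order of its chain). The objective is to minimize the makespan. \textbf{Rules.} \emph{Johnson's rule}, for jobs that all go first to a machine $a$ and then to a machine $b$, processes on both machines first the jobs with $p_{aj}\le p_{bj}$ by increasing $p_{aj}$, then the other jobs by decreasing $p_{bj}$, every operation as early as possible. \emph{Jackson's rule} orders the jobs with order $(1\to2)$ and the jobs with order $(2\to1)$ by Johnson's rule; $M_1$ processes the $(1\to2)$ jobs, then the jobs with an operation on $M_1$ only, then the $(2\to1)$ jobs, and $M_2$ processes the $(2\to1)$ jobs, then the jobs with an operation on $M_2$ only, then the $(1\to2)$ jobs, every operation as early as possible.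 \textbf{Path subroutine (ABV).} For accuracy $\delta>0$ and nonnegative weights $w^1,w^2$ on the arcs, ABV computes an $s$-$t$ path as follows. It finds a shortest path for $w^1+w^2$, of length $c$; if $c=0$ it returns that path. Otherwise it puts $\theta=\delta c/(2|V|)$ and $B=\lfloor c/\theta\rfloor$, replaces each $w^i_j$ by $\lfloor w^i_j/\theta\rfloor$, computes by dynamic programming over the number of arcs all pairs (with both entries at most $B$) of rounded lengths of walks from $s$ with at most $|V|$ arcs, takes an $s$-$t$ walk whose larger rounded length is least, and removes the cycles from it. \textbf{Algorithm JJAR} (with parameter $\varepsilon>0$). Put $\rho=\frac23$, $\delta=\frac23\varepsilon$, $M=(1+\delta)\sum_j(p_{1j}+p_{2j})+1$, $D=\emptyset$ and $(w^1_j,w^2_j)=(p_{1j},p_{2j})$. Find a path $P$ by ABV and schedule $J_P$ by Jackson's rule, with makespan $C'$. While $J_P\cap D=\emptyset$ and some $J_j\in J_P$ has $p_{1j}+p_{2j}\ge\rho C'$: for all $J_j\notin D$ with $p_{1j}+p_{2j}\ge\rho C'$ put $(w^1_j,w^2_j)=(M,M)$ and add $J_j$ to $D$; then compute $P$ by ABV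 with the new weights and accuracy $\delta$, and schedule $J_P$ by Jackson's rule, with makespan $C'$. Return the best of all solutions found. \textbf{Theorem.} For every $\varepsilon>0$, JJAR is a $(\frac32+\varepsilon)$-approximation algorithm for $J2\,|\,op\le 2,\ \mathrm{shortest\ path}\,|\,C_{\max}$: (i) for all nonnegative processing times (in $\mathbb R$, or any ordered field with integer parts), JJAR returns nothing if there is no $s$-$t$ path, and otherwise it returns a directed $s$-$t$ path and a feasible schedule of its jobs, with its makespan $C_{\max}$, such that $C_{\max}\le(\frac32+\varepsilon)\,C$ for the makespan $C$ of every feasible solution; (ii) for each fixed rational $\varepsilon>0$ and rational processing times, the number of steps of JJAR, where an arithmetic operation or comparison is charged by the square of the bit lengths of its operands, is bounded by a polynomial in the length of the input, that is, in $|V|+|A|$ plus the total bit length of the processing times. (iii) Moreover, for every finite set of such jobs, let $C^J_{\max}$ be the makespan of the schedule given by Jackson's rule, and let $C^1_{\max}$ (respectively $C^2_{\max}$) be the makespan of the schedule given by Johnson's rule after the processing order of all jobs has been changed to $(1\to2)$ (respectively $(2\to1)$), with unchanged processing times. Then $C^J_{\max}\le\max\{C^1_{\max},C^2_{\max}\}$.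 -/

import Mathlib

/-! ## Step-counted computations

A value of type `Timed α` is the result of a computation together with the number of steps spent.
Control flow, reading or writing an array cell and list operations on one cell cost a constant
number of steps; an arithmetic operation or comparison of numbers is charged by the square of the
bit lengths of its operands. -/

structure Timed (α : Type) where
  val : α
  time : ℕ

namespace Timed

instance : Monad Timed where
  pure a := ⟨a, 0⟩
  bind x f := ⟨(f x.val).val, x.time + (f x.val).time⟩

/-- Spend `c` steps. -/
def tick (c : ℕ) : Timed Unit := ⟨(), c⟩

/-- Array read. Arrays are functions on their index type. -/
def get {ι α : Type} (f : ι → α) (i : ι) : Timed α := ⟨f i, 1⟩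

/-- Array write. -/
def set {ι α : Type} [DecidableEq ι] (f : ι → α) (i : ι) (a : α) : Timed (ι → α) :=
  ⟨Function.update f i a, 1⟩

/-- Allocation of an array with `c` cells, all filled with `a`. -/
def fill {ι α : Type} (c : ℕ) (a : α) : Timed (ι → α) := ⟨fun _ => a, c⟩

/-- Execute `f` for the elements of a list, in order, updating a state. -/
def forEach {α σ : Type} (f : σ → α → Timed σ) : List α → σ → Timed σ
  | [], s => do
    tick 1
    pure s
  | x :: xs, s => do
    tick 1
    let s' ← f s x
    forEach f xs s'

/-- Execute `f` exactly `k` times. -/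
def iter {σ : Type} (f : σ → Timed σ) : ℕ → σ → Timed σ
  | 0, s => do
    tick 1
    pure s
  | k + 1, s => do
    tick 1
    let s' ← f s
    iter f k s'

/-- The array of the values `f i`, for `i : Fin n`. -/
def tabulate {n : ℕ} {α : Type} (a₀ : α) (f : Fin n → Timed α) : Timed (Fin n → α) := do
  let A ← fill n a₀
  forEach (fun A i => do
    let a ← f i
    set A i a) (List.finRange n) A

def filter {α : Type} (p : α → Timed Bool) : List α → Timed (List α)
  | [] => do
    tick 1
    pure []
  | x :: xs => do
    tick 1
    let b ← p x
    let ys ← filter p xs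
    if b then pure (x :: ys) else pure ys

def any {α : Type} (p : α → Timed Bool) : List α → Timed Bool
  | [] => do
    tick 1
    pure false
  | x :: xs => do
    tick 1
    let b ← p x
    if b then pure true else any p xs

def reverse {α : Type} (xs : List α) : Timed (List α) :=
  forEach (fun ys x => pure (x :: ys)) xs []

/-- Insertion of `x` before the first `y` with `le x y`. -/
def insert {α : Type} (le : α → α → Timed Bool) (x : α) : List α → Timed (List α)
  | [] => do
    tick 1
    pure [x]
  | y :: ys => do
    tick 1
    let b ← le x y
    if b then pure (x :: y :: ys) else do
      let zs ← insert le x ys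
      pure (y :: zs)

/-- (Stable) insertion sort. -/
def sort {α : Type} (le : α → α → Timed Bool) : List α → Timed (List α)
  | [] => do
    tick 1
    pure []
  | x :: xs => do
    tick 1
    let ys ← sort le xs
    insert le x ys

def natAdd (a b : ℕ) : Timed ℕ := ⟨a + b, (Nat.size a + Nat.size b + 1) ^ 2⟩

def natLe (a b : ℕ) : Timed Bool := ⟨decide (a ≤ b), (Nat.size a + Nat.size b + 1) ^ 2⟩

end Timed

/-- The number of bits charged for a number. -/
class BitSize (K : Type) where
  bits : K → ℕ

/-- A rational is stored as a reduced fraction in binary. -/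
instance : BitSize ℚ where
  bits q := Nat.size q.num.natAbs + Nat.size q.den

namespace Timed

variable {K : Type} [Field K] [LinearOrder K] [FloorSemiring K] [BitSize K]

def opCost {K : Type} [BitSize K] (a b : K) : ℕ := (BitSize.bits a + BitSize.bits b + 1) ^ 2

def add (a b : K) : Timed K := ⟨a + b, opCost a b⟩
def mul (a b : K) : Timed K := ⟨a * b, opCost a b⟩
def div (a b : K) : Timed K := ⟨a / b, opCost a b⟩
def le (a b : K) : Timed Bool := ⟨decide (a ≤ b), opCost a b⟩
def lt (a b : K) : Timed Bool := ⟨decide (a < b), opCost a b⟩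
def max (a b : K) : Timed K := ⟨Max.max a b, opCost a b⟩
/-- Integer part of a quotient. -/
def floorDiv (a b : K) : Timed ℕ := ⟨⌊a / b⌋₊, opCost a b⟩
def ofNat (k : ℕ) : Timed K := ⟨(k : K), Nat.size k + 1⟩

end Timed

/-! ## The problem -/

/-- A finite directed multigraph with a source `s` and a destination `t`. -/
structure Network where
  numV : ℕ
  numA : ℕ
  src : Fin numA → Fin numV
  tgt : Fin numA → Fin numV
  s : Fin numV
  t : Fin numV

namespace Network

def IsWalk (N : Network) : Fin N.numV → List (Fin N.numA) → Fin N.numV → Prop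
  | u, [], v => u = v
  | u, a :: P, v => N.src a = u ∧ N.IsWalk (N.tgt a) P v

/-- `P` is the list of arcs of a directed `s`-`t` path: no vertex is visited twice. -/
def IsPath (N : Network) (P : List (Fin N.numA)) : Prop :=
  N.IsWalk N.s P N.t ∧ (N.s :: P.map N.tgt).Nodup

end Network

/-- A job of `J2 | op ≤ 2`: a chain of operations given by the list `route` of their machines,
with at most one operation on each of the two machines `0` and `1`, hence at most two operations.
The operation on machine `m ∈ route` takes `time m` (if `m ∉ route`, this entry is irrelevant). -/
structure Job (K : Type) [Field K] [LinearOrder K] where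
  route : List (Fin 2)
  route_nodup : route.Nodup
  time : Fin 2 → K
  time_nonneg : ∀ m, 0 ≤ time m

namespace Job

variable {K : Type} [Field K] [LinearOrder K]

/-- The total time that the job needs on machine `m`. -/
def load (J : Job K) (m : Fin 2) : K := if m ∈ J.route then J.time m else 0

/-- The job with the same processing times that goes first to machine `a` and then to the other
machine `1 - a`; a missing operation becomes an operation of length `0`. -/
def reroute (J : Job K) (a : Fin 2) : Job K where
  route := [a, 1 - a]
  route_nodup := by fin_cases a <;> decide
  time := J.load
  time_nonneg m := by
    unfold load
    split_ifs
    · exact J.time_nonneg m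
    · exact le_rfl

end Job

/-! A schedule for jobs indexed by `Fin n` gives a start time for each pair of a job and a
machine. -/

section Schedules

variable {K : Type} [Field K] [LinearOrder K] {n : ℕ}

/-- Feasibility of the start times `σ` for the jobs in `S` in the two-machine job shop. -/
structure IsSchedule (job : Fin n → Job K) (S : Finset (Fin n)) (σ : Fin n × Fin 2 → K) :
    Prop where
  nonneg : ∀ j ∈ S, ∀ m ∈ (job j).route, 0 ≤ σ (j, m)
  chain : ∀ j ∈ S, (job j).route.IsChain (fun a b => σ (j, a) + (job j).time a ≤ σ (j, b))
  machine : ∀ i ∈ S, ∀ j ∈ S, i ≠ j → ∀ m ∈ (job i).route, m ∈ (job j).route →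
    σ (i, m) + (job i).time m ≤ σ (j, m) ∨ σ (j, m) + (job j).time m ≤ σ (i, m)

/-- The latest completion time of an operation of a job in `S` (and `0` if there is none). -/
def makespan (job : Fin n → Job K) (S : Finset (Fin n)) (σ : Fin n × Fin 2 → K) : K :=
  S.fold max 0 (fun j =>
    ((job j).route.map (fun m => σ (j, m) + (job j).time m)).foldr max 0)

end Schedules

/-- An instance of `J2 | op ≤ 2, shortest path | C_max`: the job `job a` belongs to the arc `a`. -/
structure ShopPath (K : Type) [Field K] [LinearOrder K] extends Network where
  job : Fin numA → Job K

/-- The length of the input. -/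
def ShopPath.size {K : Type} [Field K] [LinearOrder K] [BitSize K] (I : ShopPath K) : ℕ :=
  I.numV + I.numA + ∑ a, ∑ m, BitSize.bits ((I.job a).time m)

/-! ## Johnson's rule and Jackson's rule -/

section Rules

open Timed

variable {K : Type} [Field K] [LinearOrder K] [BitSize K] {n : ℕ}

def loadT (job : Fin n → Job K) (j : Fin n) (m : Fin 2) : Timed K := ⟨(job j).load m, 3⟩

/-- Johnson's order for jobs whose first machine is `a` and second machine is `b`: first the jobs
with first time at most the second time, by increasing first time, then the remaining jobs, by
decreasing second time. -/
def johnsonLe (job : Fin n → Job K) (a b : Fin 2) (i j : Fin n) : Timed Bool := do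
  let pᵢ ← loadT job i a
  let qᵢ ← loadT job i b
  let pⱼ ← loadT job j a
  let qⱼ ← loadT job j b
  let gᵢ ← le pᵢ qᵢ
  let gⱼ ← le pⱼ qⱼ
  match gᵢ, gⱼ with
  | true, true => le pᵢ pⱼ
  | true, false => pure true
  | false, true => pure false
  | false, false => le qⱼ qᵢ

def johnsonSort (job : Fin n → Job K) (a b : Fin 2) (L : List (Fin n)) : Timed (List (Fin n)) :=
  sort (johnsonLe job a b) L

/-- Process the listed jobs on machine `m` without delay; the state is the pair of the start times
assigned so far and the time from which machine `m` is free. -/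
def placeFirst (job : Fin n → Job K) (m : Fin 2) :
    List (Fin n) → (Fin n × Fin 2 → K) × K → Timed ((Fin n × Fin 2 → K) × K) :=
  forEach (fun st j => do
    let p ← loadT job j m
    let σ ← set st.1 (j, m) st.2
    let f ← add st.2 p
    pure (σ, f))

/-- Process the listed jobs on machine `b`, in this order, each as soon as machine `b` is free and
the operation of the job on machine `a` is completed. -/
def placeSecond (job : Fin n → Job K) (a b : Fin 2) :
    List (Fin n) → (Fin n × Fin 2 → K) × K → Timed ((Fin n × Fin 2 → K) × K) :=
  forEach (fun st j => do
    let r ← get st.1 (j, a)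
    let p ← loadT job j a
    let c ← add r p
    let x ← Timed.max st.2 c
    let σ ← set st.1 (j, b) x
    let q ← loadT job j b
    let f ← add x q
    pure (σ, f))

/-- Johnson's rule for the two-machine flow shop in which every job of `L` goes first to machine
`a` and then to machine `b`. Returns start times and makespan. -/
def johnson (job : Fin n → Job K) (a b : Fin 2) (L : List (Fin n)) :
    Timed ((Fin n × Fin 2 → K) × K) := do
  let L' ← johnsonSort job a b L
  let σ₀ ← fill (2 * n) 0
  let x ← placeFirst job a L' (σ₀, 0)
  let y ← placeSecond job a b L' (x.1, 0)
  let c ← Timed.max x.2 y.2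
  pure (y.1, c)

def hasRoute (job : Fin n → Job K) (r : List (Fin 2)) (j : Fin n) : Timed Bool :=
  ⟨decide ((job j).route = r), 3⟩

/-- Jackson's rule for the jobs of `L`: machine `0` processes the jobs with route `0 → 1` in
Johnson's order, then those with an operation on machine `0` only, then those with route `1 → 0` in
their Johnson order; symmetrically for machine `1`. Returns start times and makespan. -/
def jackson (job : Fin n → Job K) (L : List (Fin n)) : Timed ((Fin n × Fin 2 → K) × K) := do
  let J₀₁ ← filter (hasRoute job [0, 1]) L
  let J₁₀ ← filter (hasRoute job [1, 0]) L
  let J₀ ← filter (hasRoute job [0]) L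
  let J₁ ← filter (hasRoute job [1]) L
  let L₀₁ ← johnsonSort job 0 1 J₀₁
  let L₁₀ ← johnsonSort job 1 0 J₁₀
  let σ₀ ← fill (2 * n) 0
  let x ← placeFirst job 0 L₀₁ (σ₀, 0)
  let x ← placeFirst job 0 J₀ x
  let y ← placeFirst job 1 L₁₀ (x.1, 0)
  let y ← placeFirst job 1 J₁ y
  let x ← placeSecond job 1 0 L₁₀ (y.1, x.2)
  let y ← placeSecond job 0 1 L₀₁ (x.1, y.2)
  let c ← Timed.max x.2 y.2
  pure (y.1, c)

end Rules

/-! ## Approximate min-max shortest paths with two weights per arc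

The ABV algorithm: a shortest path for the sum of the two weights gives a lower and an upper bound
on the optimum which differ by a factor two; with these the weights are scaled and rounded down,
and the rounded problem is solved by dynamic programming over the pairs of path lengths. -/

section ABV

open Timed

variable {K : Type} [Field K] [LinearOrder K] [BitSize K] (N : Network)

/-- One relaxation step of the Bellman-Ford algorithm. A label of a vertex is the length of a walk
from `s` together with its arcs, the last one first. -/
def relax (w : Fin N.numA → K) (old : Fin N.numV → Option (K × List (Fin N.numA)))
    (new : Fin N.numV → Option (K × List (Fin N.numA))) (a : Fin N.numA) :
    Timed (Fin N.numV → Option (K × List (Fin N.numA))) := do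
  let u ← get N.src a
  let v ← get N.tgt a
  match ← get old u with
  | none => pure new
  | some (d, P) => do
    let x ← get w a
    let d' ← add d x
    match ← get new v with
    | none => set new v (some (d', a :: P))
    | some (e, _) => do
      let b ← lt d' e
      if b then set new v (some (d', a :: P)) else pure new

/-- Shortest walks from `s` for one weight function. -/
def bellmanFord (w : Fin N.numA → K) :
    Timed (Fin N.numV → Option (K × List (Fin N.numA))) := do
  let l ← fill N.numV none
  let l ← set l N.s (some (0, []))
  iter (fun old => do
    tick N.numV
    forEach (relax N w old) (List.finRange N.numA) old) N.numV l

/-- A table of the dynamic program: entry `(v, x, y)` is a walk from `s` to `v` (last arc first) of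
lengths `x` and `y` for the two rounded weights, if one has been found. -/
abbrev Network.Table (N : Network) : Type := Fin N.numV × ℕ × ℕ → Option (List (Fin N.numA))

/-- Extend the walk in entry `(src a, x, y)` by the arc `a`, if both lengths remain at most `B`. -/
def extend (w₁ w₂ : Fin N.numA → ℕ) (B : ℕ) (old : N.Table) (a : Fin N.numA) (x y : ℕ)
    (new : N.Table) : Timed N.Table := do
  let u ← get N.src a
  let v ← get N.tgt a
  match ← get old (u, x, y) with
  | none => pure new
  | some P => do
    let x₁ ← get w₁ a
    let y₁ ← get w₂ a
    let x' ← natAdd x x₁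
    let y' ← natAdd y y₁
    let b ← natLe x' B
    let c ← natLe y' B
    if b && c then do
      match ← get new (v, x', y') with
      | none => set new (v, x', y') (some (a :: P))
      | some _ => pure new
    else pure new

/-- All pairs of lengths at most `B` of walks from `s` with at most `numV` arcs. -/
def dynProg (w₁ w₂ : Fin N.numA → ℕ) (B : ℕ) : Timed N.Table := do
  let T ← fill (N.numV * (B + 1) * (B + 1)) none
  let T ← set T (N.s, 0, 0) (some [])
  iter (fun old => do
    tick (N.numV * (B + 1) * (B + 1))
    forEach (fun new a =>
      forEach (fun new x =>
        forEach (fun new y => extend N w₁ w₂ B old a x y new)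
          (List.range (B + 1)) new)
        (List.range (B + 1)) new)
      (List.finRange N.numA) old) N.numV T

/-- The entry `(t, x, y)` of the table with least `max x y`. -/
def selectBest (B : ℕ) (T : N.Table) : Timed (Option (ℕ × List (Fin N.numA))) :=
  forEach (fun best x =>
    forEach (fun best y => do
      match ← get T (N.t, x, y) with
      | none => pure best
      | some P => do
        let b ← natLe x y
        let z := if b then y else x
        match best with
        | none => pure (some (z, P))
        | some (z', _) => do
          let c ← natLe z' z
          if c then pure best else pure (some (z, P)))
      (List.range (B + 1)) best)
    (List.range (B + 1)) none

/-- For a path ending at `t`: its final part from the vertex `v` on, if `v` is on it. -/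
def suffixFrom (v : Fin N.numV) : List (Fin N.numA) → Timed (Option (List (Fin N.numA)))
  | [] => do
    tick 1
    if v = N.t then pure (some []) else pure none
  | a :: P => do
    tick 1
    let u ← get N.src a
    if u = v then pure (some (a :: P)) else suffixFrom v P

/-- Remove the cycles from a walk ending at `t`. -/
def eraseCycles : List (Fin N.numA) → Timed (List (Fin N.numA))
  | [] => do
    tick 1
    pure []
  | a :: P => do
    tick 1
    let Q ← eraseCycles P
    let u ← get N.src a
    match ← suffixFrom N u Q with
    | some R => pure R
    | none => pure (a :: Q)

/-- The path obtained from a stored walk (last arc first). -/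
def toPath (P : List (Fin N.numA)) : Timed (List (Fin N.numA)) := do
  let Q ← reverse P
  eraseCycles N Q

/-- The ABV algorithm with accuracy `δ` for the weights `w₁`, `w₂`; `none` if there is no path. -/
def abv [FloorSemiring K] (δ : K) (w₁ w₂ : Fin N.numA → K) :
    Timed (Option (List (Fin N.numA))) := do
  let w ← tabulate 0 (fun a => do
    let x ← get w₁ a
    let y ← get w₂ a
    add x y)
  let l ← bellmanFord N w
  match ← get l N.t with
  | none => pure none
  | some (c, P) => do
    let z ← le c 0
    if z then do
      let Q ← toPath N P
      pure (some Q)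
    else do
      let h ← div c 2
      let e ← mul δ h
      let k ← ofNat N.numV
      let θ ← div e k
      let B ← floorDiv c θ
      let v₁ ← tabulate 0 (fun a => do
        let x ← get w₁ a
        floorDiv x θ)
      let v₂ ← tabulate 0 (fun a => do
        let x ← get w₂ a
        floorDiv x θ)
      let T ← dynProg N v₁ v₂ B
      match ← selectBest N B T with
      | none => do
        let Q ← toPath N P
        pure (some Q)
      | some (_, R) => do
        let Q ← toPath N R
        pure (some Q)

end ABV

/-! ## The iterative algorithm -/

/-- An output: the arcs of a path, start times for the corresponding jobs, and the makespan. -/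
structure Solution (n : ℕ) (K : Type) where
  path : List (Fin n)
  start : Fin n × Fin 2 → K
  cmax : K

section UAR

open Timed

variable {K : Type} [Field K] [LinearOrder K] [FloorSemiring K] [BitSize K]

/-- The while loop of `uar`. Here `tot` lists the total processing times, `bigM` is the prohibitive
weight, `w₁, w₂` are the current weights, `D` marks the jobs modified so far, `P` and `c` are the
current path and makespan, and `best` is the best solution so far. The body is executed at most as
often as the first argument says; since each execution marks a new job, the bound `numA` used
below never cuts the loop short. -/
def uarLoop (N : Network) (alg : List (Fin N.numA) → Timed ((Fin N.numA × Fin 2 → K) × K))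
    (ρ δ bigM : K) (tot : Fin N.numA → K) :
    ℕ → (Fin N.numA → K) → (Fin N.numA → K) → (Fin N.numA → Bool) → List (Fin N.numA) → K →
      Solution N.numA K → Timed (Solution N.numA K)
  | 0, _, _, _, _, _, best => pure best
  | k + 1, w₁, w₂, D, P, c, best => do
    let thr ← mul ρ c
    let hit ← any (fun j => get D j) P
    let big ← any (fun j => do
      let x ← get tot j
      le thr x) P
    if !hit && big then do
      let (w₁, w₂, D) ← forEach (fun (st : (Fin N.numA → K) × (Fin N.numA → K) ×
          (Fin N.numA → Bool)) j => do
        let d ← get st.2.2 j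
        let x ← get tot j
        let b ← le thr x
        if !d && b then do
          let w₁ ← set st.1 j bigM
          let w₂ ← set st.2.1 j bigM
          let D ← set st.2.2 j true
          pure (w₁, w₂, D)
        else pure st) (List.finRange N.numA) (w₁, w₂, D)
      match ← abv N δ w₁ w₂ with
      | none => pure best
      | some P => do
        let (σ, c) ← alg P
        let b ← lt c best.cmax
        let best := if b then ⟨P, σ, c⟩ else best
        uarLoop N alg ρ δ bigM tot k w₁ w₂ D P c best
    else pure best

/-- The algorithm `UAR(alg, ρ, 2)` with accuracy `δ` of the path algorithm. -/
def uar (I : ShopPath K) (alg : List (Fin I.numA) → Timed ((Fin I.numA × Fin 2 → K) × K))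
    (ρ δ : K) : Timed (Option (Solution I.numA K)) := do
  let w₁ ← tabulate 0 (fun j => loadT I.job j 0)
  let w₂ ← tabulate 0 (fun j => loadT I.job j 1)
  let tot ← tabulate 0 (fun j => do
    let x ← get w₁ j
    let y ← get w₂ j
    add x y)
  match ← abv I.toNetwork δ w₁ w₂ with
  | none => pure none
  | some P => do
    let (σ, c) ← alg P
    let sum ← forEach (fun z j => do
      let x ← get tot j
      add z x) (List.finRange I.numA) (0 : K)
    let e ← add 1 δ
    let m ← mul e sum
    let bigM ← add m 1
    let D ← fill I.numA false
    let best ← uarLoop I.toNetwork alg ρ δ bigM tot I.numA w₁ w₂ D P c ⟨P, σ, c⟩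
    pure (some best)

/-- The JJAR algorithm with target accuracy `ε`: `UAR` with Jackson's rule and `ρ = 2 / 3`; the
accuracy of the path algorithm is `2 ε / 3`. -/
def jjar (I : ShopPath K) (ε : K) : Timed (Option (Solution I.numA K)) := do
  let δ ← mul (2 / 3) ε
  uar I (jackson I.job) (2 / 3) δ

end UAR

/-! Approximation. Fix a feasible solution with path Q and makespan C. Two lower bounds suffice:
each machine load of Q is at most C (`IsSchedule.loadSum_le`), and so is the total length of each
job of Q (`IsSchedule.load_add_load_le`).

By `jackson_critical`, the makespan C' of Jackson's rule is either bounded by a machine load or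
equal to the length of a critical path through one job u: the jobs up to u on the first machine a of
u, then u and its successors on the second machine b. Johnson's order allows one side of this path
to be charged to the other machine. If p_a(u) ≤ p_b(u), every job before u also has p_a ≤ p_b, so
the path has length at most the load of b plus p_a(u); otherwise it has length at most the load of a
plus p_b(u). In both cases the excess is the shorter operation of u, hence at most half of its total
length. If all jobs are shorter than 2/3 of C', this gives C' ≤ max load + C'/3, so C' ≤ 3/2 max
load (`jackson_le_of_small`).

ABV is a (1 + δ)-approximation for the larger of the two path lengths (`abv_approx`): with c the
shortest length for the sum of the weights, the optimum is at least c/2, and rounding to multiples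
of θ loses at most |V| θ = δ c/2. Hence, as long as no job of Q is marked, the current path P has
max load at most (1 + δ) C and avoids the prohibitive weight M. If P has no job of length at least
2/3 C', then C' ≤ 3/2 (1 + 2ε/3) C = (3/2 + ε) C. If it has one and Q has one too, then C ≥ 2/3 C'
already. In the remaining case the marking leaves Q untouched and the loop continues; each round
marks a new job, so the number of arcs bounds the number of rounds (`uarLoop_approx`).

Running time. All numbers are represented over common denominators: the product of the input
denominators, times factors from δ and the constants 2, 3 and |V|. The weights never grow from round
to round, so the bit lengths stay polynomial. The table is small because c/θ = 2|V|/δ does not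
depend on the processing times.

Comparison with Johnson. Insertion sort with a total transitive relation maps sublists to sublists.
Thus a critical path of Jackson's schedule embeds into the Johnson sequence of all jobs, where the
additional jobs can only lengthen it; a machine load is a lower bound for either Johnson schedule.
-/

namespace Timed

/-! ### Value and cost rules for step-counted loops -/

variable {α β σ : Type}

@[simp] theorem bind_val (x : Timed α) (f : α → Timed β) : (x >>= f).val = (f x.val).val := rfl

@[simp] theorem bind_time (x : Timed α) (f : α → Timed β) :
    (x >>= f).time = x.time + (f x.val).time := rfl

@[simp] theorem pure_val (a : α) : (pure a : Timed α).val = a := rfl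

@[simp] theorem pure_time (a : α) : (pure a : Timed α).time = 0 := rfl

@[simp] theorem tick_time (c : ℕ) : (tick c).time = c := rfl

@[simp] theorem forEach_nil_val (f : σ → α → Timed σ) (s : σ) : (forEach f [] s).val = s := rfl

@[simp] theorem forEach_cons_val (f : σ → α → Timed σ) (x : α) (L : List α) (s : σ) :
    (forEach f (x :: L) s).val = (forEach f L (f s x).val).val := rfl

theorem forEach_nil_time (f : σ → α → Timed σ) (s : σ) : (forEach f [] s).time = 1 := rfl

theorem forEach_cons_time (f : σ → α → Timed σ) (x : α) (L : List α) (s : σ) :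
    (forEach f (x :: L) s).time = 1 + ((f s x).time + (forEach f L (f s x).val).time) := rfl

/-- The invariant rule for loops over a list, with a step-indexed invariant. -/
theorem forEach_spec {f : σ → α → Timed σ} (Inv : ℕ → σ → Prop) (c : ℕ) :
    ∀ (L : List α) (k : ℕ) (s : σ), Inv k s →
      (∀ i s, ∀ x ∈ L, k ≤ i → i < k + L.length → Inv i s →
        Inv (i + 1) (f s x).val ∧ (f s x).time ≤ c) →
      Inv (k + L.length) (forEach f L s).val ∧ (forEach f L s).time ≤ L.length * (c + 1) + 1
  | [], k, s, h, _ => ⟨h, by simp [forEach_nil_time]⟩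
  | x :: L, k, s, h, hs => by
    have h1 := hs k s x (by simp) le_rfl (by simp) h
    have h2 := forEach_spec Inv c L (k + 1) _ h1.1 (fun i s y hy hi hi' => hs i s y
      (by simp [hy]) (by omega) (by simp; omega))
    refine ⟨?_, ?_⟩
    · have : k + (x :: L).length = k + 1 + L.length := by simp; omega
      rw [this]
      exact h2.1
    · rw [forEach_cons_time, List.length_cons, Nat.succ_mul]
      omega

/-- The invariant rule for loops over a list. -/
theorem forEach_inv {f : σ → α → Timed σ} (Inv : σ → Prop) (L : List α) (s : σ) (h : Inv s)
    (hs : ∀ s, ∀ x ∈ L, Inv s → Inv (f s x).val) : Inv (forEach f L s).val := by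
  induction L generalizing s with
  | nil => exact h
  | cons x L ih =>
    exact ih _ (hs _ _ (by simp) h) (fun s y hy => hs s y (by simp [hy]))

/-- The time rule for loops over a list. -/
theorem forEach_time_le {f : σ → α → Timed σ} (Inv : σ → Prop) (c : ℕ) (L : List α) (s : σ)
    (h : Inv s) (hs : ∀ s, ∀ x ∈ L, Inv s → Inv (f s x).val ∧ (f s x).time ≤ c) :
    (forEach f L s).time ≤ L.length * (c + 1) + 1 :=
  (forEach_spec (fun _ => Inv) c L 0 s h (fun _ s x hx _ _ h => hs s x hx h)).2

/-- A property established by the step for `x` and preserved by all steps holds in the end. -/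
theorem forEach_establish {f : σ → α → Timed σ} (Inv : σ → Prop) (G : α → σ → Prop) (L : List α)
    (s : σ) (h : Inv s) (hs : ∀ s, ∀ x ∈ L, Inv s → Inv (f s x).val)
    (hG : ∀ s, ∀ x ∈ L, Inv s → G x (f s x).val)
    (hp : ∀ y s, ∀ x ∈ L, Inv s → G y s → G y (f s x).val) :
    ∀ x ∈ L, G x (forEach f L s).val := by
  induction L generalizing s with
  | nil => simp
  | cons x L ih =>
    intro y hy
    rcases List.mem_cons.1 hy with rfl | hy
    · exact (forEach_inv (fun s => Inv s ∧ G y s) L _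
        ⟨hs _ _ (by simp) h, hG _ _ (by simp) h⟩
        (fun s x hx hI => ⟨hs _ _ (by simp [hx]) hI.1, hp _ _ _ (by simp [hx]) hI.1 hI.2⟩)).2
    · exact ih _ (hs _ _ (by simp) h) (fun s z hz => hs s z (by simp [hz]))
        (fun s z hz => hG s z (by simp [hz])) (fun y s z hz => hp y s z (by simp [hz])) y hy

/-- The invariant rule for counted loops, with a step-indexed invariant. -/
theorem iter_spec {f : σ → Timed σ} (Inv : ℕ → σ → Prop) (c : ℕ) :
    ∀ (m k : ℕ) (s : σ), Inv k s →
      (∀ i s, k ≤ i → i < k + m → Inv i s → Inv (i + 1) (f s).val ∧ (f s).time ≤ c) →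
      Inv (k + m) (iter f m s).val ∧ (iter f m s).time ≤ m * (c + 1) + 1
  | 0, k, s, h, _ => ⟨h, by simp [iter]⟩
  | m + 1, k, s, h, hs => by
    have h1 := hs k s le_rfl (by omega) h
    have h2 := iter_spec Inv c m (k + 1) _ h1.1 (fun i s hi hi' => hs i s (by omega) (by omega))
    refine ⟨?_, ?_⟩
    · have : k + (m + 1) = k + 1 + m := by omega
      rw [this]
      exact h2.1
    · have : (iter f (m + 1) s).time = 1 + ((f s).time + (iter f m (f s).val).time) := rfl
      rw [this, Nat.succ_mul]
      omega

theorem iter_inv {f : σ → Timed σ} (Inv : ℕ → σ → Prop) :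
    ∀ (m k : ℕ) (s : σ), Inv k s → (∀ i s, Inv i s → Inv (i + 1) (f s).val) →
      Inv (k + m) (iter f m s).val
  | 0, _, _, h, _ => h
  | m + 1, k, s, h, hs => by
    have h2 := iter_inv Inv m (k + 1) _ (hs k s h) hs
    have : k + (m + 1) = k + 1 + m := by omega
    rw [this]
    exact h2

@[simp] theorem reverse_val (L : List α) : (reverse L).val = L.reverse := by
  have : ∀ (L K : List α),
      (forEach (fun ys x => (pure (x :: ys) : Timed (List α))) L K).val = L.reverse ++ K := by
    intro L
    induction L with
    | nil => intro K; rfl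
    | cons x L ih => intro K; simp [ih]
  simpa [reverse] using this L []

theorem reverse_time_le (L : List α) : (reverse L).time ≤ L.length * 1 + 1 :=
  forEach_time_le (fun _ => True) 0 L [] trivial (by simp)

/-- The step for i writes the right value into cell i, and no later step destroys it: a step for
another index writes elsewhere, and a repeated one writes the same value. -/
theorem tabulate_spec {n : ℕ} (a₀ : α) (f : Fin n → Timed α) :
    (tabulate a₀ f).val = fun i => (f i).val := by
  ext i
  refine forEach_establish (f := fun A i => do
    let a ← f i
    Timed.set A i a) (fun _ => True) (fun i A => A i = (f i).val) (List.finRange n) (fun _ => a₀)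
    trivial (by simp) ?_ ?_ i (by simp)
  · intro s x _ _
    simp [Timed.set]
  · intro y s x _ _ h
    by_cases hy : y = x
    · subst hy; simp [Timed.set]
    · simp [Timed.set, Function.update_of_ne hy, h]

theorem tabulate_time_le {n : ℕ} (a₀ : α) (f : Fin n → Timed α) (c : ℕ)
    (h : ∀ i, (f i).time ≤ c) : (tabulate a₀ f).time ≤ n + (n * (c + 1 + 1) + 1) := by
  have := forEach_time_le (f := fun A i => do
    let a ← f i
    Timed.set A i a) (fun _ => True) (c + 1) (List.finRange n) (fun _ => a₀) trivial
    (fun s x _ _ => ⟨trivial, by simpa [Timed.set] using h x⟩)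
  rw [List.length_finRange] at this
  exact Nat.add_le_add_left this n

@[simp] theorem filter_cons_val (p : α → Timed Bool) (x : α) (L : List α) :
    (filter p (x :: L)).val =
      if (p x).val then x :: (filter p L).val else (filter p L).val := by
  simp only [filter, bind_val]
  split <;> rfl

@[simp] theorem filter_val (p : α → Timed Bool) (L : List α) :
    (filter p L).val = L.filter (fun x => (p x).val) := by
  induction L with
  | nil => rfl
  | cons x L ih => rw [filter_cons_val, ih, List.filter_cons]

theorem filter_time_le (p : α → Timed Bool) (c : ℕ) (L : List α) (h : ∀ x ∈ L, (p x).time ≤ c) :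
    (filter p L).time ≤ L.length * (c + 1) + 1 := by
  induction L with
  | nil => simp [filter]
  | cons x L ih =>
    have h1 := ih (fun y hy => h y (by simp [hy]))
    have h2 := h x (by simp)
    have : (filter p (x :: L)).time = 1 + ((p x).time + (filter p L).time) := by
      simp only [filter, bind_time, tick_time]
      split <;> simp
    rw [this, List.length_cons, Nat.succ_mul]
    omega

@[simp] theorem any_val (p : α → Timed Bool) (L : List α) :
    (any p L).val = L.any (fun x => (p x).val) := by
  induction L with
  | nil => rfl
  | cons x L ih =>
    simp only [any, bind_val, List.any_cons]
    split <;> simp_all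

theorem any_time_le (p : α → Timed Bool) (c : ℕ) (L : List α) (h : ∀ x ∈ L, (p x).time ≤ c) :
    (any p L).time ≤ L.length * (c + 1) + 1 := by
  induction L with
  | nil => simp [any]
  | cons x L ih =>
    have h1 := ih (fun y hy => h y (by simp [hy]))
    have h2 := h x (by simp)
    simp only [any, bind_time, tick_time]
    rw [List.length_cons, Nat.succ_mul]
    split
    · simp only [pure_time]; omega
    · omega

theorem insert_val (le : α → α → Timed Bool) (x : α) (L : List α) :
    (insert le x L).val = L.orderedInsert (fun a b => (le a b).val = true) x := by
  induction L with
  | nil => rfl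
  | cons y L ih =>
    simp only [insert, bind_val, List.orderedInsert]
    split <;> simp_all

/-- Makes permutation, sortedness and sublist facts about `List.insertionSort` available for the
timed sort. -/
theorem sort_val (le : α → α → Timed Bool) (L : List α) :
    (sort le L).val = L.insertionSort (fun a b => (le a b).val = true) := by
  induction L with
  | nil => rfl
  | cons y L ih => simp [sort, insert_val, ih, List.insertionSort]

theorem insert_time_le (le : α → α → Timed Bool) (c : ℕ) (x : α) (L : List α)
    (h : ∀ x y, (le x y).time ≤ c) : (insert le x L).time ≤ L.length * (c + 1) + 1 := by
  induction L with
  | nil => simp [insert]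
  | cons y L ih =>
    have h2 := h x y
    simp only [insert, bind_time, tick_time]
    rw [List.length_cons, Nat.succ_mul]
    split <;> simp only [pure_time, bind_time] <;> omega

theorem sort_length (le : α → α → Timed Bool) (L : List α) :
    (sort le L).val.length = L.length := by
  rw [sort_val, List.length_insertionSort]

theorem sort_time_le (le : α → α → Timed Bool) (c : ℕ) (L : List α)
    (h : ∀ x y, (le x y).time ≤ c) :
    (sort le L).time ≤ (L.length + 1) * (L.length * (c + 1) + 2) := by
  induction L with
  | nil => simp [sort]
  | cons y L ih =>
    have h2 := insert_time_le le c y (sort le L).val h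
    rw [sort_length] at h2
    simp only [sort, bind_time, tick_time, List.length_cons]
    nlinarith

end Timed

/-! ### Loads, list scheduling and lower bounds on the makespan -/

section Scheduling

variable {K : Type} [Field K] [LinearOrder K] {n : ℕ}

theorem Job.load_nonneg [IsStrictOrderedRing K] (J : Job K) (m : Fin 2) : 0 ≤ J.load m :=
  (J.reroute 0).time_nonneg m

theorem Job.load_of_mem {J : Job K} {m : Fin 2} (h : m ∈ J.route) : J.load m = J.time m := if_pos h

theorem Job.load_of_notMem {J : Job K} {m : Fin 2} (h : m ∉ J.route) : J.load m = 0 := if_neg h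

theorem Job.mem_route_reroute (J : Job K) (a m : Fin 2) : m ∈ (J.reroute a).route := by
  fin_cases a <;> fin_cases m <;> simp [Job.reroute]

@[simp] theorem Job.load_reroute (J : Job K) (a m : Fin 2) : (J.reroute a).load m = J.load m :=
  if_pos (J.mem_route_reroute a m)

/-- A route without repetitions on two machines. -/
theorem Job.route_cases (J : Job K) :
    J.route = [] ∨ J.route = [0] ∨ J.route = [1] ∨ J.route = [0, 1] ∨ J.route = [1, 0] := by
  have key : ∀ r : List (Fin 2), r.Nodup →
      r = [] ∨ r = [0] ∨ r = [1] ∨ r = [0, 1] ∨ r = [1, 0] := by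
    intro r hr
    have hlen := hr.length_le_card
    rw [Fintype.card_fin] at hlen
    match r, hr, hlen with
    | [], _, _ => simp
    | [a], _, _ => clear hr hlen; revert a; decide
    | [a, b], h, _ => clear hr hlen; revert h; revert a b; decide
  exact key _ J.route_nodup

/-- The total load of the listed jobs on a machine. -/
def loadSum (job : Fin n → Job K) (m : Fin 2) (L : List (Fin n)) : K :=
  (L.map fun j => (job j).load m).sum

section LoadSum

variable (job : Fin n → Job K) (m : Fin 2)

@[simp] theorem loadSum_nil : loadSum job m [] = 0 := rfl

@[simp] theorem loadSum_cons (j : Fin n) (L : List (Fin n)) :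
    loadSum job m (j :: L) = (job j).load m + loadSum job m L := by simp [loadSum]

@[simp] theorem loadSum_append (L L' : List (Fin n)) :
    loadSum job m (L ++ L') = loadSum job m L + loadSum job m L' := by simp [loadSum]

theorem loadSum_perm {L L' : List (Fin n)} (h : L.Perm L') :
    loadSum job m L = loadSum job m L' := (h.map _).sum_eq

variable [IsStrictOrderedRing K]

theorem loadSum_nonneg (L : List (Fin n)) : 0 ≤ loadSum job m L := by
  induction L with
  | nil => simp
  | cons j L ih => simpa using add_nonneg ((job j).load_nonneg m) ih

theorem loadSum_sublist {L L' : List (Fin n)} (h : L.Sublist L') :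
    loadSum job m L ≤ loadSum job m L' := by
  induction h with
  | slnil => simp
  | cons j h ih => simpa using ih.trans (le_add_of_nonneg_left ((job j).load_nonneg m))
  | cons_cons j h ih => simpa using ih

end LoadSum

/-- List scheduling on machine `m` with ready times `r`. -/
def place (job : Fin n → Job K) (m : Fin 2) (r : Fin n → K) :
    List (Fin n) → (Fin n × Fin 2 → K) × K → (Fin n × Fin 2 → K) × K
  | [], st => st
  | j :: L, st => place job m r L
      (Function.update st.1 (j, m) (max st.2 (r j)), max st.2 (r j) + (job j).load m)

theorem place_append (job : Fin n → Job K) (m : Fin 2) (r : Fin n → K) (L L' : List (Fin n))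
    (st : (Fin n × Fin 2 → K) × K) :
    place job m r (L ++ L') st = place job m r L' (place job m r L st) := by
  induction L generalizing st with
  | nil => rfl
  | cons j L ih => exact ih _

/-- Ready times 0 never delay a machine whose clock is nonnegative, so processing without delay is
the list scheduling `place` with `r = 0`. -/
theorem placeFirst_val [IsStrictOrderedRing K] [BitSize K] (job : Fin n → Job K) (m : Fin 2)
    (L : List (Fin n)) (st : (Fin n × Fin 2 → K) × K) (h : 0 ≤ st.2) :
    (placeFirst job m L st).val = place job m 0 L st := by
  induction L generalizing st with
  | nil => rfl
  | cons j L ih =>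
    have : (placeFirst job m (j :: L) st).val = (placeFirst job m L
      (Function.update st.1 (j, m) st.2, st.2 + (job j).load m)).val := rfl
    rw [this, ih _ (add_nonneg h ((job j).load_nonneg m)), place]
    simp [h]

/-- Only start times on b are written, so the completion times on a that are read during the loop
are those of the initial state; the ready times can be frozen there. -/
theorem placeSecond_val [BitSize K] (job : Fin n → Job K) {a b : Fin 2} (hab : a ≠ b)
    (L : List (Fin n)) (st : (Fin n × Fin 2 → K) × K) :
    (placeSecond job a b L st).val =
      place job b (fun j => st.1 (j, a) + (job j).load a) L st := by
  induction L generalizing st with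
  | nil => rfl
  | cons j L ih =>
    have : (placeSecond job a b (j :: L) st).val = (placeSecond job a b L
      (Function.update st.1 (j, b) (max st.2 (st.1 (j, a) + (job j).load a)),
        max st.2 (st.1 (j, a) + (job j).load a) + (job j).load b)).val := rfl
    rw [this, ih, place]
    simp [hab]

section Place

variable (job : Fin n → Job K) (m : Fin 2) (r : Fin n → K)

theorem place_of_ne (L : List (Fin n)) (st : (Fin n × Fin 2 → K) × K) {j : Fin n} {m' : Fin 2}
    (h : m' ≠ m ∨ j ∉ L) : (place job m r L st).1 (j, m') = st.1 (j, m') := by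
  induction L generalizing st with
  | nil => rfl
  | cons i L ih =>
    rw [place, ih _ (by simp at h; tauto)]
    refine Function.update_of_ne ?_ _ _
    simp only [ne_eq, Prod.mk.injEq, not_and]
    rintro rfl
    simpa using h

variable [IsStrictOrderedRing K]

theorem add_loadSum_le_place (L : List (Fin n)) (st : (Fin n × Fin 2 → K) × K) :
    st.2 + loadSum job m L ≤ (place job m r L st).2 := by
  induction L generalizing st with
  | nil => simp [place]
  | cons i L ih =>
    rw [place, loadSum_cons, ← add_assoc]
    refine le_trans ?_ (ih _)
    rw [add_le_add_iff_right]
    exact add_le_add_left (le_max_left st.2 (r i)) _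

theorem le_place (L : List (Fin n)) (st : (Fin n × Fin 2 → K) × K) :
    st.2 ≤ (place job m r L st).2 :=
  (le_add_of_nonneg_right (loadSum_nonneg job m L)).trans (add_loadSum_le_place job m r L st)

/-- Every job u, critical or not, gives a lower bound: after its release, u and all its successors
still have to pass the machine. Converse direction to `place_critical`, used for the Johnson
schedules. -/
theorem ready_add_loadSum_le_place (A : List (Fin n)) (u : Fin n) (B : List (Fin n))
    (st : (Fin n × Fin 2 → K) × K) :
    r u + (job u).load m + loadSum job m B ≤ (place job m r (A ++ u :: B) st).2 := by
  rw [place_append, place]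
  refine le_trans ?_ (add_loadSum_le_place job m r B _)
  rw [add_le_add_iff_right]
  exact add_le_add_left (le_max_right _ (r u)) _

omit [IsStrictOrderedRing K] in
/-- The critical path of a list schedule. -/
theorem place_critical (L : List (Fin n)) (st : (Fin n × Fin 2 → K) × K) :
    (place job m r L st).2 = st.2 + loadSum job m L ∨ ∃ A u B, L = A ++ u :: B ∧
      (place job m r L st).2 = r u + (job u).load m + loadSum job m B := by
  induction L generalizing st with
  | nil => simp [place]
  | cons i L ih =>
    rcases ih (Function.update st.1 (i, m) (max st.2 (r i)), max st.2 (r i) + (job i).load m) with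
      h | ⟨A, u, B, rfl, h⟩
    · rw [place, h]
      rcases le_total st.2 (r i) with h' | h'
      · exact .inr ⟨[], i, L, rfl, by simp [h']⟩
      · exact .inl (by simp [h', add_assoc])
    · exact .inr ⟨i :: A, u, B, rfl, by rw [place, h]⟩

theorem place_start {L : List (Fin n)} (hL : L.Nodup) (st : (Fin n × Fin 2 → K) × K) {j : Fin n}
    (hj : j ∈ L) : st.2 ≤ (place job m r L st).1 (j, m) ∧ r j ≤ (place job m r L st).1 (j, m) ∧
      (place job m r L st).1 (j, m) + (job j).load m ≤ (place job m r L st).2 := by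
  induction L generalizing st with
  | nil => simp at hj
  | cons i L ih =>
    rw [List.nodup_cons] at hL
    rw [place]
    rcases List.mem_cons.1 hj with rfl | hj
    · rw [place_of_ne _ _ _ _ _ (.inr hL.1)]
      simpa using le_place job m r L
        (Function.update st.1 (j, m) (max st.2 (r j)), max st.2 (r j) + (job j).load m)
    · refine ⟨le_trans ?_ (ih hL.2 _ hj).1, (ih hL.2 _ hj).2⟩
      exact (le_max_left _ _).trans (le_add_of_nonneg_right ((job i).load_nonneg m))

theorem place_pairwise {L : List (Fin n)} (hL : L.Nodup) (st : (Fin n × Fin 2 → K) × K) :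
    L.Pairwise (fun i j => (place job m r L st).1 (i, m) + (job i).load m ≤
      (place job m r L st).1 (j, m)) := by
  induction L generalizing st with
  | nil => simp
  | cons i L ih =>
    rw [List.nodup_cons] at hL
    rw [place]
    refine List.pairwise_cons.2 ⟨fun j hj => ?_, ih hL.2 _⟩
    rw [place_of_ne _ _ _ _ _ (.inr hL.1)]
    simpa using (place_start job m r hL.2
      (Function.update st.1 (i, m) (max st.2 (r i)), max st.2 (r i) + (job i).load m) hj).1

theorem place_zero {L : List (Fin n)} (st : (Fin n × Fin 2 → K) × K) (h : 0 ≤ st.2) :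
    (place job m 0 L st).2 = st.2 + loadSum job m L := by
  induction L generalizing st with
  | nil => simp [place]
  | cons i L ih =>
    rw [place, ih]
    · simp [h, add_assoc]
    · simpa [h] using add_nonneg h ((job i).load_nonneg m)

/-- Without ready times there is no idle time, so u starts after exactly the load of its
predecessors. The condition `u ∉ B` excludes that its entry is overwritten later. -/
theorem place_zero_start {A B : List (Fin n)} {u : Fin n} (st : (Fin n × Fin 2 → K) × K)
    (h : 0 ≤ st.2) (hu : u ∉ B) :
    (place job m 0 (A ++ u :: B) st).1 (u, m) = st.2 + loadSum job m A := by
  have h' : 0 ≤ st.2 + loadSum job m A := add_nonneg h (loadSum_nonneg job m A)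
  rw [place_append, place, place_of_ne _ _ _ _ _ (.inr hu), place_zero job m st h]
  simpa using h'

end Place

section Makespan

variable (job : Fin n → Job K) (σ : Fin n × Fin 2 → K)

theorem foldr_max_le_iff (l : List K) (c : K) :
    l.foldr max 0 ≤ c ↔ 0 ≤ c ∧ ∀ x ∈ l, x ≤ c := by
  induction l with
  | nil => simp
  | cons x l ih => simp [ih]; tauto

theorem makespan_le_iff (S : Finset (Fin n)) (c : K) : makespan job S σ ≤ c ↔
    0 ≤ c ∧ ∀ j ∈ S, ∀ m ∈ (job j).route, σ (j, m) + (job j).load m ≤ c := by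
  unfold makespan
  rw [Finset.fold_max_le]
  simp only [foldr_max_le_iff, List.mem_map, forall_exists_index, and_imp,
    forall_apply_eq_imp_iff₂]
  refine and_congr_right fun h => forall₂_congr fun j hj => ?_
  simp only [h, true_and]
  exact forall₂_congr fun m hm => by rw [Job.load_of_mem hm]

theorem makespan_nonneg (S : Finset (Fin n)) : 0 ≤ makespan job S σ :=
  ((makespan_le_iff job σ S _).1 le_rfl).1

theorem le_makespan {S : Finset (Fin n)} {j : Fin n} (hj : j ∈ S) {m : Fin 2}
    (hm : m ∈ (job j).route) : σ (j, m) + (job j).load m ≤ makespan job S σ :=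
  ((makespan_le_iff job σ S _).1 le_rfl).2 j hj m hm

end Makespan

section LowerBounds

variable [IsStrictOrderedRing K] {job : Fin n → Job K} {σ : Fin n × Fin 2 → K}

/-- Disjoint intervals in `[0, C]` have total length at most `C`. -/
theorem sum_length_le {ι : Type} (S : Finset ι) (s p : ι → K) (hp : ∀ i ∈ S, 0 < p i)
    (hd : ∀ i ∈ S, ∀ j ∈ S, i ≠ j → s i + p i ≤ s j ∨ s j + p j ≤ s i) :
    ∀ C, 0 ≤ C → (∀ i ∈ S, 0 ≤ s i ∧ s i + p i ≤ C) → ∑ i ∈ S, p i ≤ C := by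
  classical
  -- Remove the interval a with the latest start. Since lengths are positive, no other interval can
  -- lie after it, so the others fit into [0, s a] and the induction hypothesis applies with C := s
  -- a.
  induction S using Finset.induction_on_max_value s with
  | empty => simp
  | @insert a S ha hmax ih =>
    intro C _ hC
    rw [Finset.sum_insert ha]
    have h1 := hC a (by simp)
    have := ih (fun i hi => hp i (by simp [hi]))
      (fun i hi j hj => hd i (by simp [hi]) j (by simp [hj])) (s a) h1.1 (fun i hi => by
        refine ⟨(hC i (by simp [hi])).1, ?_⟩
        rcases hd i (by simp [hi]) a (by simp) (fun h => ha (h ▸ hi)) with h | h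
        · exact h
        · have := hmax i hi
          have := hp a (by simp)
          linarith)
    linarith

omit [IsStrictOrderedRing K] in
theorem loadSum_toFinset (m : Fin 2) {L : List (Fin n)} (hL : L.Nodup) :
    loadSum job m L = ∑ j ∈ L.toFinset, (job j).load m := by
  rw [List.sum_toFinset _ hL, loadSum]

/-- Only operations of positive length contribute. Restricting to them ensures both the positivity
needed for packing intervals and that the machine really is on the route, so that the constraints of
the schedule apply. -/
theorem IsSchedule.loadSum_le {L : List (Fin n)} (hL : L.Nodup)
    (h : IsSchedule job L.toFinset σ) (m : Fin 2) :
    loadSum job m L ≤ makespan job L.toFinset σ := by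
  rw [loadSum_toFinset m hL, ← Finset.sum_filter_of_ne (p := fun j => 0 < (job j).load m)
    (fun j _ hj => lt_of_le_of_ne ((job j).load_nonneg m) (Ne.symm hj))]
  have key : ∀ j ∈ L.toFinset.filter (fun j => 0 < (job j).load m),
      j ∈ L.toFinset ∧ m ∈ (job j).route := by
    intro j hj
    rw [Finset.mem_filter] at hj
    refine ⟨hj.1, ?_⟩
    by_contra hm
    rw [Job.load_of_notMem hm] at hj
    exact lt_irrefl _ hj.2
  refine sum_length_le _ (fun j => σ (j, m)) _ (fun j hj => (Finset.mem_filter.1 hj).2) ?_ _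
    (makespan_nonneg _ _ _) ?_
  · intro i hi j hj hij
    have := h.machine i (key i hi).1 j (key j hj).1 hij m (key i hi).2 (key j hj).2
    rwa [← Job.load_of_mem (key i hi).2, ← Job.load_of_mem (key j hj).2] at this
  · intro i hi
    exact ⟨h.nonneg i (key i hi).1 m (key i hi).2, le_makespan job σ (key i hi).1 (key i hi).2⟩

/-- The operations of one job are processed one after the other. This bound lets the algorithm stop
worrying about a competing path that contains a job above the threshold. -/
theorem IsSchedule.load_add_load_le {S : Finset (Fin n)} (h : IsSchedule job S σ) {j : Fin n}
    (hj : j ∈ S) : (job j).load 0 + (job j).load 1 ≤ makespan job S σ := by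
  have h0 := makespan_nonneg job σ S
  have hm := fun m => le_makespan job σ hj (m := m)
  have hn := h.nonneg j hj
  have hc := h.chain j hj
  have ht := fun m => @Job.load_of_mem _ _ _ (job j) m
  have ht' := fun m => @Job.load_of_notMem _ _ _ (job j) m
  rcases (job j).route_cases with hr | hr | hr | hr | hr <;> rw [hr] at hm hn hc ht ht'
  · rw [ht' 0 (by simp), ht' 1 (by simp)]; simpa using h0
  · rw [ht' 1 (by simp)]; linarith [hm 0 (by simp), hn 0 (by simp)]
  · rw [ht' 0 (by simp)]; linarith [hm 1 (by simp), hn 1 (by simp)]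
  · rw [List.isChain_cons_cons] at hc
    linarith [hm 1 (by simp), hn 0 (by simp), ht 0 (by simp), ht 1 (by simp), hc.1]
  · rw [List.isChain_cons_cons] at hc
    linarith [hm 0 (by simp), hn 1 (by simp), ht 0 (by simp), ht 1 (by simp), hc.1]

end LowerBounds

/-! ### Johnson's order and its stability under passing to sublists -/

section Johnson

variable [BitSize K] (job : Fin n → Job K)

/-- Johnson's order. -/
def JohnsonRel (a b : Fin 2) (i j : Fin n) : Prop := (johnsonLe job a b i j).val = true

instance (a b : Fin 2) : DecidableRel (JohnsonRel job a b) :=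
  fun i j => inferInstanceAs (Decidable ((johnsonLe job a b i j).val = true))

theorem johnsonRel_iff (a b : Fin 2) (i j : Fin n) : JohnsonRel job a b i j ↔
    ((job i).load a ≤ (job i).load b ∧
      ((job j).load a ≤ (job j).load b → (job i).load a ≤ (job j).load a)) ∨
    ((job i).load b < (job i).load a ∧ (job j).load b < (job j).load a ∧
      (job j).load b ≤ (job i).load b) := by
  unfold JohnsonRel johnsonLe
  simp only [Timed.bind_val, loadT, Timed.le]
  by_cases h1 : (job i).load a ≤ (job i).load b <;>
    by_cases h2 : (job j).load a ≤ (job j).load b <;>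
      simp [h1, h2, not_lt.2, not_le.1]

instance (a b : Fin 2) : Std.Total (JohnsonRel job a b) where
  total i j := by
    simp only [johnsonRel_iff]
    grind

instance (a b : Fin 2) : IsTrans (Fin n) (JohnsonRel job a b) where
  trans i j k := by
    simp only [johnsonRel_iff]
    grind

theorem johnsonRel_reroute (a b c : Fin 2) (i j : Fin n) :
    JohnsonRel (fun j => (job j).reroute c) a b i j ↔ JohnsonRel job a b i j := by
  simp [johnsonRel_iff]

theorem johnsonSort_val (a b : Fin 2) (L : List (Fin n)) :
    (johnsonSort job a b L).val = L.insertionSort (JohnsonRel job a b) := by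
  rw [johnsonSort, Timed.sort_val]
  rfl

theorem johnsonSort_perm (a b : Fin 2) (L : List (Fin n)) :
    (johnsonSort job a b L).val.Perm L := by
  rw [johnsonSort_val]
  exact List.perm_insertionSort _ _

theorem johnsonSort_pairwise (a b : Fin 2) (L : List (Fin n)) :
    (johnsonSort job a b L).val.Pairwise (JohnsonRel job a b) := by
  rw [johnsonSort_val]
  exact List.pairwise_insertionSort _ _

/-- An additional element is inserted without disturbing the others, and inserting the same element
into a sorted list and into a sublist of it preserves the sublist relation. Hence the Johnson order
of the jobs of one route sits inside that of all jobs, ties included. -/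
theorem insertionSort_sublist {α : Type} (r : α → α → Prop) [DecidableRel r] [Std.Total r]
    [IsTrans α r] {L L' : List α} (h : L.Sublist L') :
    (L.insertionSort r).Sublist (L'.insertionSort r) := by
  induction h with
  | slnil => simp
  | cons x h ih => exact ih.trans (List.sublist_orderedInsert _ _)
  | cons_cons x h ih =>
    exact List.Sublist.orderedInsert_sublist _ ih (List.pairwise_insertionSort _ _)

theorem johnsonSort_sublist (a b : Fin 2) {L L' : List (Fin n)} (h : L.Sublist L') :
    (johnsonSort job a b L).val.Sublist (johnsonSort job a b L').val := by
  rw [johnsonSort_val, johnsonSort_val]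
  exact insertionSort_sublist _ h

theorem johnsonSort_reroute (a b c : Fin 2) (L : List (Fin n)) :
    (johnsonSort (fun j => (job j).reroute c) a b L).val = (johnsonSort job a b L).val := by
  simp only [johnsonSort_val]
  congr 1
  ext i j
  exact johnsonRel_reroute job a b c i j

end Johnson

end Scheduling

/-! ### Jackson's rule: feasibility, critical paths, comparison with Johnson's rule -/

section Scheduling

variable {K : Type} [Field K] [LinearOrder K] [IsStrictOrderedRing K] {n : ℕ}

omit [IsStrictOrderedRing K] in
theorem loadSum_reroute (job : Fin n → Job K) (a m : Fin 2) (L : List (Fin n)) :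
    loadSum (fun j => (job j).reroute a) m L = loadSum job m L := by simp [loadSum]

theorem loadSum_subset (job : Fin n → Job K) (m : Fin 2) {L L' : List (Fin n)} (hL : L.Nodup)
    (h : L ⊆ L') : loadSum job m L ≤ loadSum job m L' := by
  obtain ⟨L₁, h₁, h₂⟩ := hL.subperm h
  rw [← loadSum_perm job m h₁]
  exact loadSum_sublist job m h₂

omit [IsStrictOrderedRing K] in
-- The clock is the completion time of the last listed job. This is what makes the computed makespan
-- equal to the true one and not merely an upper bound.
theorem place_attained (job : Fin n → Job K) (m : Fin 2) (r : Fin n → K) {L : List (Fin n)}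
    (hL : L.Nodup) (st : (Fin n × Fin 2 → K) × K) :
    (place job m r L st).2 = st.2 ∨ ∃ j ∈ L,
      (place job m r L st).2 = (place job m r L st).1 (j, m) + (job j).load m := by
  rcases List.eq_nil_or_concat' L with rfl | ⟨A, j, rfl⟩
  · exact .inl rfl
  · refine .inr ⟨j, by simp, ?_⟩
    simp [place_append, place]

/-- A machine that first processes the jobs of `X` without idle time and then those of `Z` by list
scheduling. -/
theorem two_stage {job : Fin n → Job K} {m : Fin 2} {X Z : List (Fin n)} (hX : (X ++ Z).Nodup)
    {σ σ₀ σ₁ : Fin n × Fin 2 → K} {r : Fin n → K}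
    (h₁ : ∀ j ∈ X, σ (j, m) = (place job m 0 X (σ₀, 0)).1 (j, m))
    (h₂ : ∀ j ∈ Z, σ (j, m) = (place job m r Z (σ₁, loadSum job m X)).1 (j, m)) :
    ((X ++ Z).Pairwise fun i j => σ (i, m) + (job i).load m ≤ σ (j, m)) ∧
    (∀ j ∈ X ++ Z, 0 ≤ σ (j, m) ∧
      σ (j, m) + (job j).load m ≤ (place job m r Z (σ₁, loadSum job m X)).2) ∧
    ((place job m r Z (σ₁, loadSum job m X)).2 = 0 ∨ ∃ j ∈ X ++ Z,
      (place job m r Z (σ₁, loadSum job m X)).2 = σ (j, m) + (job j).load m) := by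
  have hXn := (List.nodup_append.1 hX).1
  have hZn := (List.nodup_append.1 hX).2.1
  have hsum := place_zero job m (L := X) (σ₀, 0) le_rfl
  rw [zero_add] at hsum
  have e₁ : ∀ j ∈ X, 0 ≤ σ (j, m) ∧ σ (j, m) + (job j).load m ≤ loadSum job m X := by
    intro j hj
    have := place_start job m 0 hXn (σ₀, 0) hj
    rw [hsum, ← h₁ j hj] at this
    exact ⟨this.1, this.2.2⟩
  have e₂ : ∀ j ∈ Z, loadSum job m X ≤ σ (j, m) ∧
      σ (j, m) + (job j).load m ≤ (place job m r Z (σ₁, loadSum job m X)).2 := by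
    intro j hj
    have := place_start job m r hZn (σ₁, loadSum job m X) hj
    rw [← h₂ j hj] at this
    exact ⟨this.1, this.2.2⟩
  have hle := le_place job m r Z (σ₁, loadSum job m X)
  refine ⟨List.pairwise_append.2 ⟨?_, ?_, fun i hi j hj => (e₁ i hi).2.trans (e₂ j hj).1⟩, ?_, ?_⟩
  · refine (place_pairwise job m 0 hXn (σ₀, 0)).imp_of_mem fun {i j} hi hj h => ?_
    rwa [h₁ i hi, h₁ j hj]
  · refine (place_pairwise job m r hZn (σ₁, loadSum job m X)).imp_of_mem fun {i j} hi hj h => ?_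
    rwa [h₂ i hi, h₂ j hj]
  · intro j hj
    rcases List.mem_append.1 hj with hj | hj
    · exact ⟨(e₁ j hj).1, (e₁ j hj).2.trans hle⟩
    · exact ⟨(loadSum_nonneg job m X).trans (e₂ j hj).1, (e₂ j hj).2⟩
  · rcases place_attained job m r hZn (σ₁, loadSum job m X) with h | ⟨j, hj, h⟩
    · rcases place_attained job m 0 hXn (σ₀, 0) with h' | ⟨j, hj, h'⟩
      · rw [hsum] at h'
        exact .inl (h.trans h')
      · rw [hsum, ← h₁ j hj] at h'
        exact .inr ⟨j, by simp [hj], h.trans h'⟩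
    · exact .inr ⟨j, by simp [hj], by rw [h, ← h₂ j hj]⟩

variable [BitSize K]

/-- The jobs of `L` with route `a → 1 - a`, in Johnson's order. -/
def sorted (job : Fin n → Job K) (a : Fin 2) (L : List (Fin n)) : List (Fin n) :=
  (johnsonSort job a (1 - a) (L.filter fun j => (job j).route = [a, 1 - a])).val

/-- The jobs of `L` with a single operation, on machine `a`. -/
def singles (job : Fin n → Job K) (a : Fin 2) (L : List (Fin n)) : List (Fin n) :=
  L.filter fun j => (job j).route = [a]

variable (job : Fin n → Job K)

omit [IsStrictOrderedRing K] in
theorem mem_sorted {a : Fin 2} {L : List (Fin n)} {j : Fin n} :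
    j ∈ sorted job a L ↔ j ∈ L ∧ (job j).route = [a, 1 - a] := by
  rw [sorted, (johnsonSort_perm job _ _ _).mem_iff]
  simp

omit [IsStrictOrderedRing K] [BitSize K] in
theorem mem_singles {a : Fin 2} {L : List (Fin n)} {j : Fin n} :
    j ∈ singles job a L ↔ j ∈ L ∧ (job j).route = [a] := by simp [singles]

omit [IsStrictOrderedRing K] in
-- The three blocks of a machine belong to different routes, hence are disjoint.
theorem nodup_machine (a : Fin 2) {L : List (Fin n)} (hL : L.Nodup) :
    (sorted job a L ++ singles job a L ++ sorted job (1 - a) L).Nodup := by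
  have h1 : ∀ a, (sorted job a L).Nodup := fun a => by
    rw [sorted, (johnsonSort_perm job _ _ _).nodup_iff]
    exact hL.filter _
  rw [List.nodup_append, List.nodup_append]
  refine ⟨⟨h1 a, hL.filter _, ?_⟩, h1 _, ?_⟩
  · rintro i hi j hj rfl
    rw [mem_sorted] at hi
    rw [mem_singles, hi.2] at hj
    simpa using hj.2
  · rintro i hi j hj rfl
    rw [List.mem_append, mem_sorted, mem_singles] at hi
    rw [mem_sorted] at hj
    have := hj.2
    rcases hi with hi | hi <;> rw [hi.2] at this
    · revert this; clear hi hj; revert a; decide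
    · simp at this

omit [IsStrictOrderedRing K] in
-- The five possible routes are checked: a route visits a exactly if it is `[a, 1 - a]`, `[a]` or
-- `[1 - a, a]`.
theorem mem_machine {a : Fin 2} {L : List (Fin n)} {j : Fin n} :
    j ∈ sorted job a L ++ singles job a L ++ sorted job (1 - a) L ↔
      j ∈ L ∧ a ∈ (job j).route := by
  simp only [List.mem_append, mem_sorted, mem_singles, ← and_or_left]
  refine and_congr_right fun _ => ?_
  have h := (job j).route_cases
  generalize (job j).route = r at h
  revert a
  rcases h with rfl | rfl | rfl | rfl | rfl <;> decide

/-- Machine `0` after the jobs with route `0 → 1` and those with an operation on machine `0` only. -/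
def stage₁ (L : List (Fin n)) : (Fin n × Fin 2 → K) × K :=
  place job 0 0 (sorted job 0 L ++ singles job 0 L) (fun _ => 0, 0)

/-- Machine `1` after the jobs with route `1 → 0` and those with an operation on machine `1` only. -/
def stage₂ (L : List (Fin n)) : (Fin n × Fin 2 → K) × K :=
  place job 1 0 (sorted job 1 L ++ singles job 1 L) ((stage₁ job L).1, 0)

/-- The final block of machine `0`: the jobs with route `1 → 0`. -/
def stage₃ (L : List (Fin n)) : (Fin n × Fin 2 → K) × K :=
  place job 0 (fun j => (stage₂ job L).1 (j, 1) + (job j).load 1) (sorted job 1 L)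
    ((stage₂ job L).1, loadSum job 0 (sorted job 0 L ++ singles job 0 L))

/-- The final block of machine `1`: the jobs with route `0 → 1`. -/
def stage₄ (L : List (Fin n)) : (Fin n × Fin 2 → K) × K :=
  place job 1 (fun j => (stage₃ job L).1 (j, 0) + (job j).load 0) (sorted job 0 L)
    ((stage₃ job L).1, loadSum job 1 (sorted job 1 L ++ singles job 1 L))

/-- The leading two blocks of each machine merge into a single run with ready times 0, so four list
schedules describe the whole program. -/
theorem jackson_val (L : List (Fin n)) :
    (jackson job L).val = ((stage₄ job L).1, max (stage₃ job L).2 (stage₄ job L).2) := by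
  have h00 : ∀ m X (σ : Fin n × Fin 2 → K), (0 : K) ≤ (place job m 0 X (σ, 0)).2 :=
    fun m X σ => le_place job m 0 X (σ, 0)
  have h1 : (stage₁ job L).2 = loadSum job 0 (sorted job 0 L ++ singles job 0 L) := by
    rw [stage₁, place_zero job _ _ le_rfl, zero_add]
  have h2 : (stage₂ job L).2 = loadSum job 1 (sorted job 1 L ++ singles job 1 L) := by
    rw [stage₂, place_zero job _ _ le_rfl, zero_add]
  have e1 : (placeFirst job 0 (singles job 0 L)
      (placeFirst job 0 (sorted job 0 L) (fun _ => 0, 0)).val).val = stage₁ job L := by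
    rw [placeFirst_val _ _ _ (_, 0) le_rfl, placeFirst_val _ _ _ _ (h00 _ _ _), ← place_append]
    rfl
  have e2 : (placeFirst job 1 (singles job 1 L)
      (placeFirst job 1 (sorted job 1 L) ((stage₁ job L).1, 0)).val).val = stage₂ job L := by
    rw [placeFirst_val _ _ _ (_, 0) le_rfl, placeFirst_val _ _ _ _ (h00 _ _ _), ← place_append]
    rfl
  have e3 : (placeSecond job 1 0 (sorted job 1 L) ((stage₂ job L).1, (stage₁ job L).2)).val =
      stage₃ job L := by
    rw [placeSecond_val _ (by decide), h1]
    rfl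
  have e4 : (placeSecond job 0 1 (sorted job 0 L) ((stage₃ job L).1, (stage₂ job L).2)).val =
      stage₄ job L := by
    rw [placeSecond_val _ (by decide), h2]
    rfl
  rw [← e4, ← e3, ← e2, ← e1]
  simp only [jackson, Timed.bind_val, Timed.filter_val, hasRoute]
  rfl

omit [IsStrictOrderedRing K] in
theorem stage₄_zero (L : List (Fin n)) (j : Fin n) :
    (stage₄ job L).1 (j, 0) = (stage₃ job L).1 (j, 0) :=
  place_of_ne _ _ _ _ _ (.inl (by decide))

omit [IsStrictOrderedRing K] in
theorem stage₃_one (L : List (Fin n)) (j : Fin n) :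
    (stage₃ job L).1 (j, 1) = (stage₂ job L).1 (j, 1) :=
  place_of_ne _ _ _ _ _ (.inl (by decide))

omit [IsStrictOrderedRing K] in
theorem stage₂_zero (L : List (Fin n)) (j : Fin n) :
    (stage₂ job L).1 (j, 0) = (stage₁ job L).1 (j, 0) :=
  place_of_ne _ _ _ _ _ (.inl (by decide))

variable {L : List (Fin n)} (hL : L.Nodup)
include hL

/-- The properties of the schedule of Jackson's rule on one machine. -/
theorem jackson_machine (a : Fin 2) : ∃ c,
    (if a = 0 then (stage₃ job L).2 else (stage₄ job L).2) = c ∧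
    ((sorted job a L ++ singles job a L ++ sorted job (1 - a) L).Pairwise
      fun i j => (stage₄ job L).1 (i, a) + (job i).load a ≤ (stage₄ job L).1 (j, a)) ∧
    (∀ j ∈ sorted job a L ++ singles job a L ++ sorted job (1 - a) L,
      0 ≤ (stage₄ job L).1 (j, a) ∧ (stage₄ job L).1 (j, a) + (job j).load a ≤ c) ∧
    (c = 0 ∨ ∃ j ∈ sorted job a L ++ singles job a L ++ sorted job (1 - a) L,
      c = (stage₄ job L).1 (j, a) + (job j).load a) := by
  refine ⟨_, rfl, ?_⟩
  have hdisj := List.nodup_append.1 (nodup_machine job a hL)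
  fin_cases a
  · refine two_stage (σ₀ := fun _ => 0) (nodup_machine job 0 hL) (fun j hj => ?_) (fun j hj => ?_)
    · exact (stage₄_zero job L j).trans ((place_of_ne _ _ _ _ _
        (.inr fun h => hdisj.2.2 j hj j h rfl)).trans (stage₂_zero job L j))
    · exact stage₄_zero job L j
  · refine two_stage (σ₀ := (stage₁ job L).1) (nodup_machine job 1 hL) (fun j hj => ?_) (fun j hj => rfl)
    exact (place_of_ne _ _ _ _ _ (.inr fun h => hdisj.2.2 j hj j h rfl)).trans
      (stage₃_one job L j)

/-- Disjointness on a machine is the order of its blocks. The chain constraint holds because the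
second operation of a two-operation job lies in a final block, where its ready time is the
completion of the first one. -/
theorem jackson_isSchedule : IsSchedule job L.toFinset (jackson job L).val.1 := by
  rw [jackson_val]
  refine ⟨fun j hj m hm => ?_, fun j hj => ?_, fun i hi j hj hij m hmi hmj => ?_⟩
  · obtain ⟨c, -, -, h, -⟩ := jackson_machine job hL m
    exact (h j ((mem_machine job).2 ⟨by simpa using hj, hm⟩)).1
  · have hn := nodup_machine job 0 hL
    rw [List.append_assoc] at hn
    rw [List.mem_toFinset] at hj
    have h01 : (job j).route = [0, 1] →
        (stage₄ job L).1 (j, 0) + (job j).load 0 ≤ (stage₄ job L).1 (j, 1) := by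
      intro hr
      rw [stage₄_zero]
      exact (place_start job 1 (fun j => (stage₃ job L).1 (j, 0) + (job j).load 0) (List.nodup_append.1 hn).1
        ((stage₃ job L).1, loadSum job 1 (sorted job 1 L ++ singles job 1 L)) ((mem_sorted job).2 ⟨hj, hr⟩)).2.1
    have h10 : (job j).route = [1, 0] →
        (stage₄ job L).1 (j, 1) + (job j).load 1 ≤ (stage₄ job L).1 (j, 0) := by
      intro hr
      rw [stage₄_zero]
      have : (stage₄ job L).1 (j, 1) = (stage₂ job L).1 (j, 1) :=
        (place_of_ne _ _ _ _ _ (.inr fun h => by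
          rw [mem_sorted, hr] at h; simp at h)).trans (stage₃_one job L j)
      rw [this]
      exact (place_start job 0 (fun j => (stage₂ job L).1 (j, 1) + (job j).load 1)
        (List.nodup_append.1 (nodup_machine job 0 hL)).2.1
        ((stage₂ job L).1, loadSum job 0 (sorted job 0 L ++ singles job 0 L)) ((mem_sorted job).2 ⟨hj, hr⟩)).2.1
    have ht := fun m => @Job.load_of_mem _ _ _ (job j) m
    rcases (job j).route_cases with hr | hr | hr | hr | hr <;> rw [hr] at ht ⊢
    · simp
    · simp
    · simp
    · rw [ht 0 (by simp)] at h01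
      simpa using h01 hr
    · rw [ht 1 (by simp)] at h10
      simpa using h10 hr
  · obtain ⟨c, -, h, -⟩ := jackson_machine job hL m
    rw [← Job.load_of_mem hmi, ← Job.load_of_mem hmj]
    have hi := (mem_machine job).2 ⟨List.mem_toFinset.1 hi, hmi⟩
    have hj := (mem_machine job).2 ⟨List.mem_toFinset.1 hj, hmj⟩
    -- The list order gives only the first alternative for earlier-later pairs; the symmetric
    -- disjunction extends to all pairs of distinct jobs.
    have h' := h.imp (S := fun i j => (stage₄ job L).1 (i, m) + (job i).load m ≤
      (stage₄ job L).1 (j, m) ∨ (stage₄ job L).1 (j, m) + (job j).load m ≤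
      (stage₄ job L).1 (i, m)) Or.inl
    have : Std.Symm fun i j => (stage₄ job L).1 (i, m) + (job i).load m ≤
      (stage₄ job L).1 (j, m) ∨ (stage₄ job L).1 (j, m) + (job j).load m ≤
      (stage₄ job L).1 (i, m) := ⟨fun _ _ h => h.symm⟩
    exact h'.forall hi hj hij

/-- Each machine clock bounds all completion times on its machine and is attained by one of them, or
is 0. -/
theorem jackson_makespan : makespan job L.toFinset (jackson job L).val.1 =
    (jackson job L).val.2 := by
  rw [jackson_val]
  obtain ⟨c₀, e₀, -, h₀, h₀'⟩ := jackson_machine job hL 0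
  obtain ⟨c₁, e₁, -, h₁, h₁'⟩ := jackson_machine job hL 1
  simp only [reduceIte, one_ne_zero] at e₀ e₁
  simp only [e₀, e₁]
  have key : ∀ m c, (c = 0 ∨ ∃ j ∈ sorted job m L ++ singles job m L ++ sorted job (1 - m) L,
      c = (stage₄ job L).1 (j, m) + (job j).load m) →
      c ≤ makespan job L.toFinset (stage₄ job L).1 := by
    rintro m c (rfl | ⟨j, hj, rfl⟩)
    · exact makespan_nonneg _ _ _
    · rw [mem_machine] at hj
      exact le_makespan job _ (List.mem_toFinset.2 hj.1) hj.2
  refine le_antisymm ((makespan_le_iff _ _ _ _).2 ⟨?_, fun j hj m hm => ?_⟩)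
    (max_le (key 0 _ h₀') (key 1 _ h₁'))
  · have : (0 : K) ≤ (stage₃ job L).2 := 
      (loadSum_nonneg job 0 (sorted job 0 L ++ singles job 0 L)).trans
        (le_place job 0 (fun j => (stage₂ job L).1 (j, 1) + (job j).load 1) (sorted job 1 L)
          ((stage₂ job L).1, _))
    rw [e₀] at this
    exact this.trans (le_max_left _ _)
  · have hj' := (mem_machine job).2 ⟨List.mem_toFinset.1 hj, hm⟩
    fin_cases m
    · exact (h₀ j hj').2.trans (le_max_left _ _)
    · exact (h₁ j hj').2.trans (le_max_right _ _)

/-- The makespan of Jackson's rule is the load of a machine or the length of a critical path in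
one of the two flow shops. -/
theorem jackson_critical : (∃ m, (jackson job L).val.2 ≤ loadSum job m L) ∨
    ∃ a A u B, sorted job a L = A ++ u :: B ∧ (jackson job L).val.2 =
      loadSum job a A + (job u).load a + (job u).load (1 - a) + loadSum job (1 - a) B := by
  have hload : ∀ m, loadSum job m (sorted job m L ++ singles job m L) +
      loadSum job m (sorted job (1 - m) L) ≤ loadSum job m L := fun m => by
    rw [← loadSum_append]
    exact loadSum_subset _ _ (nodup_machine job m hL) fun j hj => ((mem_machine job).1 hj).1
  rw [jackson_val]
  rcases max_choice (stage₃ job L).2 (stage₄ job L).2 with h | h <;> simp only [h]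
  · rcases place_critical job 0 (fun j => (stage₂ job L).1 (j, 1) + (job j).load 1)
      (sorted job 1 L) ((stage₂ job L).1, loadSum job 0 (sorted job 0 L ++ singles job 0 L))
      with h | ⟨A, u, B, e, h⟩
    · exact .inl ⟨0, h.trans_le (hload 0)⟩
    · refine .inr ⟨1, A, u, B, e, h.trans ?_⟩
      have hn := (List.nodup_append.1 (nodup_machine job 1 hL)).1
      -- The first operation of u lies in the leading block of its machine, which has no idle time.
      have : (stage₂ job L).1 (u, 1) = loadSum job 1 A := by
        unfold stage₂
        rw [e, List.append_assoc, List.nodup_append, List.cons_append, List.nodup_cons] at hn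
        rw [e, List.append_assoc, List.cons_append,
          place_zero_start job 1 _ le_rfl hn.2.1.1, zero_add]
      rw [this]
      rfl
  · rcases place_critical job 1 (fun j => (stage₃ job L).1 (j, 0) + (job j).load 0)
      (sorted job 0 L) ((stage₃ job L).1, loadSum job 1 (sorted job 1 L ++ singles job 1 L))
      with h | ⟨A, u, B, e, h⟩
    · exact .inl ⟨1, h.trans_le (hload 1)⟩
    · refine .inr ⟨0, A, u, B, e, h.trans ?_⟩
      have hn := nodup_machine job 0 hL
      have hu : u ∈ sorted job 0 L := by simp [e]
      have : (stage₃ job L).1 (u, 0) = loadSum job 0 A := by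
        -- The final block of machine 0 consists of jobs of the opposite route, so it does not
        -- overwrite the start of u.
        have h1 : (stage₃ job L).1 (u, 0) = (stage₂ job L).1 (u, 0) :=
          place_of_ne _ _ _ _ _ (.inr fun h =>
            (List.nodup_append.1 hn).2.2 u (by simp [hu]) u h rfl)
        rw [h1, stage₂_zero]
        unfold stage₁
        have hn := (List.nodup_append.1 hn).1
        rw [e, List.append_assoc, List.nodup_append, List.cons_append, List.nodup_cons] at hn
        rw [e, List.append_assoc, List.cons_append,
          place_zero_start job 0 _ le_rfl hn.2.1.1, zero_add]
      rw [this]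
      rfl

/-- Without a job of total length at least `2/3` of the makespan, Jackson's rule is within a factor
`3/2` of the larger machine load. -/
theorem jackson_le_of_small
    (h : ∀ j ∈ L, (job j).load 0 + (job j).load 1 < 2 / 3 * (jackson job L).val.2) :
    (jackson job L).val.2 ≤ 3 / 2 * max (loadSum job 0 L) (loadSum job 1 L) := by
  have hm : ∀ m, loadSum job m L ≤ max (loadSum job 0 L) (loadSum job 1 L) := by
    intro m
    fin_cases m
    · exact le_max_left _ _
    · exact le_max_right _ _
  rcases jackson_critical job hL with ⟨m, hc⟩ | ⟨a, A, u, B, e, hc⟩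
  · have := hm m
    have := (loadSum_nonneg job m L)
    linarith
  · have hsub : ∀ m, loadSum job m A + (job u).load m + loadSum job m B ≤
        max (loadSum job 0 L) (loadSum job 1 L) := by
      intro m
      refine le_trans ?_ (hm m)
      have := loadSum_subset job m (L := sorted job a L) (L' := L)
        (List.nodup_append.1 (List.nodup_append.1 (nodup_machine job a hL)).1).1
        (fun j hj => ((mem_sorted job).1 hj).1)
      rw [e] at this
      simp only [loadSum_append, loadSum_cons] at this
      linarith
    have hu : (job u).load a + (job u).load (1 - a) < 2 / 3 * (jackson job L).val.2 := by
      have := h u ((mem_sorted job (a := a)).1 (by simp [e])).1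
      fin_cases a
      · exact this
      · rw [add_comm]; exact this
    have hs := johnsonSort_pairwise job a (1 - a)
      (L.filter fun j => (job j).route = [a, 1 - a])
    have hs : (sorted job a L).Pairwise _ := hs
    rw [e, List.pairwise_append] at hs
    have hmono : ∀ (b c : Fin 2) (X : List (Fin n)),
        (∀ i ∈ X, (job i).load b ≤ (job i).load c) → loadSum job b X ≤ loadSum job c X := by
      intro b c X hX
      exact List.sum_le_sum hX
    -- If u belongs to the first Johnson group, so do all its predecessors, and A can be charged to
    -- machine 1 - a. The path then exceeds the load of that machine by at most the shorter
    -- operation of u, which is less than a third of the makespan.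
    by_cases hg : (job u).load a ≤ (job u).load (1 - a)
    · have := hmono a (1 - a) A (fun i hi => by
        have := hs.2.2 i hi u (by simp)
        rw [johnsonRel_iff] at this
        rcases this with h | h
        · exact h.1
        · exact absurd hg (not_le.2 h.2.1))
      have := hsub (1 - a)
      linarith
    -- Mirror case: u and all its successors are in the second group, so B is charged to machine a.
    · have := hmono (1 - a) a B (fun i hi => by
        have := (List.pairwise_cons.1 hs.2.1).1 i hi
        rw [johnsonRel_iff] at this
        rcases this with h | h
        · exact absurd h.1 hg
        · exact h.2.1.le)
      have := hsub a
      linarith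

/-- Lower bounds for Johnson's rule. -/
theorem johnson_bounds (hr : ∀ j m, m ∈ (job j).route) {a b : Fin 2} (hab : a ≠ b) :
    loadSum job a L ≤ makespan job L.toFinset (johnson job a b L).val.1 ∧
    loadSum job b L ≤ makespan job L.toFinset (johnson job a b L).val.1 ∧
    ∀ A u B, (johnsonSort job a b L).val = A ++ u :: B →
      loadSum job a A + (job u).load a + (job u).load b + loadSum job b B ≤
        makespan job L.toFinset (johnson job a b L).val.1 := by
  set L' := (johnsonSort job a b L).val with hL'
  have hperm : L'.Perm L := johnsonSort_perm job a b L
  have hn : L'.Nodup := hperm.nodup_iff.2 hL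
  set x := place job a 0 L' (fun _ => 0, 0) with hx
  set r : Fin n → K := fun j => x.1 (j, a) + (job j).load a with hr'
  have hval : (johnson job a b L).val.1 = (place job b r L' (x.1, 0)).1 := by
    have e1 : (placeFirst job a L' (fun _ => 0, 0)).val = x := placeFirst_val _ _ _ _ le_rfl
    rw [hr', ← placeSecond_val job hab L' (x.1, 0), ← e1]
    rfl
  rw [hval]
  have key : ∀ c m, (place job b r L' (x.1, 0)).1 = c → ∀ j ∈ L', c (j, m) + (job j).load m ≤
      makespan job L.toFinset c :=
    fun c m _ j hj => le_makespan job c (List.mem_toFinset.2 (hperm.mem_iff.1 hj)) (hr j m)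
  have hb : (place job b r L' (x.1, 0)).2 ≤
      makespan job L.toFinset (place job b r L' (x.1, 0)).1 := by
    rcases place_attained job b r hn (x.1, 0) with h | ⟨j, hj, h⟩
    · rw [h]; exact makespan_nonneg _ _ _
    · rw [h]; exact key _ b rfl j hj
  refine ⟨?_, ?_, fun A u B e => le_trans ?_ hb⟩
  · have hx2 : x.2 = loadSum job a L := by
      rw [hx, place_zero job a _ le_rfl, zero_add, loadSum_perm job a hperm]
    rw [← hx2]
    rcases place_attained job a 0 hn (fun _ => 0, 0) with h | ⟨j, hj, h⟩
    -- The clock of the first machine equals 0 or a completion time there, and the latter is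
    -- unaffected by the placements on b.
    · rw [hx, h]; exact makespan_nonneg _ _ _
    · rw [hx, h]
      have := key _ a rfl j hj
      rwa [place_of_ne job b r L' (x.1, 0) (.inl hab)] at this
  · refine le_trans ?_ hb
    have := add_loadSum_le_place job b r L' (x.1, 0)
    rwa [zero_add, loadSum_perm job b hperm] at this
  · have h1 := ready_add_loadSum_le_place job b r A u B (x.1, 0)
    have h2 : r u = loadSum job a A + (job u).load a := by
      rw [e, List.nodup_append, List.nodup_cons] at hn
      simp only [hr', hx, e]
      rw [place_zero_start job a _ le_rfl hn.2.1.1, zero_add]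
    rw [h2, ← e] at h1
    exact h1

/-- Jackson's rule compared with Johnson's rule for the two uniform machine orders. -/
theorem jackson_le_johnson : makespan job L.toFinset (jackson job L).val.1 ≤
    max (makespan (fun j => (job j).reroute 0) L.toFinset
          (johnson (fun j => (job j).reroute 0) 0 1 L).val.1)
      (makespan (fun j => (job j).reroute 1) L.toFinset
          (johnson (fun j => (job j).reroute 1) 1 0 L).val.1) := by
  rw [jackson_makespan job hL]
  have key : ∀ a, ∀ A u B, sorted job a L = A ++ u :: B →
      loadSum job a A + (job u).load a + (job u).load (1 - a) + loadSum job (1 - a) B ≤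
        makespan (fun j => (job j).reroute a) L.toFinset
          (johnson (fun j => (job j).reroute a) a (1 - a) L).val.1 := by
    intro a A u B e
    have hab : a ≠ 1 - a := by clear e; revert a; decide
    have hb := (johnson_bounds (fun j => (job j).reroute a) hL
      (fun j m => (job j).mem_route_reroute a m) hab).2.2
    rw [johnsonSort_reroute] at hb
    have hs : (sorted job a L).Sublist (johnsonSort job a (1 - a) L).val :=
      johnsonSort_sublist job _ _ List.filter_sublist
    -- Locate A, u, B inside the Johnson sequence of all jobs: A within a part before u, B within a
    -- part after u. The remaining jobs have nonnegative loads and only lengthen the path through u.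
    rw [e, List.append_sublist_iff] at hs
    obtain ⟨A', B', e', hA, hB⟩ := hs
    rw [List.cons_sublist_iff] at hB
    obtain ⟨C, D, rfl, hC, hD⟩ := hB
    obtain ⟨C₁, C₂, rfl⟩ := List.append_of_mem hC
    have := hb (A' ++ C₁) u (C₂ ++ D) (by rw [e']; simp)
    refine le_trans ?_ this
    simp only [loadSum_reroute, Job.load_reroute, loadSum_append]
    have h1 := loadSum_sublist job a hA
    have h2 := loadSum_sublist job (1 - a) hD
    have h3 := loadSum_nonneg job a C₁
    have h4 := loadSum_nonneg job (1 - a) C₂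
    linarith
  have hb := johnson_bounds (fun j => (job j).reroute 0) hL
      (fun j m => (job j).mem_route_reroute 0 m) (a := 0) (b := 1) (by decide)
  simp only [loadSum_reroute] at hb
  rcases jackson_critical job hL with ⟨m, hc⟩ | ⟨a, A, u, B, e, hc⟩
  -- A machine load bounds either Johnson schedule from below, since rerouting keeps the loads; the
  -- first one is taken.
  · refine (hc.trans ?_).trans (le_max_left _ _)
    fin_cases m
    · exact hb.1
    · exact hb.2.1
  · rw [hc]
    have := key a A u B e
    fin_cases a
    · exact this.trans (le_max_left _ _)
    · exact this.trans (le_max_right _ _)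

end Scheduling

/-! ### Walks and the removal of cycles -/

section PathSearch

open Timed

section Walks

variable (N : Network)

theorem Network.isWalk_append {u v : Fin N.numV} {P Q : List (Fin N.numA)} :
    N.IsWalk u (P ++ Q) v ↔ ∃ x, N.IsWalk u P x ∧ N.IsWalk x Q v := by
  induction P generalizing u with
  | nil => simp [Network.IsWalk]
  | cons a P ih => simp [Network.IsWalk, ih, and_assoc]

theorem Network.isWalk_reverse_cons {u v : Fin N.numV} {P : List (Fin N.numA)} {a : Fin N.numA} :
    N.IsWalk u (a :: P).reverse v ↔ N.IsWalk u P.reverse (N.src a) ∧ N.tgt a = v := by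
  rw [List.reverse_cons, N.isWalk_append]
  simp only [Network.IsWalk]
  constructor
  · rintro ⟨x, h, rfl, rfl⟩
    exact ⟨h, rfl⟩
  · rintro ⟨h, rfl⟩
    exact ⟨_, h, rfl, rfl⟩

theorem Network.isWalk_concat {u v : Fin N.numV} {P : List (Fin N.numA)} {a : Fin N.numA} :
    N.IsWalk u (P ++ [a]) v ↔ N.IsWalk u P (N.src a) ∧ N.tgt a = v := by
  simpa using N.isWalk_reverse_cons (P := P.reverse)

variable {N}

theorem Network.IsPath.length_lt {P : List (Fin N.numA)} (h : N.IsPath P) :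
    P.length < N.numV := by
  simpa using h.2.length_le_card

theorem Network.IsPath.nodup {P : List (Fin N.numA)} (h : N.IsPath P) : P.Nodup :=
  (List.nodup_cons.1 h.2).2.of_map

/-- A final part of a simple path is simple. If nothing is found, u is a new vertex, which is what
is needed to prepend an arc leaving u. -/
theorem suffixFrom_spec (u : Fin N.numV) (Q : List (Fin N.numA)) {x : Fin N.numV}
    (hw : N.IsWalk x Q N.t) (hn : (x :: Q.map N.tgt).Nodup) :
    match (suffixFrom N u Q).val with
    | some R => N.IsWalk u R N.t ∧ (u :: R.map N.tgt).Nodup ∧ R.Sublist Q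
    | none => u ∉ x :: Q.map N.tgt := by
  induction Q generalizing x with
  | nil =>
    obtain rfl : x = N.t := hw
    by_cases h : u = N.t
    · simp [suffixFrom, h, Network.IsWalk]
    · simp [suffixFrom, h]
  | cons a Q ih =>
    obtain ⟨rfl, hw⟩ := hw
    by_cases h : N.src a = u
    · simp only [suffixFrom, Timed.get, bind_val, h, reduceIte, pure_val]
      subst h
      exact ⟨⟨rfl, hw⟩, hn, List.Sublist.refl _⟩
    · simp only [suffixFrom, Timed.get, bind_val, h, reduceIte]
      have := ih hw (List.nodup_cons.1 hn).2
      revert this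
      generalize (suffixFrom N u Q).val = o
      rcases o with _ | R
      · intro h'
        rw [List.mem_cons, not_or]
        exact ⟨fun h'' => h h''.symm, h'⟩
      · exact fun h' => ⟨h'.1, h'.2.1, h'.2.2.cons _⟩

/-- The tail is already simple when an arc is added in front of it; if the source of the arc lies on
the tail, the arc and the part before that vertex form a closed walk and are dropped. The result is
a sublist, so no nonnegative weight increases. -/
theorem eraseCycles_spec (Q : List (Fin N.numA)) {x : Fin N.numV} (hw : N.IsWalk x Q N.t) :
    N.IsWalk x (eraseCycles N Q).val N.t ∧ (x :: (eraseCycles N Q).val.map N.tgt).Nodup ∧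
      (eraseCycles N Q).val.Sublist Q := by
  induction Q generalizing x with
  | nil => exact ⟨hw, by simp [eraseCycles], by simp [eraseCycles]⟩
  | cons a Q ih =>
    obtain ⟨rfl, hw⟩ := hw
    obtain ⟨h1, h2, h3⟩ := ih hw
    have h4 := suffixFrom_spec (N.src a) _ h1 h2
    simp only [eraseCycles, Timed.get, bind_val]
    revert h4
    generalize (suffixFrom N (N.src a) (eraseCycles N Q).val).val = o
    rcases o with _ | R
    · exact fun h4 => ⟨⟨rfl, h1⟩, List.nodup_cons.2 ⟨h4, h2⟩, h3.cons_cons a⟩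
    · exact fun h4 => ⟨h4.1, h4.2.1, (h4.2.2.trans h3).cons a⟩

theorem toPath_spec {P : List (Fin N.numA)} (hw : N.IsWalk N.s P.reverse N.t) :
    N.IsPath (toPath N P).val ∧ (toPath N P).val.Sublist P.reverse := by
  have h := eraseCycles_spec P.reverse hw
  simp only [toPath, bind_val, reverse_val]
  exact ⟨⟨h.1, h.2.1⟩, h.2.2⟩

theorem sum_map_sublist {α K : Type} [Field K] [LinearOrder K] [IsStrictOrderedRing K]
    {w : α → K} (hw : ∀ a, 0 ≤ w a) {P Q : List α} (h : P.Sublist Q) :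
    (P.map w).sum ≤ (Q.map w).sum := by
  induction h with
  | slnil => simp
  | cons a h ih => simpa using ih.trans (le_add_of_nonneg_left (hw a))
  | cons_cons a h ih => simpa using ih

theorem sum_toPath_le {K : Type} [Field K] [LinearOrder K] [IsStrictOrderedRing K]
    {w : Fin N.numA → K} (hw : ∀ a, 0 ≤ w a) {P : List (Fin N.numA)}
    (hP : N.IsWalk N.s P.reverse N.t) : ((toPath N P).val.map w).sum ≤ (P.map w).sum := by
  refine (sum_map_sublist hw (toPath_spec hP).2).trans_eq ?_
  exact ((List.reverse_perm P).map w).sum_eq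

end Walks

/-! ### Shortest walks by relaxation -/

section BellmanFord

variable {K : Type} [Field K] [LinearOrder K] [BitSize K] {N : Network}

/-- The two outcomes of a relaxation step. -/
theorem relax_cases (w : Fin N.numA → K) (old new : Fin N.numV → Option (K × List (Fin N.numA)))
    (a : Fin N.numA) :
    ((relax N w old new a).val = new ∧ ∀ d P, old (N.src a) = some (d, P) →
      ∃ e R, new (N.tgt a) = some (e, R) ∧ e ≤ d + w a) ∨
    ∃ d P, old (N.src a) = some (d, P) ∧
      (relax N w old new a).val = Function.update new (N.tgt a) (some (d + w a, a :: P)) ∧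
      ∀ e R, new (N.tgt a) = some (e, R) → d + w a ≤ e := by
  simp only [relax, Timed.get, Timed.add, Timed.lt, Timed.set, bind_val]
  rcases old (N.src a) with _ | ⟨d, P⟩
  · left; simp
  · rcases h : new (N.tgt a) with _ | ⟨e, R⟩
    · right; exact ⟨d, P, rfl, by simp, by simp⟩
    · by_cases hlt : d + w a < e
      · right
        refine ⟨d, P, rfl, by simp [hlt], fun e' R' h' => ?_⟩
        obtain ⟨rfl, rfl⟩ : e = e' ∧ R = R' := by simpa using h'
        exact hlt.le
      · left
        refine ⟨by simp [hlt], fun d' P' h' => ⟨e, R, rfl, ?_⟩⟩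
        obtain ⟨rfl, rfl⟩ : d = d' ∧ P = P' := by simpa using h'
        exact not_lt.1 hlt

/-- The labels are the lengths of walks. -/
def ValidLabels (w : Fin N.numA → K) (k : ℕ)
    (l : Fin N.numV → Option (K × List (Fin N.numA))) : Prop :=
  ∀ v d P, l v = some (d, P) → N.IsWalk N.s P.reverse v ∧ d = (P.map w).sum ∧ P.length ≤ k

/-- The label of `v` exists and is at most `x`. -/
def LabelLe (l : Fin N.numV → Option (K × List (Fin N.numA))) (v : Fin N.numV) (x : K) : Prop :=
  ∃ d P, l v = some (d, P) ∧ d ≤ x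

/-- New labels are built from the table of the previous round only, so a walk gains at most one arc
per round. This bounds the stored walks, and later the bit lengths of the labels. -/
theorem relax_valid {w : Fin N.numA → K} {k : ℕ}
    {old new : Fin N.numV → Option (K × List (Fin N.numA))} (ho : ValidLabels w k old)
    (hn : ValidLabels w (k + 1) new) (a : Fin N.numA) :
    ValidLabels w (k + 1) (relax N w old new a).val := by
  rcases relax_cases w old new a with ⟨h, -⟩ | ⟨d, P, h1, h2, -⟩
  · rwa [h]
  · rw [h2]
    intro v e R h
    by_cases hv : v = N.tgt a
    · subst hv
      rw [Function.update_self] at h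
      obtain ⟨rfl, rfl⟩ : d + w a = e ∧ a :: P = R := by simpa using h
      obtain ⟨h3, h4, h5⟩ := ho _ _ _ h1
      refine ⟨N.isWalk_reverse_cons.2 ⟨h3, rfl⟩, ?_, by simpa using h5⟩
      rw [h4, List.map_cons, List.sum_cons, add_comm]
    · rw [Function.update_of_ne hv] at h
      exact hn v e R h

theorem relax_mono {w : Fin N.numA → K}
    {old new : Fin N.numV → Option (K × List (Fin N.numA))} (a : Fin N.numA) {v : Fin N.numV}
    {x : K} (h : LabelLe new v x) : LabelLe (relax N w old new a).val v x := by
  rcases relax_cases w old new a with ⟨h', -⟩ | ⟨d, P, h1, h2, h3⟩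
  · rwa [h']
  · rw [h2]
    obtain ⟨e, R, h4, h5⟩ := h
    by_cases hv : v = N.tgt a
    · subst hv
      exact ⟨_, _, Function.update_self .., (h3 e R h4).trans h5⟩
    · exact ⟨e, R, by rwa [Function.update_of_ne hv], h5⟩

variable [IsStrictOrderedRing K]

theorem relax_establish {w : Fin N.numA → K}
    {old new : Fin N.numV → Option (K × List (Fin N.numA))} (a : Fin N.numA)
    {x : K} (h : LabelLe old (N.src a) x) :
    LabelLe (relax N w old new a).val (N.tgt a) (x + w a) := by
  obtain ⟨d', P', h4, h5⟩ := h
  have h6 : d' + w a ≤ x + w a := (add_le_add_iff_right _).2 h5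
  rcases relax_cases w old new a with ⟨h', h''⟩ | ⟨d, P, h1, h2, -⟩
  · rw [h']
    obtain ⟨e, R, h7, h8⟩ := h'' d' P' h4
    exact ⟨e, R, h7, h8.trans h6⟩
  · rw [h2]
    obtain ⟨rfl, rfl⟩ : d = d' ∧ P = P' := by simpa [h1] using h4
    exact ⟨_, _, Function.update_self .., h6⟩

/-- After k rounds each label is the length of a walk with at most k arcs, and no walk with at most
k arcs is shorter: its last arc is relaxed in round k, starting from a label at least as good as its
prefix. Since a simple path has fewer than `numV` arcs, `numV` rounds suffice. -/
theorem bellmanFord_spec (w : Fin N.numA → K) :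
    ValidLabels w N.numV (bellmanFord N w).val ∧
      ∀ v Q, N.IsWalk N.s Q v → Q.length ≤ N.numV →
        LabelLe (bellmanFord N w).val v (Q.map w).sum := by
  have key := iter_inv (f := fun old => do
      tick N.numV
      forEach (relax N w old) (List.finRange N.numA) old)
    (fun k l => ValidLabels w k l ∧ ∀ v Q, N.IsWalk N.s Q v → Q.length ≤ k →
      LabelLe l v (Q.map w).sum) N.numV 0
    (Function.update (fun _ => none) N.s (some (0, []))) ?_ ?_
  · rw [zero_add] at key
    exact key
  · constructor
    · intro v d P h
      by_cases hv : v = N.s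
      · subst hv
        rw [Function.update_self] at h
        obtain ⟨rfl, rfl⟩ : 0 = d ∧ [] = P := by simpa using h
        simp [Network.IsWalk]
      · rw [Function.update_of_ne hv] at h
        simp at h
    · intro v Q hQ hl
      obtain rfl : Q = [] := by simpa using hl
      obtain rfl : N.s = v := hQ
      exact ⟨0, [], Function.update_self .., by simp⟩
  · rintro k old ⟨hv, hc⟩
    simp only [bind_val]
    have hv' : ValidLabels w (k + 1) old := fun v d P h =>
      ⟨(hv v d P h).1, (hv v d P h).2.1, (hv v d P h).2.2.trans (Nat.le_succ k)⟩
    refine ⟨forEach_inv (ValidLabels w (k + 1)) _ _ hv' fun s a _ h => relax_valid hv h a, ?_⟩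
    intro v Q hQ hl
    rcases List.eq_nil_or_concat' Q with rfl | ⟨P, a, rfl⟩
    · exact forEach_inv (fun l => LabelLe l v _) _ _ (hc v [] hQ (by simp))
        fun s a _ h => relax_mono a h
    · rw [N.isWalk_concat] at hQ
      obtain ⟨hP, rfl⟩ := hQ
      have := forEach_establish (f := relax N w old) (fun _ => True)
        (fun a l => ∀ x, LabelLe old (N.src a) x → LabelLe l (N.tgt a) (x + w a))
        (List.finRange N.numA) old trivial (by simp) (fun s a _ _ x hx => relax_establish a hx)
        (fun b s a _ _ h x hx => relax_mono a (h x hx)) a (by simp) _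
        (hc _ P hP (by simpa using hl))
      simpa using this

end BellmanFord

/-! ### The dynamic program over pairs of rounded lengths -/

section DynProg

variable {N : Network} (w₁ w₂ : Fin N.numA → ℕ) (B : ℕ)

/-- The two outcomes of an extension step. -/
theorem extend_cases (old new : N.Table) (a : Fin N.numA) (x y : ℕ) :
    ((extend N w₁ w₂ B old a x y new).val = new ∧ (old (N.src a, x, y) ≠ none →
      x + w₁ a ≤ B → y + w₂ a ≤ B → new (N.tgt a, x + w₁ a, y + w₂ a) ≠ none)) ∨
    ∃ P, old (N.src a, x, y) = some P ∧ (extend N w₁ w₂ B old a x y new).val =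
      Function.update new (N.tgt a, x + w₁ a, y + w₂ a) (some (a :: P)) := by
  simp only [extend, Timed.get, natAdd, natLe, Timed.set, bind_val]
  rcases old (N.src a, x, y) with _ | P
  · left; simp
  · by_cases hb : x + w₁ a ≤ B ∧ y + w₂ a ≤ B
    · simp only [hb.1, hb.2, decide_true, Bool.and_self, reduceIte, bind_val]
      rcases h : new (N.tgt a, x + w₁ a, y + w₂ a) with _ | R
      · right; exact ⟨P, rfl, rfl⟩
      · left; simp
    · left
      refine ⟨?_, fun _ h1 h2 => absurd ⟨h1, h2⟩ hb⟩
      simp only [bind_val]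
      rw [if_neg (by simpa using hb)]
      rfl

/-- The entries of the table are walks of the given lengths with at most `k` arcs. -/
def ValidTable (k : ℕ) (T : N.Table) : Prop :=
  ∀ v x y P, T (v, x, y) = some P → N.IsWalk N.s P.reverse v ∧ (P.map w₁).sum = x ∧
    (P.map w₂).sum = y ∧ P.length ≤ k

variable {w₁ w₂ B}

theorem extend_valid {k : ℕ} {old new : N.Table} (ho : ValidTable w₁ w₂ k old)
    (hn : ValidTable w₁ w₂ (k + 1) new) (a : Fin N.numA) (x y : ℕ) :
    ValidTable w₁ w₂ (k + 1) (extend N w₁ w₂ B old a x y new).val := by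
  rcases extend_cases w₁ w₂ B old new a x y with ⟨h, -⟩ | ⟨P, h1, h2⟩
  · rwa [h]
  · rw [h2]
    intro v x' y' R h
    by_cases hv : (v, x', y') = (N.tgt a, x + w₁ a, y + w₂ a)
    · rw [hv, Function.update_self] at h
      obtain rfl : a :: P = R := by simpa using h
      simp only [Prod.mk.injEq] at hv
      obtain ⟨rfl, rfl, rfl⟩ := hv
      obtain ⟨h3, h4, h5, h6⟩ := ho _ _ _ _ h1
      refine ⟨N.isWalk_reverse_cons.2 ⟨h3, rfl⟩, ?_, ?_, by simpa using h6⟩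
      · rw [List.map_cons, List.sum_cons, h4, add_comm]
      · rw [List.map_cons, List.sum_cons, h5, add_comm]
    · rw [Function.update_of_ne hv] at h
      exact hn v x' y' R h

theorem extend_mono {old new : N.Table} (a : Fin N.numA) (x y : ℕ) {e : Fin N.numV × ℕ × ℕ}
    (h : new e ≠ none) : (extend N w₁ w₂ B old a x y new).val e ≠ none := by
  rcases extend_cases w₁ w₂ B old new a x y with ⟨h', -⟩ | ⟨P, -, h2⟩
  · rwa [h']
  · rw [h2]
    by_cases he : e = (N.tgt a, x + w₁ a, y + w₂ a)
    · subst he; simp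
    · rwa [Function.update_of_ne he]

theorem extend_establish {old new : N.Table} (a : Fin N.numA) (x y : ℕ)
    (h : old (N.src a, x, y) ≠ none) (hx : x + w₁ a ≤ B) (hy : y + w₂ a ≤ B) :
    (extend N w₁ w₂ B old a x y new).val (N.tgt a, x + w₁ a, y + w₂ a) ≠ none := by
  rcases extend_cases w₁ w₂ B old new a x y with ⟨h', h''⟩ | ⟨P, -, h2⟩
  · rw [h']; exact h'' h hx hy
  · rw [h2]; simp

variable (w₁ w₂ B)

/-- The invariant is as for shortest walks, with one entry per pair of lengths. Discarding lengths
above B is harmless: the weights are natural numbers, so every prefix of a walk within the bounds is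
within the bounds. -/
theorem dynProg_spec : ValidTable w₁ w₂ N.numV (dynProg N w₁ w₂ B).val ∧
    ∀ v Q, N.IsWalk N.s Q v → Q.length ≤ N.numV → (Q.map w₁).sum ≤ B → (Q.map w₂).sum ≤ B →
      (dynProg N w₁ w₂ B).val (v, (Q.map w₁).sum, (Q.map w₂).sum) ≠ none := by
  have key := iter_inv (f := fun old => do
      tick (N.numV * (B + 1) * (B + 1))
      forEach (fun new a =>
        forEach (fun new x =>
          forEach (fun new y => extend N w₁ w₂ B old a x y new)
            (List.range (B + 1)) new)
          (List.range (B + 1)) new)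
        (List.finRange N.numA) old)
    (fun k T => ValidTable w₁ w₂ k T ∧ ∀ v Q, N.IsWalk N.s Q v → Q.length ≤ k →
      (Q.map w₁).sum ≤ B → (Q.map w₂).sum ≤ B → T (v, (Q.map w₁).sum, (Q.map w₂).sum) ≠ none)
    N.numV 0 (Function.update (fun _ => none) (N.s, 0, 0) (some [])) ?_ ?_
  · rw [zero_add] at key
    exact key
  · constructor
    · intro v x y P h
      by_cases hv : (v, x, y) = (N.s, 0, 0)
      · rw [hv, Function.update_self] at h
        obtain rfl : [] = P := by simpa using h
        simp only [Prod.mk.injEq] at hv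
        obtain ⟨rfl, rfl, rfl⟩ := hv
        simp [Network.IsWalk]
      · rw [Function.update_of_ne hv] at h
        simp at h
    · intro v Q hQ hl _ _
      obtain rfl : Q = [] := by simpa using hl
      obtain rfl : N.s = v := hQ
      simp
  · rintro k old ⟨hv, hc⟩
    simp only [bind_val]
    have hv' : ValidTable w₁ w₂ (k + 1) old := fun v x y P h => by
      obtain ⟨h1, h2, h3, h4⟩ := hv v x y P h
      exact ⟨h1, h2, h3, h4.trans (Nat.le_succ k)⟩
    have mono : ∀ e a xs ys (new : N.Table), new e ≠ none → (forEach (fun new x =>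
          forEach (fun new y => extend N w₁ w₂ B old a x y new) ys new) xs new).val e ≠ none :=
      fun e a xs ys new h => forEach_inv (fun T : N.Table => T e ≠ none) _ _ h fun s x _ h =>
        forEach_inv (fun T : N.Table => T e ≠ none) _ _ h fun s y _ h => extend_mono a x y h
    refine ⟨forEach_inv (ValidTable w₁ w₂ (k + 1)) _ _ hv' fun s a _ h =>
      forEach_inv (ValidTable w₁ w₂ (k + 1)) _ _ h fun s x _ h =>
      forEach_inv (ValidTable w₁ w₂ (k + 1)) _ _ h fun s y _ h => extend_valid hv h a x y, ?_⟩
    intro v Q hQ hl h1 h2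
    rcases List.eq_nil_or_concat' Q with rfl | ⟨P, a, rfl⟩
    · exact forEach_inv (fun T : N.Table => T (v, 0, 0) ≠ none) _ _
        (hc v [] hQ (by simp) (by simp) (by simp)) fun s a _ h => mono _ _ _ _ _ h
    · rw [N.isWalk_concat] at hQ
      obtain ⟨hP, rfl⟩ := hQ
      simp only [List.map_append, List.map_cons, List.map_nil, List.sum_append, List.sum_cons,
        List.sum_nil, add_zero] at h1 h2 ⊢
      have hold := hc _ P hP (by simpa using hl) (by omega) (by omega)
      generalize (P.map w₁).sum = x at *
      generalize (P.map w₂).sum = y at *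
      -- Among all iterations of the three nested loops, the one at (a, x, y) fills the desired
      -- entry; the premise `a' = a` (then `x' = x`, `y' = y`) singles it out, and monotonicity
      -- keeps the entry filled.
      refine forEach_establish (fun _ => True) (fun a' T => a' = a →
          T (N.tgt a, x + w₁ a, y + w₂ a) ≠ none)
        (List.finRange N.numA) old trivial (by simp) ?_
        (fun b s a _ _ h h' => mono _ _ _ _ _ (h h')) a (by simp) rfl
      rintro new a' - - rfl
      refine forEach_establish (fun _ => True) (fun x' T => x' = x →
          T (N.tgt a', x + w₁ a', y + w₂ a') ≠ none)
        (List.range (B + 1)) new trivial (by simp) ?_ ?_ x (by simp; omega) rfl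
      · rintro new x' - - rfl
        refine forEach_establish (fun _ => True) (fun y' T => y' = y →
            T (N.tgt a', x' + w₁ a', y + w₂ a') ≠ none)
          (List.range (B + 1)) new trivial (by simp) ?_ ?_ y (by simp; omega) rfl
        · rintro new y' - - rfl
          exact extend_establish a' x' y' hold h1 h2
        · intro y' s z _ _ h h'
          exact extend_mono a' x' z (h h')
      · intro x' s z _ _ h h'
        exact forEach_inv (fun T : N.Table => T _ ≠ none) _ _ (h h')
          fun s y _ h => extend_mono a' z y h

/-- One step of the search for the best entry of the table. -/
def selectStep (T : N.Table) (x : ℕ) (best : Option (ℕ × List (Fin N.numA))) (y : ℕ) :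
    Timed (Option (ℕ × List (Fin N.numA))) := do
  match ← Timed.get T (N.t, x, y) with
  | none => pure best
  | some P => do
    let b ← natLe x y
    let z := if b then y else x
    match best with
    | none => pure (some (z, P))
    | some (z', _) => do
      let c ← natLe z' z
      if c then pure best else pure (some (z, P))

theorem selectBest_eq (T : N.Table) : selectBest N B T = forEach (fun best x =>
    forEach (selectStep T x) (List.range (B + 1)) best) (List.range (B + 1)) none := rfl

theorem selectStep_cases (T : N.Table) (x y : ℕ) (best : Option (ℕ × List (Fin N.numA))) :
    ((selectStep T x best y).val = best ∧
      (T (N.t, x, y) ≠ none → ∃ z P, best = some (z, P) ∧ z ≤ Max.max x y)) ∨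
    ∃ P, T (N.t, x, y) = some P ∧ (selectStep T x best y).val = some (Max.max x y, P) ∧
      ∀ z P, best = some (z, P) → Max.max x y ≤ z := by
  have hmax : (if decide (x ≤ y) = true then y else x) = Max.max x y := by
    simp [max_def]
  simp only [selectStep, Timed.get, bind_val]
  rcases T (N.t, x, y) with _ | P
  · left; simp
  · simp only [natLe, bind_val, hmax]
    rcases best with _ | ⟨z', R⟩
    · right; exact ⟨P, rfl, rfl, by simp⟩
    · by_cases h : z' ≤ Max.max x y
      · left
        simp only [h, decide_true, bind_val, reduceIte, pure_val]
        exact ⟨trivial, fun _ => ⟨z', R, rfl, h⟩⟩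
      · right
        simp only [h, decide_false, bind_val, Bool.false_eq_true, reduceIte, pure_val]
        refine ⟨P, rfl, rfl, fun z Q hz => ?_⟩
        obtain ⟨rfl, rfl⟩ : z' = z ∧ R = Q := by simpa using hz
        omega

/-- The first half is soundness of the stored value; the second holds because the stored value never
increases and is at most that of an entry once this entry has been visited. -/
theorem selectBest_spec (T : N.Table) :
    (∀ z P, (selectBest N B T).val = some (z, P) →
      ∃ x y, T (N.t, x, y) = some P ∧ z = Max.max x y) ∧
    ∀ x ≤ B, ∀ y ≤ B, T (N.t, x, y) ≠ none →
      ∃ z P, (selectBest N B T).val = some (z, P) ∧ z ≤ Max.max x y := by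
  rw [selectBest_eq]
  constructor
  · refine forEach_inv (fun best => ∀ z P, best = some (z, P) →
      ∃ x y, T (N.t, x, y) = some P ∧ z = Max.max x y) _ _ (by simp) fun s x _ h =>
      forEach_inv (fun best => ∀ z P, best = some (z, P) →
      ∃ x y, T (N.t, x, y) = some P ∧ z = Max.max x y) _ _ h fun s y _ h => ?_
    rcases selectStep_cases T x y s with ⟨h1, -⟩ | ⟨P, h1, h2, -⟩
    · rwa [h1]
    · rw [h2]
      intro z Q hz
      obtain ⟨rfl, rfl⟩ : Max.max x y = z ∧ P = Q := by simpa using hz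
      exact ⟨x, y, h1, rfl⟩
  · intro x₀ hx y₀ hy hT
    have mono : ∀ x y (s : Option (ℕ × List (Fin N.numA))),
        (∃ z P, s = some (z, P) ∧ z ≤ Max.max x₀ y₀) →
          ∃ z P, (selectStep T x s y).val = some (z, P) ∧ z ≤ Max.max x₀ y₀ := by
      rintro x y s ⟨z, R, hs, hz⟩
      rcases selectStep_cases T x y s with ⟨h1, -⟩ | ⟨P, h1, h2, h3⟩
      · exact ⟨z, R, h1.trans hs, hz⟩
      · exact ⟨_, _, h2, (h3 z R hs).trans hz⟩
    refine forEach_establish (fun _ => True) (fun x s => x = x₀ →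
      ∃ z P, s = some (z, P) ∧ z ≤ Max.max x₀ y₀) (List.range (B + 1)) none trivial (by simp)
      ?_ ?_ x₀ (by simp; omega) rfl
    · rintro s x - - rfl
      refine forEach_establish (fun _ => True) (fun y s => y = y₀ →
        ∃ z P, s = some (z, P) ∧ z ≤ Max.max x y₀) (List.range (B + 1)) s trivial (by simp)
        ?_ ?_ y₀ (by simp; omega) rfl
      · rintro s y - - rfl
        rcases selectStep_cases T x y s with ⟨h1, h2⟩ | ⟨P, h1, h2, -⟩
        · obtain ⟨z, R, h3, h4⟩ := h2 hT
          exact ⟨z, R, h1.trans h3, h4⟩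
        · exact ⟨_, _, h2, le_rfl⟩
      · intro y' s y _ _ h h'
        exact mono x y s (h h')
    · intro x' s x _ _ h h'
      exact forEach_inv (fun s => ∃ z P, s = some (z, P) ∧ z ≤ Max.max x₀ y₀) _ _ (h h')
        fun s y _ h => mono x y s h

end DynProg

end PathSearch

/-! ### The accuracy of ABV -/

section PathApproximation

open Timed

section ABV

variable {K : Type} [Field K] [LinearOrder K] [BitSize K] [FloorSemiring K] {N : Network}

/-- The unit to which the weights are rounded. -/
def roundingUnit (N : Network) (δ c : K) : K := δ * (c / 2) / (N.numV : K)

theorem abv_val (δ : K) (w₁ w₂ : Fin N.numA → K) : (abv N δ w₁ w₂).val =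
    match (bellmanFord N fun a => w₁ a + w₂ a).val N.t with
    | none => none
    | some (c, P) => if c ≤ 0 then some (toPath N P).val else
      match (selectBest N ⌊c / roundingUnit N δ c⌋₊
        (dynProg N (fun a => ⌊w₁ a / roundingUnit N δ c⌋₊)
          (fun a => ⌊w₂ a / roundingUnit N δ c⌋₊) ⌊c / roundingUnit N δ c⌋₊).val).val with
      | none => some (toPath N P).val
      | some (_, R) => some (toPath N R).val := by
  simp only [abv, bind_val, tabulate_spec, Timed.get, Timed.add]
  rcases (bellmanFord N fun a => w₁ a + w₂ a).val N.t with _ | ⟨c, P⟩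
  · rfl
  · by_cases hc : c ≤ 0
    · simp [Timed.le, hc]
    · simp only [Timed.le, bind_val, hc, decide_false, Bool.false_eq_true, reduceIte, Timed.div,
        Timed.mul, Timed.ofNat, floorDiv, tabulate_spec]
      unfold roundingUnit
      split <;> simp_all

variable [IsStrictOrderedRing K]

omit [BitSize K] in
theorem sum_floor_mul_le {ι : Type} {θ : K} (hθ : 0 < θ) {w : ι → K} (hw : ∀ a, 0 ≤ w a)
    (P : List ι) :
    (((P.map fun a => ⌊w a / θ⌋₊).sum : ℕ) : K) * θ ≤ (P.map w).sum := by
  induction P with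
  | nil => simp
  | cons a P ih =>
    have := (le_div_iff₀ hθ).1 (Nat.floor_le (div_nonneg (hw a) hθ.le))
    simp only [List.map_cons, List.sum_cons, Nat.cast_add, add_mul]
    exact add_le_add this ih

omit [BitSize K] in
-- Rounding down loses less than one unit θ per arc.
theorem sum_le_sum_floor_mul {ι : Type} {θ : K} (hθ : 0 < θ) (w : ι → K) (P : List ι) :
    (P.map w).sum ≤ (((P.map fun a => ⌊w a / θ⌋₊).sum : ℕ) : K) * θ + P.length * θ := by
  induction P with
  | nil => simp
  | cons a P ih =>
    have := (div_lt_iff₀ hθ).1 (Nat.lt_floor_add_one (w a / θ))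
    simp only [List.map_cons, List.sum_cons, Nat.cast_add, List.length_cons, Nat.cast_one]
    nlinarith

/-- The larger of the two lengths of a path. -/
def minmax {ι : Type} (w₁ w₂ : ι → K) (P : List ι) : K :=
  Max.max (P.map w₁).sum (P.map w₂).sum

omit [BitSize K] [FloorSemiring K] [IsStrictOrderedRing K] in
theorem minmax_le_iff {ι : Type} {w₁ w₂ : ι → K} {P : List ι} {c : K} :
    minmax w₁ w₂ P ≤ c ↔ (P.map w₁).sum ≤ c ∧ (P.map w₂).sum ≤ c := max_le_iff

omit [BitSize K] [FloorSemiring K] in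
theorem minmax_toPath_le {w₁ w₂ : Fin N.numA → K} (h₁ : ∀ a, 0 ≤ w₁ a) (h₂ : ∀ a, 0 ≤ w₂ a)
    {P : List (Fin N.numA)} (hP : N.IsWalk N.s P.reverse N.t) :
    minmax w₁ w₂ (toPath N P).val ≤ minmax w₁ w₂ P :=
  max_le_max (sum_toPath_le h₁ hP) (sum_toPath_le h₂ hP)

omit [BitSize K] in
/-- The guarantee of the rounded dynamic program. -/
theorem dynProg_approx {θ c : K} (hθ : 0 < θ) {w₁ w₂ : Fin N.numA → K} (h₁ : ∀ a, 0 ≤ w₁ a)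
    (h₂ : ∀ a, 0 ≤ w₂ a) {Q : List (Fin N.numA)} (hQ : N.IsPath Q) (hc : minmax w₁ w₂ Q ≤ c) :
    ∃ z R, (selectBest N ⌊c / θ⌋₊ (dynProg N (fun a => ⌊w₁ a / θ⌋₊)
        (fun a => ⌊w₂ a / θ⌋₊) ⌊c / θ⌋₊).val).val = some (z, R) ∧
      N.IsWalk N.s R.reverse N.t ∧ minmax w₁ w₂ R ≤ minmax w₁ w₂ Q + N.numV * θ := by
  set B := ⌊c / θ⌋₊
  set v₁ := fun a => ⌊w₁ a / θ⌋₊ with hv₁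
  set v₂ := fun a => ⌊w₂ a / θ⌋₊ with hv₂
  obtain ⟨hT, hT'⟩ := dynProg_spec (N := N) v₁ v₂ B
  set T := (dynProg N v₁ v₂ B).val
  obtain ⟨hS, hS'⟩ := selectBest_spec B T
  -- Rounding down keeps the lengths of Q below c/θ, so Q is within the range of the table.
  have hB : ∀ w : Fin N.numA → K, (∀ a, 0 ≤ w a) → (Q.map w).sum ≤ c →
      (Q.map fun a => ⌊w a / θ⌋₊).sum ≤ B := by
    intro w hw hle
    refine Nat.le_floor ?_
    rw [le_div_iff₀ hθ]
    exact (sum_floor_mul_le hθ hw Q).trans hle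
  rw [minmax_le_iff] at hc
  have hb₁ := hB w₁ h₁ hc.1
  have hb₂ := hB w₂ h₂ hc.2
  obtain ⟨z, R, hR, hz⟩ := hS' _ hb₁ _ hb₂ (hT' N.t Q hQ.1 hQ.length_lt.le hb₁ hb₂)
  obtain ⟨x, y, hxy, hzxy⟩ := hS z R hR
  obtain ⟨hw, hx, hy, hl⟩ := hT _ _ _ _ hxy
  refine ⟨z, R, hR, hw, ?_⟩
  -- The table only holds walks with at most `numV` arcs, so the total rounding loss of R is at most
  -- `numV * θ`.
  have hlen : (R.length : K) * θ ≤ N.numV * θ := by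
    gcongr
  have hzK : (z : K) * θ ≤ minmax w₁ w₂ Q := by
    have h3 := sum_floor_mul_le hθ h₁ Q
    have h4 := sum_floor_mul_le hθ h₂ Q
    rcases le_max_iff.1 hz with hz | hz
    · have : (z : K) * θ ≤ (((Q.map fun a => ⌊w₁ a / θ⌋₊).sum : ℕ) : K) * θ := by gcongr
      exact (this.trans h3).trans (le_max_left _ _)
    · have : (z : K) * θ ≤ (((Q.map fun a => ⌊w₂ a / θ⌋₊).sum : ℕ) : K) * θ := by gcongr
      exact (this.trans h4).trans (le_max_right _ _)
  rw [minmax_le_iff]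
  constructor
  · have h3 := sum_le_sum_floor_mul hθ w₁ R
    have h4 : ((R.map fun a => ⌊w₁ a / θ⌋₊).sum : K) * θ ≤ z * θ := by
      gcongr
      rw [hzxy, ← hx]
      exact le_max_left _ _
    linarith
  · have h3 := sum_le_sum_floor_mul hθ w₂ R
    have h4 : ((R.map fun a => ⌊w₂ a / θ⌋₊).sum : K) * θ ≤ z * θ := by
      gcongr
      rw [hzxy, ← hy]
      exact le_max_right _ _
    linarith

omit [FloorSemiring K] in
theorem bellmanFord_none {w : Fin N.numA → K} (h : ¬ ∃ P, N.IsPath P) :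
    (bellmanFord N w).val N.t = none := by
  by_contra hne
  obtain ⟨⟨c, P⟩, hP⟩ := Option.ne_none_iff_exists'.1 hne
  exact h ⟨_, (toPath_spec ((bellmanFord_spec w).1 _ _ _ hP).1).1⟩

theorem abv_none {δ : K} {w₁ w₂ : Fin N.numA → K} (h : ¬ ∃ P, N.IsPath P) :
    (abv N δ w₁ w₂).val = none := by
  rw [abv_val, bellmanFord_none h]

/-- The path algorithm finds a path whose larger length is within a factor `1 + δ` of the least
possible. -/
theorem abv_approx {δ : K} (hδ : 0 < δ) {w₁ w₂ : Fin N.numA → K} (h₁ : ∀ a, 0 ≤ w₁ a)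
    (h₂ : ∀ a, 0 ≤ w₂ a) (hex : ∃ P, N.IsPath P) : ∃ P, (abv N δ w₁ w₂).val = some P ∧
      N.IsPath P ∧ ∀ Q, N.IsPath Q → minmax w₁ w₂ P ≤ (1 + δ) * minmax w₁ w₂ Q := by
  obtain ⟨hv, hc⟩ := bellmanFord_spec (N := N) fun a => w₁ a + w₂ a
  obtain ⟨P₀, hP₀⟩ := hex
  obtain ⟨c, P, hP, -⟩ := hc N.t P₀ hP₀.1 hP₀.length_lt.le
  obtain ⟨hw, hcP, -⟩ := hv _ _ _ hP
  have hsum : ∀ Q : List (Fin N.numA), (Q.map fun a => w₁ a + w₂ a).sum =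
      (Q.map w₁).sum + (Q.map w₂).sum := fun Q => List.sum_map_add
  have hnn : ∀ Q : List (Fin N.numA), 0 ≤ (Q.map w₁).sum ∧ 0 ≤ (Q.map w₂).sum := fun Q =>
    ⟨List.sum_nonneg (by simpa using fun a _ => h₁ a),
      List.sum_nonneg (by simpa using fun a _ => h₂ a)⟩
  -- A sum of two numbers is at most twice the larger one. This factor 2 accounts for the 2 in the
  -- rounding unit.
  have hcQ : ∀ Q, N.IsPath Q → c ≤ 2 * minmax w₁ w₂ Q := by
    intro Q hQ
    obtain ⟨c', P', hP', hle⟩ := hc N.t Q hQ.1 hQ.length_lt.le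
    obtain ⟨rfl, rfl⟩ : c = c' ∧ P = P' := by simpa [hP] using hP'
    rw [hsum] at hle
    have := le_max_left (Q.map w₁).sum (Q.map w₂).sum
    have := le_max_right (Q.map w₁).sum (Q.map w₂).sum
    unfold minmax
    linarith
  have hPc : minmax w₁ w₂ P ≤ c := by
    rw [hcP, hsum, minmax_le_iff]
    constructor <;> linarith [(hnn P).1, (hnn P).2]
  have htp := toPath_spec hw
  have htle := minmax_toPath_le h₁ h₂ hw
  rw [abv_val, hP]
  by_cases hc0 : c ≤ 0
  · simp only [hc0, reduceIte]
    refine ⟨_, rfl, htp.1, fun Q hQ => (htle.trans hPc).trans (hc0.trans ?_)⟩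
    exact mul_nonneg (by linarith) ((hnn Q).1.trans (le_max_left _ _))
  · have hc0' := not_le.1 hc0
    have hV : (0 : K) < N.numV := by
      have := N.s.pos
      exact_mod_cast this
    have hθ : 0 < roundingUnit N δ c := by unfold roundingUnit; positivity
    have hθ' : N.numV * roundingUnit N δ c = δ * (c / 2) := by
      unfold roundingUnit
      field_simp
    simp only [hc0, reduceIte]
    -- The shortest path for the sum fits into the table itself, so the selection always succeeds.
    obtain ⟨z, R, hR, hRw, hRle⟩ := dynProg_approx hθ h₁ h₂ htp.1 (htle.trans hPc)
    rw [hR]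
    refine ⟨_, rfl, (toPath_spec hRw).1, fun Q hQ => (minmax_toPath_le h₁ h₂ hRw).trans ?_⟩
    have hQc := hcQ Q hQ
    -- If Q fits into the table, the loss δ c/2 is at most δ times its value. If it does not, its
    -- value is at least c, while the result has value at most c + δ c/2.
    rcases le_total (minmax w₁ w₂ Q) c with hle | hle
    · obtain ⟨z', R', hR', -, hle'⟩ := dynProg_approx hθ h₁ h₂ hQ hle
      obtain ⟨rfl, rfl⟩ : z = z' ∧ R = R' := by simpa [hR] using hR'
      rw [hθ'] at hle'
      nlinarith
    · rw [hθ'] at hRle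
      nlinarith

end ABV

end PathApproximation

/-! ### The iterative algorithm and its guarantee -/

section Iteration

open Timed

section UAR

variable {K : Type} [Field K] [LinearOrder K] [BitSize K]

/-- One step of the modification of the weights. -/
def markStep {n : ℕ} (thr bigM : K) (tot : Fin n → K)
    (st : (Fin n → K) × (Fin n → K) × (Fin n → Bool)) (j : Fin n) :
    Timed ((Fin n → K) × (Fin n → K) × (Fin n → Bool)) := do
  let d ← Timed.get st.2.2 j
  let x ← Timed.get tot j
  let b ← Timed.le thr x
  if !d && b then do
    let w₁ ← Timed.set st.1 j bigM
    let w₂ ← Timed.set st.2.1 j bigM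
    let D ← Timed.set st.2.2 j true
    pure (w₁, w₂, D)
  else pure st

/-- The modification of the weights. -/
def mark {n : ℕ} (thr bigM : K) (tot : Fin n → K)
    (st : (Fin n → K) × (Fin n → K) × (Fin n → Bool)) :
    Timed ((Fin n → K) × (Fin n → K) × (Fin n → Bool)) :=
  forEach (markStep thr bigM tot) (List.finRange n) st

omit [Field K] in
theorem markStep_cases {n : ℕ} (thr bigM : K) (tot : Fin n → K)
    (st : (Fin n → K) × (Fin n → K) × (Fin n → Bool)) (j : Fin n) :
    ((markStep thr bigM tot st j).val = st ∧ (thr ≤ tot j → st.2.2 j = true)) ∨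
    (thr ≤ tot j ∧ (markStep thr bigM tot st j).val = (Function.update st.1 j bigM,
      Function.update st.2.1 j bigM, Function.update st.2.2 j true)) := by
  simp only [markStep, Timed.get, Timed.le, Timed.set, bind_val]
  by_cases h : thr ≤ tot j <;> rcases hd : st.2.2 j with _ | _ <;> simp [h]

/-- The marked jobs have the prohibitive weight, the other jobs their original weights. -/
def Consistent {n : ℕ} (bigM : K) (p₁ p₂ : Fin n → K)
    (st : (Fin n → K) × (Fin n → K) × (Fin n → Bool)) : Prop :=
  ∀ j, st.1 j = (if st.2.2 j then bigM else p₁ j) ∧ st.2.1 j = if st.2.2 j then bigM else p₂ j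

omit [Field K] in
theorem markStep_consistent {n : ℕ} {thr bigM : K} {tot p₁ p₂ : Fin n → K}
    {st : (Fin n → K) × (Fin n → K) × (Fin n → Bool)} (h : Consistent bigM p₁ p₂ st)
    (j : Fin n) : Consistent bigM p₁ p₂ (markStep thr bigM tot st j).val := by
  rcases markStep_cases thr bigM tot st j with ⟨h', -⟩ | ⟨-, h'⟩
  · rwa [h']
  · rw [h']
    intro i
    by_cases hi : i = j
    · subst hi; simp
    · simpa [Function.update_of_ne hi] using h i

omit [Field K] in
-- Marks are only added, and exactly for jobs reaching the threshold; the weights remain a function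
-- of the marks, which is all that the analysis of the loop has to know about them.
theorem mark_spec {n : ℕ} {thr bigM : K} {tot p₁ p₂ : Fin n → K}
    {st : (Fin n → K) × (Fin n → K) × (Fin n → Bool)} (h : Consistent bigM p₁ p₂ st) :
    Consistent bigM p₁ p₂ (mark thr bigM tot st).val ∧
      ∀ j, (mark thr bigM tot st).val.2.2 j = true ↔ st.2.2 j = true ∨ thr ≤ tot j := by
  have mono : ∀ i j (s : (Fin n → K) × (Fin n → K) × (Fin n → Bool)), s.2.2 i = true →
      (markStep thr bigM tot s j).val.2.2 i = true := by
    intro i j s hi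
    rcases markStep_cases thr bigM tot s j with ⟨h', -⟩ | ⟨-, h'⟩
    · rwa [h']
    · rw [h']
      by_cases hij : i = j
      · subst hij; simp
      · simpa [Function.update_of_ne hij] using hi
  refine ⟨forEach_inv (Consistent bigM p₁ p₂) _ _ h fun s j _ h => markStep_consistent h j,
    fun j => ⟨?_, ?_⟩⟩
  · refine forEach_inv (fun s : (Fin n → K) × (Fin n → K) × (Fin n → Bool) =>
      s.2.2 j = true → st.2.2 j = true ∨ thr ≤ tot j) _ _ Or.inl fun s i _ hs => ?_
    rcases markStep_cases thr bigM tot s i with ⟨h', -⟩ | ⟨h'', h'⟩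
    · rwa [h']
    · rw [h']
      by_cases hij : j = i
      · subst hij
        exact fun _ => .inr h''
      · simpa [Function.update_of_ne hij] using hs
  · rintro (hj | hj)
    · exact forEach_inv (fun s : (Fin n → K) × (Fin n → K) × (Fin n → Bool) =>
        s.2.2 j = true) _ _ hj fun s i _ hs => mono j i s hs
    · refine forEach_establish (fun _ => True)
        (fun j (s : (Fin n → K) × (Fin n → K) × (Fin n → Bool)) => thr ≤ tot j → s.2.2 j = true)
        (List.finRange n) st trivial (by simp) ?_ (fun i s j _ _ hs hi => mono i j s (hs hi))
        j (by simp) hj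
      intro s i _ _ hi
      rcases markStep_cases thr bigM tot s i with ⟨h', h''⟩ | ⟨-, h'⟩
      · rw [h']
        exact h'' hi
      · rw [h']
        simp

variable [FloorSemiring K]

theorem uarLoop_succ (N : Network)
    (alg : List (Fin N.numA) → Timed ((Fin N.numA × Fin 2 → K) × K))
    (ρ δ bigM : K) (tot : Fin N.numA → K) (k : ℕ) (w₁ w₂ : Fin N.numA → K)
    (D : Fin N.numA → Bool) (P : List (Fin N.numA)) (c : K) (best : Solution N.numA K) :
    uarLoop N alg ρ δ bigM tot (k + 1) w₁ w₂ D P c best = (do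
      let thr ← Timed.mul ρ c
      let hit ← any (fun j => Timed.get D j) P
      let big ← any (fun j => do
        let x ← Timed.get tot j
        Timed.le thr x) P
      if !hit && big then do
        let st ← mark thr bigM tot (w₁, w₂, D)
        match ← abv N δ st.1 st.2.1 with
        | none => pure best
        | some P => do
          let r ← alg P
          let b ← Timed.lt r.2 best.cmax
          uarLoop N alg ρ δ bigM tot k st.1 st.2.1 st.2.2 P r.2
            (if b then ⟨P, r.1, r.2⟩ else best)
      else pure best) := rfl

theorem uarLoop_succ_val (N : Network)
    (alg : List (Fin N.numA) → Timed ((Fin N.numA × Fin 2 → K) × K))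
    (ρ δ bigM : K) (tot : Fin N.numA → K) (k : ℕ) (w₁ w₂ : Fin N.numA → K)
    (D : Fin N.numA → Bool) (P : List (Fin N.numA)) (c : K) (best : Solution N.numA K) :
    (uarLoop N alg ρ δ bigM tot (k + 1) w₁ w₂ D P c best).val =
      if (∀ j ∈ P, D j = false) ∧ ∃ j ∈ P, ρ * c ≤ tot j then
        match (abv N δ (mark (ρ * c) bigM tot (w₁, w₂, D)).val.1
          (mark (ρ * c) bigM tot (w₁, w₂, D)).val.2.1).val with
        | none => best
        | some P => (uarLoop N alg ρ δ bigM tot k (mark (ρ * c) bigM tot (w₁, w₂, D)).val.1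
            (mark (ρ * c) bigM tot (w₁, w₂, D)).val.2.1 (mark (ρ * c) bigM tot (w₁, w₂, D)).val.2.2
            P (alg P).val.2
            (if (alg P).val.2 < best.cmax then ⟨P, (alg P).val.1, (alg P).val.2⟩ else best)).val
      else best := by
  rw [uarLoop_succ]
  simp only [bind_val, any_val, Timed.mul, Timed.get, Timed.le, Timed.lt]
  have : ((!P.any fun x => D x) && P.any fun x => decide (ρ * c ≤ tot x)) = true ↔
      (∀ j ∈ P, D j = false) ∧ ∃ j ∈ P, ρ * c ≤ tot j := by simp
  by_cases h : (∀ j ∈ P, D j = false) ∧ ∃ j ∈ P, ρ * c ≤ tot j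
  · rw [if_pos h, if_pos (this.2 h)]
    simp only [bind_val]
    split <;> simp_all
  · rw [if_neg h, if_neg fun h' => h (this.1 h')]
    rfl

variable [IsStrictOrderedRing K] (I : ShopPath K)

/-- A path with its schedule by Jackson's rule. -/
def IsJacksonSolution (sol : Solution I.numA K) : Prop :=
  I.IsPath sol.path ∧ sol.start = (jackson I.job sol.path).val.1 ∧
    sol.cmax = (jackson I.job sol.path).val.2

variable {I}

omit [IsStrictOrderedRing K] [FloorSemiring K] in
theorem isJacksonSolution_ite {P : List (Fin I.numA)} (hP : I.IsPath P)
    {best : Solution I.numA K} (hb : IsJacksonSolution I best) :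
    IsJacksonSolution I (if (jackson I.job P).val.2 < best.cmax then
      ⟨P, (jackson I.job P).val.1, (jackson I.job P).val.2⟩ else best) := by
  split_ifs
  · exact ⟨hP, rfl, rfl⟩
  · exact hb

omit [IsStrictOrderedRing K] [FloorSemiring K] in
theorem cmax_ite (P : List (Fin I.numA)) (best : Solution I.numA K) :
    (if (jackson I.job P).val.2 < best.cmax then
      ⟨P, (jackson I.job P).val.1, (jackson I.job P).val.2⟩ else best : Solution _ _).cmax =
      min (jackson I.job P).val.2 best.cmax := by
  split_ifs with h
  · exact (min_eq_left h.le).symm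
  · exact (min_eq_right (not_lt.1 h)).symm

omit [BitSize K] [FloorSemiring K] in
theorem Consistent.nonneg {bigM : K} (hM : 0 ≤ bigM)
    {st : (Fin I.numA → K) × (Fin I.numA → K) × (Fin I.numA → Bool)}
    (h : Consistent bigM (fun j => (I.job j).load 0) (fun j => (I.job j).load 1) st) :
    (∀ j, 0 ≤ st.1 j) ∧ ∀ j, 0 ≤ st.2.1 j := by
  refine ⟨fun j => ?_, fun j => ?_⟩
  · rw [(h j).1]; split_ifs; exacts [hM, (I.job j).load_nonneg 0]
  · rw [(h j).2]; split_ifs; exacts [hM, (I.job j).load_nonneg 1]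

/-- The stored solution is replaced only by a strictly better Jackson schedule of a path. Together
with monotonicity, it suffices that some solution met on the way is good. -/
theorem uarLoop_isJacksonSolution {ρ δ bigM : K} (hδ : 0 < δ) (hM : 0 ≤ bigM)
    (tot : Fin I.numA → K) (hex : ∃ P, I.IsPath P) :
    ∀ (k : ℕ) (w₁ w₂ : Fin I.numA → K) (D : Fin I.numA → Bool) (P : List (Fin I.numA)) (c : K)
      (best : Solution I.numA K),
      Consistent bigM (fun j => (I.job j).load 0) (fun j => (I.job j).load 1) (w₁, w₂, D) →
      IsJacksonSolution I best →
      IsJacksonSolution I (uarLoop I.toNetwork (jackson I.job) ρ δ bigM tot k w₁ w₂ D P c best).val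
      ∧ (uarLoop I.toNetwork (jackson I.job) ρ δ bigM tot k w₁ w₂ D P c best).val.cmax ≤
        best.cmax := by
  intro k
  induction k with
  | zero => exact fun w₁ w₂ D P c best _ h => ⟨h, le_rfl⟩
  | succ k ih =>
    intro w₁ w₂ D P c best hc h
    rw [uarLoop_succ_val]
    split_ifs
    · have hc' := (mark_spec (thr := ρ * c) (tot := tot) hc).1
      obtain ⟨P', hP', hpath, -⟩ := abv_approx hδ (hc'.nonneg hM).1 (hc'.nonneg hM).2 hex
      rw [hP']
      have := ih _ _ _ P' (jackson I.job P').val.2 _ hc' (isJacksonSolution_ite hpath h)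
      refine ⟨this.1, this.2.trans ?_⟩
      rw [cmax_ite]
      exact min_le_right _ _
    · exact ⟨h, le_rfl⟩

/-- As long as no job of the path `Q` is marked, the loop ends with a solution within the
claimed factor of each schedule for `Q`. -/
theorem uarLoop_approx {ε bigM : K} (hε : 0 < ε) (tot : Fin I.numA → K)
    (htot : ∀ j, tot j = (I.job j).load 0 + (I.job j).load 1)
    (hM : ∀ m, (1 + 2 / 3 * ε) * loadSum I.job m (List.finRange I.numA) < bigM)
    {Q : List (Fin I.numA)} (hQ : I.IsPath Q) {σ : Fin I.numA × Fin 2 → K}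
    (hσ : IsSchedule I.job Q.toFinset σ) :
    ∀ (k : ℕ) (w₁ w₂ : Fin I.numA → K) (D : Fin I.numA → Bool) (P : List (Fin I.numA))
      (best : Solution I.numA K),
      Consistent bigM (fun j => (I.job j).load 0) (fun j => (I.job j).load 1) (w₁, w₂, D) →
      IsJacksonSolution I best → I.IsPath P →
      (∀ R, I.IsPath R → minmax w₁ w₂ P ≤ (1 + 2 / 3 * ε) * minmax w₁ w₂ R) →
      best.cmax ≤ (jackson I.job P).val.2 →
      (Finset.univ.filter fun j => D j = false).card ≤ k →
      (∀ j ∈ Q, D j = false) →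
      (uarLoop I.toNetwork (jackson I.job) (2 / 3) (2 / 3 * ε) bigM tot k w₁ w₂ D P
        (jackson I.job P).val.2 best).val.cmax ≤
        (3 / 2 + ε) * makespan I.job Q.toFinset σ := by
  have hM0 : 0 ≤ bigM := (mul_nonneg (by positivity) (loadSum_nonneg I.job 0 _)).trans (hM 0).le
  have hC := makespan_nonneg I.job σ Q.toFinset
  -- While Q is unmarked its weights are its loads. A marked job on P would make the value of P at
  -- least `bigM`, more than 1 + δ times the larger load of Q; so P is unmarked too and its weights
  -- are its loads.
  have clean : ∀ (w₁ w₂ : Fin I.numA → K) (D : Fin I.numA → Bool) (P : List (Fin I.numA)),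
      Consistent bigM (fun j => (I.job j).load 0) (fun j => (I.job j).load 1) (w₁, w₂, D) →
      (∀ R, I.IsPath R → minmax w₁ w₂ P ≤ (1 + 2 / 3 * ε) * minmax w₁ w₂ R) →
      (∀ j ∈ Q, D j = false) → (∀ j ∈ P, D j = false) ∧
        Max.max (loadSum I.job 0 P) (loadSum I.job 1 P) ≤
          (1 + 2 / 3 * ε) * makespan I.job Q.toFinset σ := by
    intro w₁ w₂ D P hc hmin hQD
    have heq : ∀ R : List (Fin I.numA), (∀ j ∈ R, D j = false) →
        minmax w₁ w₂ R = Max.max (loadSum I.job 0 R) (loadSum I.job 1 R) := by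
      intro R hR
      unfold minmax loadSum
      congr 2 <;> refine List.map_congr_left fun j hj => ?_
      · exact (hc j).1.trans (by simp [hR j hj])
      · exact (hc j).2.trans (by simp [hR j hj])
    have h1 := hmin Q hQ
    rw [heq Q hQD] at h1
    have hPD : ∀ j ∈ P, D j = false := by
      intro j hj
      by_contra hD
      have h2 : w₁ j = bigM := (hc j).1.trans (by simp [hD])
      have h3 : w₁ j ≤ (P.map w₁).sum :=
        List.single_le_sum (by simpa using fun a _ => (hc.nonneg hM0).1 a) _
          (List.mem_map_of_mem hj)
      have h4 : (P.map w₁).sum ≤ minmax w₁ w₂ P := le_max_left _ _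
      have h5 : ∀ m, (1 + 2 / 3 * ε) * loadSum I.job m Q < bigM := fun m =>
        lt_of_le_of_lt (mul_le_mul_of_nonneg_left
          (loadSum_subset I.job m hQ.nodup fun j _ => List.mem_finRange j) (by positivity)) (hM m)
      rcases max_choice (loadSum I.job 0 Q) (loadSum I.job 1 Q) with h | h <;> rw [h] at h1
      · linarith [h5 0]
      · linarith [h5 1]
    refine ⟨hPD, ?_⟩
    rw [← heq P hPD]
    exact h1.trans (mul_le_mul_of_nonneg_left
      (max_le (hσ.loadSum_le hQ.nodup 0) (hσ.loadSum_le hQ.nodup 1)) (by positivity))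
  -- Here the accuracy 2ε/3 pays off: 3/2 (1 + 2ε/3) = 3/2 + ε.
  have leave : ∀ P, I.IsPath P → Max.max (loadSum I.job 0 P) (loadSum I.job 1 P) ≤
      (1 + 2 / 3 * ε) * makespan I.job Q.toFinset σ →
      (∀ j ∈ P, tot j < 2 / 3 * (jackson I.job P).val.2) →
      (jackson I.job P).val.2 ≤ (3 / 2 + ε) * makespan I.job Q.toFinset σ := by
    intro P hP hle hbig
    have := jackson_le_of_small I.job hP.nodup fun j hj => by rw [← htot]; exact hbig j hj
    linarith
  intro k
  induction k with
  | zero =>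
    intro w₁ w₂ D P best hc hb hP hmin hle hk hQD
    obtain ⟨hPD, hload⟩ := clean w₁ w₂ D P hc hmin hQD
    refine hle.trans (leave P hP hload fun j hj => ?_)
    -- With no rounds left all jobs are marked; as P has no marked job, it is empty and the
    -- condition on its jobs is vacuous.
    have : ∀ j, D j = true := by
      simpa [Finset.filter_eq_empty_iff] using hk
    have := hPD j hj
    simp_all
  | succ k ih =>
    intro w₁ w₂ D P best hc hb hP hmin hle hk hQD
    obtain ⟨hPD, hload⟩ := clean w₁ w₂ D P hc hmin hQD
    have hJ := (uarLoop_isJacksonSolution (ρ := 2 / 3) (δ := 2 / 3 * ε) (by positivity) hM0 tot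
      ⟨Q, hQ⟩ (k + 1) w₁ w₂ D P (jackson I.job P).val.2 best hc hb).2
    by_cases hbig : ∃ j ∈ P, 2 / 3 * (jackson I.job P).val.2 ≤ tot j
    · obtain ⟨hc', hD'⟩ := mark_spec (thr := 2 / 3 * (jackson I.job P).val.2) (tot := tot) hc
      by_cases hQ' : ∃ j ∈ Q, 2 / 3 * (jackson I.job P).val.2 ≤ tot j
      -- A long job on Q forces the makespan of its schedule to be at least 2/3 of the current one,
      -- so the current solution is already within 3/2.
      · obtain ⟨j, hj, hjQ⟩ := hQ'
        have h1 := hσ.load_add_load_le (List.mem_toFinset.2 hj)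
        rw [htot] at hjQ
        have := mul_nonneg hε.le hC
        linarith
      · rw [uarLoop_succ_val, if_pos ⟨hPD, hbig⟩]
        obtain ⟨P', hP', hpath, hmin'⟩ := abv_approx (δ := 2 / 3 * ε) (by positivity)
          (hc'.nonneg hM0).1 (hc'.nonneg hM0).2 ⟨Q, hQ⟩
        rw [hP']
        refine ih _ _ _ P' _ hc' (isJacksonSolution_ite hpath hb) hpath hmin' ?_ ?_ ?_
        · rw [cmax_ite]
          exact min_le_left _ _
        -- The long job of P was unmarked and becomes marked, so the number of unmarked jobs drops
        -- and the round bound stays sufficient.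
        · obtain ⟨j, hj, hjP⟩ := hbig
          refine Nat.le_of_lt_succ (lt_of_lt_of_le (Finset.card_lt_card ?_) hk)
          refine Finset.ssubset_iff_of_subset ?_ |>.2 ⟨j, by simpa using hPD j hj, ?_⟩
          · intro i hi
            simp only [Finset.mem_filter, Finset.mem_univ, true_and] at hi ⊢
            by_contra h
            have := (hD' i).2 (.inl (by simpa using h))
            simp [hi] at this
          · simp [(hD' j).2 (.inr hjP)]
        · intro j hj
          by_contra h
          rcases (hD' j).1 (by simpa using h) with h | h
          · have := hQD j hj
            simp_all
          · exact hQ' ⟨j, hj, h⟩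
    · push Not at hbig
      exact hJ.trans (hle.trans (leave P hP hload hbig))

omit [LinearOrder K] [FloorSemiring K] [IsStrictOrderedRing K] in
theorem sumLoop_val {n : ℕ} (tot : Fin n → K) (L : List (Fin n)) (z : K) :
    (forEach (fun z j => do
      let x ← Timed.get tot j
      Timed.add z x) L z).val = z + (L.map tot).sum := by
  induction L generalizing z with
  | nil => simp
  | cons j L ih =>
    rw [forEach_cons_val, ih, List.map_cons, List.sum_cons, ← add_assoc]
    rfl

/-- The approximation guarantee. -/
theorem jjar_approx {ε : K} (hε : 0 < ε) (I : ShopPath K) :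
    ((¬ ∃ P, I.IsPath P) → (jjar I ε).val = none) ∧
    ((∃ P, I.IsPath P) → ∃ out : Solution I.numA K, (jjar I ε).val = some out ∧
      I.IsPath out.path ∧ IsSchedule I.job out.path.toFinset out.start ∧
      makespan I.job out.path.toFinset out.start = out.cmax ∧
      ∀ (P : List (Fin I.numA)) (σ : Fin I.numA × Fin 2 → K),
        I.IsPath P → IsSchedule I.job P.toFinset σ →
          out.cmax ≤ (3 / 2 + ε) * makespan I.job P.toFinset σ) := by
  have hval : (jjar I ε).val = (uar I (jackson I.job) (2 / 3) (2 / 3 * ε)).val := rfl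
  rw [hval]
  simp only [uar, bind_val, tabulate_spec, loadT, Timed.get, Timed.add]
  constructor
  · intro h
    rw [abv_none h]
    rfl
  · intro hex
    obtain ⟨P, hP, hpath, hmin⟩ := abv_approx (δ := 2 / 3 * ε) (by positivity)
      (fun j => (I.job j).load_nonneg 0) (fun j => (I.job j).load_nonneg 1) hex
    simp only [hP, bind_val, Timed.mul, Timed.fill, pure_val]
    have hsum := sumLoop_val (fun j => (I.job j).load 0 + (I.job j).load 1)
      (List.finRange I.numA) (0 : K)
    simp only [Timed.get, Timed.add] at hsum
    rw [hsum, zero_add, List.sum_map_add]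
    set bigM : K := (1 + 2 / 3 * ε) * ((List.map (fun j => (I.job j).load 0)
      (List.finRange I.numA)).sum + (List.map (fun j => (I.job j).load 1)
      (List.finRange I.numA)).sum) + 1 with hbigM
    -- The summand 1 in the prohibitive weight makes the inequality strict even if all processing
    -- times are 0.
    have hM : ∀ m, (1 + 2 / 3 * ε) * loadSum I.job m (List.finRange I.numA) < bigM := by
      have h0 := mul_nonneg (a := 1 + 2 / 3 * ε) (by positivity)
        (loadSum_nonneg I.job 0 (List.finRange I.numA))
      have h1 := mul_nonneg (a := 1 + 2 / 3 * ε) (by positivity)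
        (loadSum_nonneg I.job 1 (List.finRange I.numA))
      have : bigM = (1 + 2 / 3 * ε) * (loadSum I.job 0 (List.finRange I.numA) +
        loadSum I.job 1 (List.finRange I.numA)) + 1 := rfl
      intro m
      fin_cases m
      · show (1 + 2 / 3 * ε) * loadSum I.job 0 (List.finRange I.numA) < bigM
        linarith
      · show (1 + 2 / 3 * ε) * loadSum I.job 1 (List.finRange I.numA) < bigM
        linarith
    have hM0 : 0 ≤ bigM :=
      (mul_nonneg (by positivity) (loadSum_nonneg I.job 0 _)).trans (hM 0).le
    have hc : Consistent bigM (fun j => (I.job j).load 0) (fun j => (I.job j).load 1)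
        (fun j => (I.job j).load 0, fun j => (I.job j).load 1, fun _ => false) := by
      intro j; simp
    have hb : IsJacksonSolution I ⟨P, (jackson I.job P).val.1, (jackson I.job P).val.2⟩ :=
      ⟨hpath, rfl, rfl⟩
    obtain ⟨⟨h1, h2, h3⟩, -⟩ := uarLoop_isJacksonSolution (ρ := 2 / 3) (δ := 2 / 3 * ε)
      (by positivity) hM0 (fun j => (I.job j).load 0 + (I.job j).load 1) hex I.numA _ _ _ P
      (jackson I.job P).val.2 _ hc hb
    refine ⟨_, rfl, h1, ?_, ?_, fun Q σ hQ hσ => ?_⟩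
    · rw [h2]; exact jackson_isSchedule I.job h1.nodup
    · rw [h2, h3]; exact jackson_makespan I.job h1.nodup
    · exact uarLoop_approx hε _ (fun _ => rfl) hM hQ hσ I.numA _ _ _ P _ hc hb hpath hmin le_rfl
        (by simp) (by simp)

end UAR

end Iteration

/-! ### Bit lengths of fractions over a common denominator -/

section BitLengths

theorem size_mul_le (a b : ℕ) : Nat.size (a * b) ≤ Nat.size a + Nat.size b := by
  rw [Nat.size_le, pow_add]
  exact Nat.mul_lt_mul'' (Nat.lt_size_self a) (Nat.lt_size_self b)

theorem size_add_le (a b : ℕ) : Nat.size (a + b) ≤ Nat.size a + Nat.size b + 1 := by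
  rw [Nat.size_le]
  have ha := Nat.lt_size_self a
  have hb := Nat.lt_size_self b
  have h1 : 2 ^ Nat.size a ≤ 2 ^ (Nat.size a + Nat.size b) := Nat.pow_le_pow_right (by simp) (by omega)
  have h2 : 2 ^ Nat.size b ≤ 2 ^ (Nat.size a + Nat.size b) := Nat.pow_le_pow_right (by simp) (by omega)
  rw [pow_succ]
  omega

theorem size_le_self (a : ℕ) : Nat.size a ≤ a := Nat.size_le.2 Nat.lt_two_pow_self

/-- `q` is a nonnegative fraction with denominator `N` and numerator at most `z`. -/
def Frac (N z : ℕ) (q : ℚ) : Prop := ∃ a : ℕ, a ≤ z ∧ q = a / N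

namespace Frac

variable {N M z y : ℕ} {p q : ℚ}

theorem nonneg (h : Frac N z q) : 0 ≤ q := by
  obtain ⟨a, -, rfl⟩ := h
  positivity

theorem mono (h : Frac N z q) (hz : z ≤ y) : Frac N y q := by
  obtain ⟨a, ha, rfl⟩ := h
  exact ⟨a, ha.trans hz, rfl⟩

theorem zero (N z : ℕ) : Frac N z 0 := ⟨0, by simp, by simp⟩

theorem natCast (k : ℕ) : Frac 1 k (k : ℚ) := ⟨k, le_rfl, by simp⟩

theorem of_nonneg (h : 0 ≤ q) : Frac q.den q.num.natAbs q := by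
  refine ⟨_, le_rfl, ?_⟩
  have : ((q.num.natAbs : ℕ) : ℚ) = (q.num : ℚ) := by
    rw [← Int.cast_natCast, Int.natAbs_of_nonneg (Rat.num_nonneg.2 h)]
  rw [this, Rat.num_div_den]

theorem add (hp : Frac N z p) (hq : Frac N y q) : Frac N (z + y) (p + q) := by
  obtain ⟨a, ha, rfl⟩ := hp
  obtain ⟨b, hb, rfl⟩ := hq
  exact ⟨a + b, by omega, by push_cast; ring⟩

theorem max (hp : Frac N z p) (hq : Frac N z q) : Frac N z (max p q) := by
  rcases max_choice p q with h | h <;> rw [h] <;> assumption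

theorem mul (hp : Frac N z p) (hq : Frac M y q) : Frac (N * M) (z * y) (p * q) := by
  obtain ⟨a, ha, rfl⟩ := hp
  obtain ⟨b, hb, rfl⟩ := hq
  exact ⟨a * b, Nat.mul_le_mul ha hb, by push_cast; rw [div_mul_div_comm]⟩

theorem div_natCast (hq : Frac N z q) (k : ℕ) : Frac (N * k) z (q / k) := by
  obtain ⟨b, hb, rfl⟩ := hq
  exact ⟨b, hb, by push_cast; rw [div_div]⟩

/-- Representations need not be reduced, so all numbers can be brought to one denominator. -/
theorem scale (hq : Frac N z q) {k : ℕ} (hk : 0 < k) : Frac (k * N) (k * z) q := by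
  obtain ⟨b, hb, rfl⟩ := hq
  refine ⟨k * b, Nat.mul_le_mul_left k hb, ?_⟩
  push_cast
  rw [mul_div_mul_left]
  positivity

theorem sum {ι : Type} {w : ι → ℚ} (hw : ∀ a, Frac N z (w a)) (P : List ι) :
    Frac N (P.length * z) (P.map w).sum := by
  induction P with
  | nil => exact zero _ _
  | cons a P ih =>
    rw [List.map_cons, List.sum_cons, List.length_cons, Nat.succ_mul, add_comm (P.length * z)]
    exact (hw a).add ih

/-- The numerator and denominator of the reduced fraction divide those of any representation (a zero
numerator stays zero), so an arbitrary representation bounds the bit length. -/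
theorem bits_le (h : Frac N z q) (hN : 0 < N) {N' z' : ℕ} (hN' : N ≤ N') (hz : z ≤ z') :
    BitSize.bits q ≤ Nat.size N' + Nat.size z' := by
  obtain ⟨a, ha, rfl⟩ := h
  have h1 : ((a : ℚ) / N) = ((a : ℤ) : ℚ) / ((N : ℤ) : ℚ) := by push_cast; rfl
  have hden : ((a : ℚ) / N).den ≤ N := by
    rw [h1]
    refine Nat.le_of_dvd hN ?_
    have := Rat.den_dvd (a : ℤ) (N : ℤ)
    rw [Rat.divInt_eq_div] at this
    exact_mod_cast this
  have hnum : ((a : ℚ) / N).num.natAbs ≤ a := by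
    rcases Nat.eq_zero_or_pos a with rfl | ha'
    · simp
    · refine Nat.le_of_dvd ha' ?_
      rw [h1]
      have := Rat.num_dvd (a : ℤ) (b := (N : ℤ)) (by exact_mod_cast hN.ne')
      rw [Rat.divInt_eq_div] at this
      simpa using Int.natAbs_dvd_natAbs.2 this
  have : BitSize.bits ((a : ℚ) / N) =
      Nat.size ((a : ℚ) / N).num.natAbs + Nat.size ((a : ℚ) / N).den := rfl
  rw [this, add_comm]
  exact Nat.add_le_add (Nat.size_le_size (hden.trans hN'))
    (Nat.size_le_size (hnum.trans (ha.trans hz)))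

end Frac

theorem opCost_le {p q : ℚ} {W : ℕ} (hp : BitSize.bits p ≤ W) (hq : BitSize.bits q ≤ W) :
    Timed.opCost p q ≤ (2 * W + 1) ^ 2 := by
  unfold Timed.opCost
  gcongr
  omega

end BitLengths

/-! ### Closure properties of polynomial bounds -/

section PolynomialBounds

/-- A quantity that is bounded by a polynomial in the length of the input. -/
def PolyBdd (f : ShopPath ℚ → ℕ) : Prop := ∃ p : Polynomial ℕ, ∀ I, f I ≤ p.eval I.size

namespace PolyBdd

variable {f g : ShopPath ℚ → ℕ}

theorem mono (hg : PolyBdd g) (h : ∀ I, f I ≤ g I) : PolyBdd f := by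
  obtain ⟨p, hp⟩ := hg
  exact ⟨p, fun I => (h I).trans (hp I)⟩

theorem const (c : ℕ) : PolyBdd fun _ => c := ⟨Polynomial.C c, by simp⟩

theorem size : PolyBdd fun I => I.size := ⟨Polynomial.X, by simp⟩

theorem add (hf : PolyBdd f) (hg : PolyBdd g) : PolyBdd fun I => f I + g I := by
  obtain ⟨p, hp⟩ := hf
  obtain ⟨q, hq⟩ := hg
  exact ⟨p + q, fun I => by rw [Polynomial.eval_add]; exact Nat.add_le_add (hp I) (hq I)⟩

theorem mul (hf : PolyBdd f) (hg : PolyBdd g) : PolyBdd fun I => f I * g I := by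
  obtain ⟨p, hp⟩ := hf
  obtain ⟨q, hq⟩ := hg
  exact ⟨p * q, fun I => by rw [Polynomial.eval_mul]; exact Nat.mul_le_mul (hp I) (hq I)⟩

theorem sq (hf : PolyBdd f) : PolyBdd fun I => f I ^ 2 := by
  simpa only [pow_two] using hf.mul hf

theorem numV : PolyBdd fun I => I.numV := size.mono fun I => by unfold ShopPath.size; omega

theorem numA : PolyBdd fun I => I.numA := size.mono fun I => by unfold ShopPath.size; omega

/-- Numerators and denominators may be exponentially large; for them only the bit length is
polynomially bounded, so closure under + and * is needed for `Nat.size` as well. -/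
theorem size_add (hf : PolyBdd fun I => Nat.size (f I)) (hg : PolyBdd fun I => Nat.size (g I)) :
    PolyBdd fun I => Nat.size (f I + g I) :=
  ((hf.add hg).add (const 1)).mono fun I => size_add_le (f I) (g I)

theorem size_mul (hf : PolyBdd fun I => Nat.size (f I)) (hg : PolyBdd fun I => Nat.size (g I)) :
    PolyBdd fun I => Nat.size (f I * g I) :=
  (hf.add hg).mono fun I => size_mul_le (f I) (g I)

theorem size_of (hf : PolyBdd f) : PolyBdd fun I => Nat.size (f I) :=
  hf.mono fun I => size_le_self (f I)

end PolyBdd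

end PolynomialBounds

/-! ### The running time of Jackson's rule -/

section PlacementTime

variable {n : ℕ} {job : Fin n → Job ℚ} {N Z W X : ℕ}

/-- All start times and the time from which the machine is free are fractions with denominator
`N` and numerator at most `k * Z`. -/
def FracState (N Z k : ℕ) (st : (Fin n × Fin 2 → ℚ) × ℚ) : Prop :=
  (∀ i, Frac N (k * Z) (st.1 i)) ∧ Frac N (k * Z) st.2

theorem FracState.mono {k l : ℕ} {st : (Fin n × Fin 2 → ℚ) × ℚ} (h : FracState N Z k st)
    (hkl : k ≤ l) : FracState N Z l st :=
  ⟨fun i => (h.1 i).mono (Nat.mul_le_mul_right Z hkl), h.2.mono (Nat.mul_le_mul_right Z hkl)⟩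

theorem FracState.update {k : ℕ} {st : (Fin n × Fin 2 → ℚ) × ℚ} (h : FracState N Z k st)
    (i : Fin n × Fin 2) {x f : ℚ} (hx : Frac N (k * Z) x) (hf : Frac N (k * Z) f) :
    FracState N Z k (Function.update st.1 i x, f) := by
  refine ⟨fun i' => ?_, hf⟩
  by_cases hi : i' = i
  · subst hi; simpa using hx
  · simpa [Function.update_of_ne hi] using h.1 i'

/-- Scheduling only adds loads and takes maxima, so the denominator is fixed and numerators grow
linearly. One load per job is added here; two are counted so that the same index fits `placeSecond`.
-/
theorem placeFirst_time (hN : 0 < N) (hjob : ∀ j m, Frac N Z ((job j).load m)) {K : ℕ}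
    (hW : Nat.size N + Nat.size (K * Z) ≤ W) (m : Fin 2) (L : List (Fin n)) (k : ℕ)
    (hk : 2 * (k + L.length) ≤ K) {st : (Fin n × Fin 2 → ℚ) × ℚ} (h : FracState N Z (2 * k) st) :
    FracState N Z (2 * (k + L.length)) (placeFirst job m L st).val ∧
      (placeFirst job m L st).time ≤ L.length * ((2 * W + 1) ^ 2 + 4 + 1) + 1 := by
  refine Timed.forEach_spec (fun i => FracState N Z (2 * i)) _ L k st h ?_
  intro i s j _ hki hik hs
  have hf := (hs.2.add (hjob j m)).mono (y := 2 * (i + 1) * Z) (by nlinarith)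
  constructor
  · exact (hs.mono (l := 2 * (i + 1)) (by omega)).update (j, m) (hs.2.mono (by nlinarith)) hf
  · simp only [loadT, Timed.set, Timed.add, Timed.bind_time, Timed.pure_time]
    have := opCost_le (p := s.2) (q := (job j).load m)
      ((hs.2.bits_le hN le_rfl (Nat.mul_le_mul_right Z (by omega))).trans hW)
      (((hjob j m).bits_le hN le_rfl (Nat.le_mul_of_pos_left Z (by omega))).trans hW)
    omega

theorem placeSecond_time (hN : 0 < N) (hjob : ∀ j m, Frac N Z ((job j).load m)) {K : ℕ}
    (hW : Nat.size N + Nat.size (K * Z) ≤ W) (a b : Fin 2) (L : List (Fin n)) (k : ℕ)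
    (hk : 2 * (k + L.length) ≤ K) {st : (Fin n × Fin 2 → ℚ) × ℚ} (h : FracState N Z (2 * k) st) :
    FracState N Z (2 * (k + L.length)) (placeSecond job a b L st).val ∧
      (placeSecond job a b L st).time ≤ L.length * (3 * (2 * W + 1) ^ 2 + 8 + 1) + 1 := by
  refine Timed.forEach_spec (fun i => FracState N Z (2 * i)) _ L k st h ?_
  intro i s j _ hki hik hs
  -- Two loads enter per job: one in the completion time on a, one in the new clock of b.
  have hc := ((hs.1 (j, a)).add (hjob j a)).mono (y := (2 * i + 1) * Z) (by nlinarith)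
  have hx := (hs.2.mono (y := (2 * i + 1) * Z) (by nlinarith)).max hc
  have hf := (hx.add (hjob j b)).mono (y := 2 * (i + 1) * Z) (by nlinarith)
  have bits : ∀ {l q}, Frac N (l * Z) q → l ≤ 2 * i + 2 → BitSize.bits q ≤ W := fun hq hl =>
    (hq.bits_le hN le_rfl (Nat.mul_le_mul_right Z (by omega))).trans hW
  have bits' : ∀ m, BitSize.bits ((job j).load m) ≤ W := fun m =>
    bits (l := 1) ((hjob j m).mono (by omega)) (by omega)
  constructor
  · exact (hs.mono (l := 2 * (i + 1)) (by omega)).update (j, b) (hx.mono (by nlinarith)) hf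
  · simp only [loadT, Timed.get, Timed.set, Timed.add, Timed.max, Timed.bind_time,
      Timed.pure_time]
    have h1 := opCost_le (bits (hs.1 (j, a)) (by omega)) (bits' a)
    have h2 := opCost_le (bits hs.2 (by omega)) (bits hc (by omega))
    have h3 := opCost_le (bits hx (by omega)) (bits' b)
    omega

theorem johnsonLe_time (hjob : ∀ j m, BitSize.bits ((job j).load m) ≤ W) (a b : Fin 2)
    (i j : Fin n) : (johnsonLe job a b i j).time ≤ 3 * (2 * W + 1) ^ 2 + 12 := by
  have h := fun i j m m' => opCost_le (hjob i m) (hjob j m')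
  have h1 := h i i a b
  have h2 := h j j a b
  have h3 := h i j a a
  have h4 := h j i b b
  simp only [johnsonLe, loadT, Timed.le, Timed.bind_time]
  split <;> simp only [Timed.pure_time] <;> omega

/-- A bound for the time of Jackson's rule for `n` jobs if an operation costs at most `X`. -/
def jacksonTime (n X : ℕ) : ℕ :=
  4 * (n * 4 + 1) + 2 * ((n + 1) * (n * (3 * X + 12 + 1) + 2)) + 2 * n +
    4 * (n * (X + 4 + 1) + 1) + 2 * (n * (3 * X + 8 + 1) + 1) + X

/-- Six runs of at most n jobs, each job accounting for two units of Z, give the factor 12 n; the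
additional 12 is slack. -/
theorem jackson_time (hN : 0 < N) (hjob : ∀ j m, Frac N Z ((job j).load m))
    (hW : Nat.size N + Nat.size ((12 * n + 12) * Z) ≤ W) {L : List (Fin n)} (hL : L.length ≤ n) :
    Frac N ((12 * n + 12) * Z) (jackson job L).val.2 ∧
      (jackson job L).time ≤ jacksonTime n ((2 * W + 1) ^ 2) := by
  have bits : ∀ j m, BitSize.bits ((job j).load m) ≤ W := fun j m =>
    ((hjob j m).bits_le hN le_rfl (Nat.le_mul_of_pos_left Z (by omega))).trans hW
  have hr : ∀ r, (Timed.filter (hasRoute job r) L).time ≤ n * 4 + 1 ∧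
      (Timed.filter (hasRoute job r) L).val.length ≤ n := fun r => by
    constructor
    · have := Timed.filter_time_le (hasRoute job r) 3 L fun x _ => le_rfl
      omega
    · rw [Timed.filter_val]
      exact (List.length_filter_le _ _).trans hL
  have hsort : ∀ a b (L' : List (Fin n)), L'.length ≤ n →
      (johnsonSort job a b L').time ≤ (n + 1) * (n * (3 * (2 * W + 1) ^ 2 + 12 + 1) + 2) ∧
      (johnsonSort job a b L').val.length ≤ n := fun a b L' hL' => by
    constructor
    · refine (Timed.sort_time_le _ _ L' (johnsonLe_time bits a b)).trans ?_
      gcongr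
    · rw [(johnsonSort_perm job a b L').length_eq]
      exact hL'
  have hlen : ∀ l c, l ≤ n → l * c + 1 ≤ n * c + 1 := fun l c hl => by gcongr
  simp only [jackson, Timed.bind_val, Timed.bind_time, Timed.pure_time, Timed.pure_val]
  obtain ⟨f1, l1⟩ := hr [0, 1]
  obtain ⟨f2, l2⟩ := hr [1, 0]
  obtain ⟨f3, l3⟩ := hr [0]
  obtain ⟨f4, l4⟩ := hr [1]
  revert f1 l1 f2 l2 f3 l3 f4 l4
  generalize Timed.filter (hasRoute job [0, 1]) L = J₀₁
  generalize Timed.filter (hasRoute job [1, 0]) L = J₁₀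
  generalize Timed.filter (hasRoute job [0]) L = J₀
  generalize Timed.filter (hasRoute job [1]) L = J₁
  intro f1 l1 f2 l2 f3 l3 f4 l4
  obtain ⟨s1, m1⟩ := hsort 0 1 J₀₁.val l1
  obtain ⟨s2, m2⟩ := hsort 1 0 J₁₀.val l2
  revert s1 m1 s2 m2
  generalize johnsonSort job 0 1 J₀₁.val = L₀₁
  generalize johnsonSort job 1 0 J₁₀.val = L₁₀
  intro s1 m1 s2 m2
  have hfill : (Timed.fill (2 * n) (0 : ℚ) : Timed (Fin n × Fin 2 → ℚ)).time = 2 * n := rfl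
  rw [hfill]
  generalize hσ : (Timed.fill (2 * n) (0 : ℚ) : Timed (Fin n × Fin 2 → ℚ)).val = σ₀
  have h0 : FracState N Z (2 * 0) ((σ₀, 0) : (Fin n × Fin 2 → ℚ) × ℚ) := by
    subst hσ
    exact ⟨fun i => Frac.zero _ _, Frac.zero _ _⟩
  obtain ⟨b1, t1⟩ := placeFirst_time hN hjob hW 0 L₀₁.val 0 (by omega) h0
  revert b1 t1
  generalize placeFirst job 0 L₀₁.val (σ₀, 0) = x1
  intro b1 t1
  obtain ⟨b2, t2⟩ := placeFirst_time hN hjob hW 0 J₀.val _ (by omega) b1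
  revert b2 t2
  generalize placeFirst job 0 J₀.val x1.val = x2
  intro b2 t2
  obtain ⟨b3, t3⟩ := placeFirst_time hN hjob hW 1 L₁₀.val _ (by omega)
    (show FracState N Z _ (x2.val.1, 0) from ⟨b2.1, Frac.zero _ _⟩)
  revert b3 t3
  generalize placeFirst job 1 L₁₀.val (x2.val.1, 0) = y1
  intro b3 t3
  obtain ⟨b4, t4⟩ := placeFirst_time hN hjob hW 1 J₁.val _ (by omega) b3
  revert b4 t4
  generalize placeFirst job 1 J₁.val y1.val = y2
  intro b4 t4
  obtain ⟨b5, t5⟩ := placeSecond_time hN hjob hW 1 0 L₁₀.val _ (by omega)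
    (show FracState N Z _ (y2.val.1, x2.val.2) from
      ⟨b4.1, b2.2.mono (Nat.mul_le_mul_right Z (by omega))⟩)
  revert b5 t5
  generalize placeSecond job 1 0 L₁₀.val (y2.val.1, x2.val.2) = x3
  intro b5 t5
  obtain ⟨b6, t6⟩ := placeSecond_time hN hjob hW 0 1 L₀₁.val _ (by omega)
    (show FracState N Z _ (x3.val.1, y2.val.2) from
      ⟨b5.1, b4.2.mono (Nat.mul_le_mul_right Z (by omega))⟩)
  revert b6 t6
  generalize placeSecond job 0 1 L₀₁.val (x3.val.1, y2.val.2) = y3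
  intro b6 t6
  have c3 := b5.2.mono (y := (12 * n + 12) * Z) (Nat.mul_le_mul_right Z (by omega))
  have c6 := b6.2.mono (y := (12 * n + 12) * Z) (Nat.mul_le_mul_right Z (by omega))
  refine ⟨c3.max c6, ?_⟩
  have hmax : (Timed.max x3.val.2 y3.val.2).time ≤ (2 * W + 1) ^ 2 :=
    opCost_le ((c3.bits_le hN le_rfl le_rfl).trans hW) ((c6.bits_le hN le_rfl le_rfl).trans hW)
  have t1 := t1.trans (hlen _ _ m1)
  have t2 := t2.trans (hlen _ _ l3)
  have t3 := t3.trans (hlen _ _ m2)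
  have t4 := t4.trans (hlen _ _ l4)
  have t5 := t5.trans (hlen _ _ m2)
  have t6 := t6.trans (hlen _ _ m1)
  clear b1 b2 b3 b4 b5 b6 c3 c6 hW hlen hsort hr bits
  unfold jacksonTime
  generalize (2 * W + 1) ^ 2 = X at *
  generalize n * (3 * X + 12 + 1) + 2 = T₁ at *
  generalize (n + 1) * T₁ = T₁ at *
  generalize n * (X + 4 + 1) + 1 = T₂ at *
  generalize n * (3 * X + 8 + 1) + 1 = T₃ at *
  linarith

end PlacementTime

/-! ### The running time of ABV -/

section PathTime

variable {N : Network}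

theorem suffixFrom_time (v : Fin N.numV) (Q : List (Fin N.numA)) :
    (suffixFrom N v Q).time ≤ 2 * Q.length + 1 := by
  induction Q with
  | nil => simp only [suffixFrom, Timed.bind_time]; split <;> simp
  | cons a Q ih =>
    simp only [suffixFrom, Timed.bind_time, Timed.tick_time, Timed.get, List.length_cons]
    split
    · simp only [Timed.pure_time]; omega
    · omega

/-- Each arc causes one search in the cleaned tail, which is a sublist of the remaining walk; hence
a quadratic bound. -/
theorem eraseCycles_time (Q : List (Fin N.numA)) {x : Fin N.numV} (hw : N.IsWalk x Q N.t) :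
    (eraseCycles N Q).time ≤ (Q.length + 1) * (2 * Q.length + 3) := by
  induction Q generalizing x with
  | nil => simp [eraseCycles]
  | cons a Q ih =>
    obtain ⟨rfl, hw⟩ := hw
    have h1 := ih hw
    have h2 := (eraseCycles_spec Q hw).2.2.length_le
    have h3 := suffixFrom_time (N.src a) (eraseCycles N Q).val
    have h4 : (eraseCycles N (a :: Q)).time = 1 + ((eraseCycles N Q).time + (1 +
        (suffixFrom N (N.src a) (eraseCycles N Q).val).time)) := by
      simp only [eraseCycles, Timed.bind_time, Timed.tick_time, Timed.get]
      split <;> rfl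
    rw [h4, List.length_cons]
    nlinarith

/-- A bound for the time needed to remove the cycles from a walk with at most `V` arcs. -/
def toPathTime (V : ℕ) : ℕ := V + 1 + (V + 1) * (2 * V + 3)

theorem toPath_time {P : List (Fin N.numA)} (hw : N.IsWalk N.s P.reverse N.t)
    (hP : P.length ≤ N.numV) : (toPath N P).time ≤ toPathTime N.numV := by
  have h1 := Timed.reverse_time_le P
  have h2 := eraseCycles_time P.reverse hw
  simp only [toPath, Timed.bind_time, Timed.reverse_val]
  rw [List.length_reverse] at h2
  unfold toPathTime
  refine Nat.add_le_add (h1.trans (by omega)) (h2.trans ?_)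
  gcongr

/-- A label is a sum of at most k weights with the same denominator. -/
theorem validLabels_frac {w : Fin N.numA → ℚ} {M Z k : ℕ} (hw : ∀ a, Frac M Z (w a))
    {l : Fin N.numV → Option (ℚ × List (Fin N.numA))} (hl : ValidLabels w k l) {v : Fin N.numV}
    {d : ℚ} {P : List (Fin N.numA)} (h : l v = some (d, P)) : Frac M (k * Z) d := by
  obtain ⟨-, rfl, hk⟩ := hl v d P h
  exact (Frac.sum hw P).mono (Nat.mul_le_mul_right Z hk)

theorem relax_time {w : Fin N.numA → ℚ} {M Z W k : ℕ} (hM : 0 < M) (hw : ∀ a, Frac M Z (w a))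
    (hW : Nat.size M + Nat.size ((k + 1) * Z) ≤ W)
    {old new : Fin N.numV → Option (ℚ × List (Fin N.numA))} (ho : ValidLabels w k old)
    (hn : ValidLabels w (k + 1) new) (a : Fin N.numA) :
    (relax N w old new a).time ≤ 2 * (2 * W + 1) ^ 2 + 6 := by
  have bits : ∀ {l q}, Frac M (l * Z) q → l ≤ k + 1 → BitSize.bits q ≤ W := fun hq hl =>
    (hq.bits_le hM le_rfl (Nat.mul_le_mul_right Z hl)).trans hW
  simp only [relax, Timed.get, Timed.add, Timed.lt, Timed.set, Timed.bind_time]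
  rcases h1 : old (N.src a) with _ | ⟨d, P⟩
  · simp only [Timed.pure_time]; omega
  · have hd := validLabels_frac hw ho h1
    have hs := (hd.add (hw a)).mono (y := (k + 1) * Z) (by nlinarith)
    have c1 := opCost_le (bits hd (by omega)) (bits (l := 1) ((hw a).mono (by omega)) (by omega))
    rcases h2 : new (N.tgt a) with _ | ⟨e, R⟩
    · simp only [Timed.bind_time]; omega
    · have c2 := opCost_le (bits hs le_rfl) (bits (validLabels_frac hw hn h2) le_rfl)
      simp only [Timed.bind_time]
      split
      · simp only []; omega
      · simp only [Timed.pure_time]; omega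

/-- A bound for the time of the shortest path computation. -/
def bellmanFordTime (V A X : ℕ) : ℕ :=
  V + 1 + (V * (V + (A * (2 * X + 6 + 1) + 1) + 1) + 1)

theorem bellmanFord_time {w : Fin N.numA → ℚ} {M Z W : ℕ} (hM : 0 < M)
    (hw : ∀ a, Frac M Z (w a)) (hW : Nat.size M + Nat.size ((N.numV + 1) * Z) ≤ W) :
    (bellmanFord N w).time ≤ bellmanFordTime N.numV N.numA ((2 * W + 1) ^ 2) := by
  have key := Timed.iter_spec (f := fun old => do
      Timed.tick N.numV
      Timed.forEach (relax N w old) (List.finRange N.numA) old)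
    (fun k l => ValidLabels w k l) (N.numV + (N.numA * (2 * (2 * W + 1) ^ 2 + 6 + 1) + 1))
    N.numV 0 (Function.update (fun _ => none) N.s (some (0, []))) ?_ ?_
  · have : (bellmanFord N w).time = N.numV + (1 + (Timed.iter (fun old => do
      Timed.tick N.numV
      Timed.forEach (relax N w old) (List.finRange N.numA) old) N.numV
        (Function.update (fun _ => none) N.s (some (0, [])))).time) := rfl
    rw [this, ← add_assoc]
    exact Nat.add_le_add_left key.2 _
  · intro v d P h
    by_cases hv : v = N.s
    · subst hv
      rw [Function.update_self] at h
      obtain ⟨rfl, rfl⟩ : 0 = d ∧ [] = P := by simpa using h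
      simp [Network.IsWalk]
    · rw [Function.update_of_ne hv] at h
      simp at h
  · intro k old _ hk hv
    have hv' : ValidLabels w (k + 1) old := fun v d P h =>
      ⟨(hv v d P h).1, (hv v d P h).2.1, (hv v d P h).2.2.trans (Nat.le_succ k)⟩
    refine ⟨Timed.forEach_inv (ValidLabels w (k + 1)) _ _ hv' fun s a _ h =>
      relax_valid hv h a, ?_⟩
    have := Timed.forEach_time_le (f := relax N w old) (ValidLabels w (k + 1))
      (2 * (2 * W + 1) ^ 2 + 6) (List.finRange N.numA) old hv' fun s a _ h =>
        ⟨relax_valid hv h a, relax_time hM hw ((Nat.add_le_add_left (Nat.size_le_size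
          (Nat.mul_le_mul_right Z (by omega))) _).trans hW) hv h a⟩
    rw [List.length_finRange] at this
    exact Nat.add_le_add_left this _

theorem natOp_le {x y s : ℕ} (hx : x ≤ s) (hy : y ≤ s) :
    (Nat.size x + Nat.size y + 1) ^ 2 ≤ (2 * Nat.size s + 1) ^ 2 := by
  have := Nat.size_le_size hx
  have := Nat.size_le_size hy
  gcongr
  omega

/-- All operands are at most S: old lengths are at most B, and new ones exceed B by at most one
weight. -/
theorem extend_time {w₁ w₂ : Fin N.numA → ℕ} {B S : ℕ} (h₁ : ∀ a, B + w₁ a ≤ S)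
    (h₂ : ∀ a, B + w₂ a ≤ S) (old new : N.Table) (a : Fin N.numA) {x y : ℕ} (hx : x ≤ B)
    (hy : y ≤ B) :
    (extend N w₁ w₂ B old a x y new).time ≤ 4 * (2 * Nat.size S + 1) ^ 2 + 7 := by
  have h₁ := h₁ a
  have h₂ := h₂ a
  simp only [extend, Timed.get, Timed.natAdd, Timed.natLe, Timed.set, Timed.bind_time]
  rcases old (N.src a, x, y) with _ | P
  · simp only [Timed.pure_time]; omega
  · have c1 := natOp_le (s := S) (x := x) (y := w₁ a) (by omega) (by omega)
    have c2 := natOp_le (s := S) (x := y) (y := w₂ a) (by omega) (by omega)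
    have c3 := natOp_le (s := S) (x := x + w₁ a) (y := B) (by omega) (by omega)
    have c4 := natOp_le (s := S) (x := y + w₂ a) (y := B) (by omega) (by omega)
    simp only [Timed.bind_time]
    split
    · simp only [Timed.bind_time]
      split
      · simp only []; omega
      · simp only [Timed.pure_time]; omega
    · simp only [Timed.pure_time]; omega

/-- A bound for the time of the dynamic program and the selection of its best entry. -/
def tableTime (V A Y B : ℕ) : ℕ :=
  V * (B + 1) * (B + 1) + (1 + (V * (V * (B + 1) * (B + 1) +
    (A * ((B + 1) * ((B + 1) * (4 * Y + 7 + 1) + 1 + 1) + 1 + 1) + 1) + 1) + 1))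

theorem dynProg_time {w₁ w₂ : Fin N.numA → ℕ} {B S : ℕ} (h₁ : ∀ a, B + w₁ a ≤ S)
    (h₂ : ∀ a, B + w₂ a ≤ S) :
    (dynProg N w₁ w₂ B).time ≤ tableTime N.numV N.numA ((2 * Nat.size S + 1) ^ 2) B := by
  have key := Timed.iter_spec (f := fun old : N.Table => do
      Timed.tick (N.numV * (B + 1) * (B + 1))
      Timed.forEach (fun new a =>
        Timed.forEach (fun new x =>
          Timed.forEach (fun new y => extend N w₁ w₂ B old a x y new)
            (List.range (B + 1)) new)
          (List.range (B + 1)) new)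
        (List.finRange N.numA) old)
    (fun _ _ => True) (N.numV * (B + 1) * (B + 1) + (N.numA * ((B + 1) * ((B + 1) *
      (4 * (2 * Nat.size S + 1) ^ 2 + 7 + 1) + 1 + 1) + 1 + 1) + 1)) N.numV 0
    (Function.update (fun _ => none) (N.s, 0, 0) (some [])) trivial ?_
  · exact Nat.add_le_add_left (Nat.add_le_add_left key.2 1) _
  · intro _ old _ _ _
    refine ⟨trivial, ?_⟩
    simp only [Timed.bind_time, Timed.tick_time]
    refine Nat.add_le_add_left ?_ _
    refine (Timed.forEach_time_le (fun _ => True) ((B + 1) * ((B + 1) *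
      (4 * (2 * Nat.size S + 1) ^ 2 + 7 + 1) + 1 + 1) + 1) _ _ trivial
      fun new a _ _ => ⟨trivial, ?_⟩).trans_eq (by rw [List.length_finRange])
    refine (Timed.forEach_time_le (fun _ => True) ((B + 1) *
      (4 * (2 * Nat.size S + 1) ^ 2 + 7 + 1) + 1) _ _ trivial
      fun new x hx _ => ⟨trivial, ?_⟩).trans_eq (by rw [List.length_range])
    refine (Timed.forEach_time_le (fun _ => True) (4 * (2 * Nat.size S + 1) ^ 2 + 7) _ _ trivial
      fun new y hy _ => ⟨trivial, ?_⟩).trans_eq (by rw [List.length_range])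
    rw [List.mem_range] at hx hy
    exact extend_time h₁ h₂ old new a (by omega) (by omega)

/-- A bound for the time of the selection of the best entry of the table. -/
def selectTime (Y B : ℕ) : ℕ := (B + 1) * ((B + 1) * (2 * Y + 1 + 1) + 1 + 1) + 1

/-- The invariant that the stored value is at most B is needed to charge its comparison. -/
theorem selectBest_time {B S : ℕ} (hB : B ≤ S) (T : N.Table) :
    (selectBest N B T).time ≤ selectTime ((2 * Nat.size S + 1) ^ 2) B := by
  rw [selectBest_eq]
  have step : ∀ x ∈ List.range (B + 1), ∀ s, ∀ y ∈ List.range (B + 1),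
      (∀ z P, s = some (z, P) → z ≤ B) →
      (∀ z P, (selectStep T x s y).val = some (z, P) → z ≤ B) ∧
        (selectStep T x s y).time ≤ 2 * (2 * Nat.size S + 1) ^ 2 + 1 := by
    intro x hx s y hy hs
    rw [List.mem_range] at hx hy
    constructor
    · rcases selectStep_cases T x y s with ⟨h1, -⟩ | ⟨P, -, h2, -⟩
      · rwa [h1]
      · rw [h2]
        intro z Q hz
        obtain ⟨rfl, rfl⟩ : max x y = z ∧ P = Q := by simpa using hz
        omega
    · simp only [selectStep, Timed.get, Timed.bind_time]
      rcases T (N.t, x, y) with _ | P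
      · simp
      · have c1 := natOp_le (s := S) (x := x) (y := y) (by omega) (by omega)
        simp only [Timed.natLe, Timed.bind_time]
        rcases s with _ | ⟨z, R⟩
        · simp only [Timed.pure_time]; omega
        · have hz := hs z R rfl
          have c2 := natOp_le (s := S) (x := z) (y := if decide (x ≤ y) = true then y else x)
            (by omega) (by split <;> omega)
          rw [Timed.bind_time, apply_ite Timed.time]
          simp only [Timed.pure_time, ite_self]
          omega
  refine (Timed.forEach_time_le (fun s => ∀ z P, s = some (z, P) → z ≤ B) ((B + 1) *
    (2 * (2 * Nat.size S + 1) ^ 2 + 1 + 1) + 1) _ _ (by simp)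
    fun s x hx hs => ⟨Timed.forEach_inv (fun s => ∀ z P, s = some (z, P) → z ≤ B) _ _ hs
      fun s y hy hs => (step x hx s y hy hs).1, ?_⟩).trans_eq (by rw [List.length_range]; rfl)
  exact (Timed.forEach_time_le (fun s => ∀ z P, s = some (z, P) → z ≤ B) _ _ _ hs
    fun s y hy hs => step x hx s y hy hs).trans_eq (by rw [List.length_range])

/-- A bound for the time of the path algorithm, if an operation on rationals costs at most `X`,
an operation on rounded lengths at most `Y`, and the rounded lengths are bounded by `B`. -/
def abvTime (V A X Y B : ℕ) : ℕ :=
  A + (A * (2 + X + 1 + 1) + 1) + bellmanFordTime V A X + 1 + X + 4 * X + (V + 1) + X +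
    2 * (A + (A * (1 + X + 1 + 1) + 1)) + tableTime V A Y B + selectTime Y B + toPathTime V

/-- The part of the path algorithm after the computation of a shortest path. -/
def abvRound {K : Type} [Field K] [LinearOrder K] [BitSize K] [FloorSemiring K] (N : Network)
    (δ : K) (w₁ w₂ : Fin N.numA → K) (c : K) (P : List (Fin N.numA)) :
    Timed (Option (List (Fin N.numA))) := do
  let h ← Timed.div c 2
  let e ← Timed.mul δ h
  let k ← Timed.ofNat N.numV
  let θ ← Timed.div e k
  let B ← Timed.floorDiv c θ
  let v₁ ← Timed.tabulate 0 (fun a => do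
    let x ← Timed.get w₁ a
    Timed.floorDiv x θ)
  let v₂ ← Timed.tabulate 0 (fun a => do
    let x ← Timed.get w₂ a
    Timed.floorDiv x θ)
  let T ← dynProg N v₁ v₂ B
  match ← selectBest N B T with
  | none => do
    let Q ← toPath N P
    pure (some Q)
  | some (_, R) => do
    let Q ← toPath N R
    pure (some Q)

theorem abv_eq {K : Type} [Field K] [LinearOrder K] [BitSize K] [FloorSemiring K] (δ : K)
    (w₁ w₂ : Fin N.numA → K) : abv N δ w₁ w₂ = (do
      let w ← Timed.tabulate 0 (fun a => do
        let x ← Timed.get w₁ a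
        let y ← Timed.get w₂ a
        Timed.add x y)
      let l ← bellmanFord N w
      match ← Timed.get l N.t with
      | none => pure none
      | some (c, P) => do
        let z ← Timed.le c 0
        if z then do
          let Q ← toPath N P
          pure (some Q)
        else abvRound N δ w₁ w₂ c P) := by
  simp only [abv, abvRound]
  congr 1; funext w; congr 1; funext l; congr 1; funext o; rcases o with _ | ⟨c, P⟩
  · rfl
  · rfl

section

variable {δ : ℚ} {dn dd M Z W : ℕ} (hδ : δ = dn / dd) (hdn : 0 < dn) (hdd : 0 < dd) (hM : 0 < M)
  {w₁ w₂ : Fin N.numA → ℚ} (h₁ : ∀ a, Frac M Z (w₁ a)) (h₂ : ∀ a, Frac M Z (w₂ a))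
  (hW : Nat.size (2 * dd * M * N.numV) + Nat.size ((dn + 1) * (2 * N.numV + 2) * (Z + 1)) ≤ W)
include hδ hdn hdd hM h₁ h₂ hW

/-- With δ = dn/dd, the table bound c/θ equals 2|V| dd/dn, hence is at most 2|V| dd, whatever the
weights are. The rounded weights may be as large as 2|V| dd Z, but they enter the cost only through
their bit lengths. In the bit bound W, the denominator 2 dd M |V| is that of θ. -/
theorem abvRound_time {c : ℚ} (hc : Frac M (N.numV * (2 * Z)) c) (hc0 : 0 < c)
    {P : List (Fin N.numA)} (hP : N.IsWalk N.s P.reverse N.t) (hPV : P.length ≤ N.numV) :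
    (abvRound N δ w₁ w₂ c P).time ≤ 5 * (2 * W + 1) ^ 2 + (N.numV + 1) +
      2 * (N.numA + (N.numA * (1 + (2 * W + 1) ^ 2 + 1 + 1) + 1)) +
      tableTime N.numV N.numA ((2 * Nat.size (2 * N.numV * dd + 2 * N.numV * dd * Z) + 1) ^ 2)
        (2 * N.numV * dd) +
      selectTime ((2 * Nat.size (2 * N.numV * dd + 2 * N.numV * dd * Z) + 1) ^ 2)
        (2 * N.numV * dd) + toPathTime N.numV := by
  have hV : 0 < N.numV := N.s.pos
  have bits : ∀ {k z q}, 0 < k → Frac k z q → k ≤ 2 * dd * M * N.numV →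
      z ≤ (dn + 1) * (2 * N.numV + 2) * (Z + 1) → BitSize.bits q ≤ W := fun hk hq h1 h2 =>
    (hq.bits_le hk h1 h2).trans hW
  have hδf : Frac dd dn δ := ⟨dn, le_rfl, hδ⟩
  have hh : Frac (M * 2) (N.numV * (2 * Z)) (c / 2) := hc.div_natCast 2
  have he := hδf.mul hh
  have hθ := he.div_natCast N.numV
  have z₁ : N.numV * (2 * Z) ≤ (dn + 1) * (2 * N.numV + 2) * (Z + 1) := by
    calc N.numV * (2 * Z) = 1 * (2 * N.numV) * Z := by ring
      _ ≤ (dn + 1) * (2 * N.numV + 2) * (Z + 1) := by gcongr <;> omega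
  have z₃ : 2 * N.numV + 2 ≤ (dn + 1) * (2 * N.numV + 2) * (Z + 1) := by
    calc 2 * N.numV + 2 = 1 * (2 * N.numV + 2) * 1 := by ring
      _ ≤ (dn + 1) * (2 * N.numV + 2) * (Z + 1) := by gcongr <;> omega
  have z₄ : dn ≤ (dn + 1) * (2 * N.numV + 2) * (Z + 1) := by
    calc dn = dn * 1 * 1 := by ring
      _ ≤ (dn + 1) * (2 * N.numV + 2) * (Z + 1) := by gcongr <;> omega
  have z₂ : dn * (N.numV * (2 * Z)) ≤ (dn + 1) * (2 * N.numV + 2) * (Z + 1) := by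
    calc dn * (N.numV * (2 * Z)) = dn * (2 * N.numV) * Z := by ring
      _ ≤ (dn + 1) * (2 * N.numV + 2) * (Z + 1) := by gcongr <;> omega
  have b₀ : M ≤ 2 * dd * M * N.numV := by
    calc M = 1 * 1 * M * 1 := by ring
      _ ≤ 2 * dd * M * N.numV := by gcongr <;> omega
  have cb := bits hM hc b₀ z₁
  have c1 := opCost_le cb (bits one_pos (Frac.natCast 2) (by omega) (by omega))
  have c2 := opCost_le (bits hdd hδf (by nlinarith [Nat.mul_pos hM hV]) z₄)
    (bits (by omega) hh (by nlinarith [Nat.mul_pos hdd hV]) z₁)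
  have c3 := opCost_le (bits (by positivity) he (by nlinarith [Nat.mul_pos hdd hM]) z₂)
    (bits one_pos (Frac.natCast N.numV) (by omega) (by omega))
  have θb := bits (by positivity) hθ (by apply le_of_eq; ring) z₂
  have c4 := opCost_le cb θb
  have c5 : Nat.size N.numV + 1 ≤ N.numV + 1 := by have := size_le_self N.numV; omega
  set θ : ℚ := δ * (c / 2) / (N.numV : ℚ) with hθdef
  have hVq : (0 : ℚ) < N.numV := by exact_mod_cast hV
  have hdnq : (1 : ℚ) ≤ dn := by exact_mod_cast hdn
  have hddq : (0 : ℚ) < dd := by exact_mod_cast hdd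
  have hMq : (0 : ℚ) < M := by exact_mod_cast hM
  -- A positive fraction with denominator M is at least 1/M.
  have hcM : 1 / (M : ℚ) ≤ c := by
    obtain ⟨a, -, rfl⟩ := hc
    have : 0 < a := by
      rcases Nat.eq_zero_or_pos a with rfl | h
      · simp at hc0
      · exact h
    have : (1 : ℚ) ≤ a := by exact_mod_cast this
    gcongr
  -- The right-hand side is dn * c, and dn ≥ 1.
  have hθc : c ≤ 2 * N.numV * dd * θ := by
    have : 2 * N.numV * dd * θ = dn * c := by
      rw [hθdef, hδ]
      field_simp
    rw [this]
    nlinarith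
  have hθ0 : 0 < θ := by
    rw [hθdef, hδ]
    have : (0 : ℚ) < dn := by linarith
    positivity
  have hB : ⌊c / θ⌋₊ ≤ 2 * N.numV * dd := by
    refine Nat.floor_le_of_le ?_
    rw [div_le_iff₀ hθ0]
    exact_mod_cast hθc
  -- A weight is at most Z/M ≤ Z c, so a rounded weight is at most Z times the bound for c/θ.
  have hv : ∀ w : Fin N.numA → ℚ, (∀ a, Frac M Z (w a)) → ∀ a,
      ⌊c / θ⌋₊ + ⌊w a / θ⌋₊ ≤ 2 * N.numV * dd + 2 * N.numV * dd * Z := by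
    intro w hw a
    refine Nat.add_le_add hB (Nat.floor_le_of_le ?_)
    rw [div_le_iff₀ hθ0]
    obtain ⟨b, hb, hwb⟩ := hw a
    have hb' : (b : ℚ) ≤ Z := by exact_mod_cast hb
    rw [hwb]
    push_cast
    calc (b : ℚ) / M ≤ Z / M := by gcongr
      _ = Z * (1 / M) := by ring
      _ ≤ Z * (2 * N.numV * dd * θ) := by
        gcongr
        exact hcM.trans hθc
      _ = 2 * N.numV * dd * Z * θ := by ring
  have ht : ∀ w : Fin N.numA → ℚ, (∀ a, Frac M Z (w a)) →
      (Timed.tabulate 0 (fun a => do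
        let x ← Timed.get w a
        Timed.floorDiv x θ)).time ≤ N.numA + (N.numA * (1 + (2 * W + 1) ^ 2 + 1 + 1) + 1) := by
    intro w hw
    refine Timed.tabulate_time_le _ _ _ fun a => ?_
    exact Nat.add_le_add_left (opCost_le (bits hM (hw a) b₀ (by nlinarith)) θb) 1
  have hd := dynProg_time (hv w₁ h₁) (hv w₂ h₂)
  have hs := selectBest_time (N := N) (hB.trans (Nat.le_add_right _ (2 * N.numV * dd * Z)))
    (dynProg N (fun a => ⌊w₁ a / θ⌋₊) (fun a => ⌊w₂ a / θ⌋₊) ⌊c / θ⌋₊).val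
  have hd' := hd.trans (show _ ≤ tableTime N.numV N.numA _ (2 * N.numV * dd) by
    unfold tableTime; gcongr)
  have hs' := hs.trans (show _ ≤ selectTime _ (2 * N.numV * dd) by
    unfold selectTime; gcongr)
  have hT := (dynProg_spec (N := N) (fun a => ⌊w₁ a / θ⌋₊) (fun a => ⌊w₂ a / θ⌋₊) ⌊c / θ⌋₊).1
  have hS := (selectBest_spec ⌊c / θ⌋₊
    (dynProg N (fun a => ⌊w₁ a / θ⌋₊) (fun a => ⌊w₂ a / θ⌋₊) ⌊c / θ⌋₊).val).1
  have heq : (abvRound N δ w₁ w₂ c P).time = Timed.opCost c 2 + (Timed.opCost δ (c / 2) +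
      (Nat.size N.numV + 1 + (Timed.opCost (δ * (c / 2)) (N.numV : ℚ) + (Timed.opCost c θ +
      ((Timed.tabulate 0 (fun a => do
        let x ← Timed.get w₁ a
        Timed.floorDiv x θ)).time + ((Timed.tabulate 0 (fun a => do
        let x ← Timed.get w₂ a
        Timed.floorDiv x θ)).time + ((dynProg N (fun a => ⌊w₁ a / θ⌋₊) (fun a => ⌊w₂ a / θ⌋₊)
        ⌊c / θ⌋₊).time + ((selectBest N ⌊c / θ⌋₊ (dynProg N (fun a => ⌊w₁ a / θ⌋₊)
        (fun a => ⌊w₂ a / θ⌋₊) ⌊c / θ⌋₊).val).time +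
        (match (selectBest N ⌊c / θ⌋₊ (dynProg N (fun a => ⌊w₁ a / θ⌋₊)
          (fun a => ⌊w₂ a / θ⌋₊) ⌊c / θ⌋₊).val).val with
          | none => (toPath N P).time
          | some (_, R) => (toPath N R).time))))))))) := by
    simp only [abvRound, Timed.bind_time, Timed.tabulate_spec]
    simp only [Timed.div, Timed.mul, Timed.ofNat, Timed.floorDiv, Timed.get, Timed.bind_val,
      ← hθdef]
    congr 9
    rcases (selectBest N ⌊c / θ⌋₊ (dynProg N (fun a => ⌊w₁ a / θ⌋₊) (fun a => ⌊w₂ a / θ⌋₊)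
      ⌊c / θ⌋₊).val).val with _ | ⟨_, R⟩ <;> rfl
  have hlast : (match (selectBest N ⌊c / θ⌋₊ (dynProg N (fun a => ⌊w₁ a / θ⌋₊)
          (fun a => ⌊w₂ a / θ⌋₊) ⌊c / θ⌋₊).val).val with
          | none => (toPath N P).time
          | some (_, R) => (toPath N R).time) ≤ toPathTime N.numV := by
    split
    · exact toPath_time hP hPV
    · rename_i z R hR
      obtain ⟨x, y, hxy, -⟩ := hS _ _ hR
      obtain ⟨h3, -, -, h4⟩ := hT _ _ _ _ hxy
      exact toPath_time h3 h4
  rw [heq]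
  have ht1 := ht w₁ h₁
  have ht2 := ht w₂ h₂
  clear hd hs hT hS heq ht bits hW
  linarith

theorem abv_time : (abv N δ w₁ w₂).time ≤ abvTime N.numV N.numA ((2 * W + 1) ^ 2)
    ((2 * Nat.size (2 * N.numV * dd + 2 * N.numV * dd * Z) + 1) ^ 2) (2 * N.numV * dd) := by
  have hV : 0 < N.numV := N.s.pos
  have b₀ : M ≤ 2 * dd * M * N.numV := by
    calc M = 1 * 1 * M * 1 := by ring
      _ ≤ 2 * dd * M * N.numV := by gcongr <;> omega
  have bits : ∀ {z q}, Frac M z q →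
      z ≤ (dn + 1) * (2 * N.numV + 2) * (Z + 1) → BitSize.bits q ≤ W := fun hq h2 =>
    (hq.bits_le hM b₀ h2).trans hW
  have hw : ∀ a, Frac M (2 * Z) (w₁ a + w₂ a) := fun a =>
    ((h₁ a).add (h₂ a)).mono (by omega)
  have hz : Z ≤ (dn + 1) * (2 * N.numV + 2) * (Z + 1) := by
    calc Z = 1 * 1 * Z := by ring
      _ ≤ (dn + 1) * (2 * N.numV + 2) * (Z + 1) := by gcongr <;> omega
  have hz' : (N.numV + 1) * (2 * Z) ≤ (dn + 1) * (2 * N.numV + 2) * (Z + 1) := by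
    calc (N.numV + 1) * (2 * Z) = 1 * (2 * N.numV + 2) * Z := by ring
      _ ≤ (dn + 1) * (2 * N.numV + 2) * (Z + 1) := by gcongr <;> omega
  have hbf := bellmanFord_time hM hw ((Nat.add_le_add (Nat.size_le_size b₀)
    (Nat.size_le_size hz')).trans hW)
  have hv := (bellmanFord_spec fun a => w₁ a + w₂ a).1
  have ht : (Timed.tabulate 0 (fun a => do
      let x ← Timed.get w₁ a
      let y ← Timed.get w₂ a
      Timed.add x y)).time ≤ N.numA + (N.numA * (2 + (2 * W + 1) ^ 2 + 1 + 1) + 1) := by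
    refine Timed.tabulate_time_le _ _ _ fun a => ?_
    have := opCost_le (bits (h₁ a) hz) (bits (h₂ a) hz)
    simp only [Timed.bind_time, Timed.get, Timed.add]
    omega
  have hval : (Timed.tabulate 0 (fun a => do
      let x ← Timed.get w₁ a
      let y ← Timed.get w₂ a
      Timed.add x y)).val = fun a => w₁ a + w₂ a := Timed.tabulate_spec _ _
  rw [abv_eq]
  simp only [Timed.bind_time]
  rw [hval]
  revert ht
  generalize (Timed.tabulate 0 (fun a => do
      let x ← Timed.get w₁ a
      let y ← Timed.get w₂ a
      Timed.add x y)).time = tb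
  intro ht
  simp only [Timed.get]
  unfold abvTime
  rcases hl : (bellmanFord N fun a => w₁ a + w₂ a).val N.t with _ | ⟨c, P⟩
  · simp only [Timed.pure_time]
    omega
  · obtain ⟨hP, -, hPV⟩ := hv _ _ _ hl
    have hc := validLabels_frac hw hv hl
    have c1 := opCost_le (bits hc (by nlinarith)) (bits (Frac.zero M 0) (by omega))
    simp only [Timed.bind_time, Timed.le]
    by_cases h0 : c ≤ 0
    · have := toPath_time hP hPV
      simp only [h0, decide_true, reduceIte, Timed.bind_time, Timed.pure_time]
      omega
    · have := abvRound_time hδ hdn hdd hM h₁ h₂ hW hc (not_le.1 h0) hP hPV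
      simp only [h0, decide_false, Bool.false_eq_true, reduceIte]
      omega

end

end PathTime

/-! ### The running time of the loop -/

section IterationTime

theorem markStep_time {n W : ℕ} {thr bigM : ℚ} {tot : Fin n → ℚ} (ht : BitSize.bits thr ≤ W)
    (hb : ∀ j, BitSize.bits (tot j) ≤ W) (st : (Fin n → ℚ) × (Fin n → ℚ) × (Fin n → Bool))
    (j : Fin n) : (markStep thr bigM tot st j).time ≤ (2 * W + 1) ^ 2 + 5 := by
  have := opCost_le ht (hb j)
  simp only [markStep, Timed.bind_time, Timed.get, Timed.le, Timed.set]
  rw [apply_ite Timed.time]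
  split <;> simp only [Timed.bind_time, Timed.pure_time] <;> omega

theorem mark_time {n W : ℕ} {thr bigM : ℚ} {tot : Fin n → ℚ} (ht : BitSize.bits thr ≤ W)
    (hb : ∀ j, BitSize.bits (tot j) ≤ W) (st : (Fin n → ℚ) × (Fin n → ℚ) × (Fin n → Bool)) :
    (mark thr bigM tot st).time ≤ n * ((2 * W + 1) ^ 2 + 5 + 1) + 1 :=
  (Timed.forEach_time_le (fun _ => True) _ _ _ trivial fun s j _ _ =>
    ⟨trivial, markStep_time ht hb s j⟩).trans_eq (by rw [List.length_finRange])

/-- A bound for the time of one execution of the loop. -/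
def loopTime (V A X Y B : ℕ) : ℕ :=
  X + (A * 2 + 1) + (A * (1 + X + 1) + 1) + (A * (X + 5 + 1) + 1) + abvTime V A X Y B +
    jacksonTime A X + X

variable {I : ShopPath ℚ} {δ : ℚ} {dn dd N Z W : ℕ} (hδ : δ = dn / dd) (hdn : 0 < dn)
  (hdd : 0 < dd) (hN : 0 < N) (hjob : ∀ j m, Frac N Z ((I.job j).load m))
  (hW : Nat.size (6 * dd * N * I.numV) +
    Nat.size ((dn + dd + 1) * (24 * I.numA + 2 * I.numV + 24) * (Z + 1)) ≤ W)
include hδ hdn hdd hN hjob hW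

omit hδ hjob hdn hdd hN in
-- A single bit bound W for the rational numbers of the loop outside ABV. The factor 3 in the
-- denominator comes from the threshold 2/3 c; 2(12 A + 12) = 24 A + 24 from its numerator.
theorem bits_le_of_frac {k z : ℕ} {q : ℚ} (hk : 0 < k) (hq : Frac k z q) (h₁ : k ≤ 3 * dd * N)
    (h₂ : z ≤ (dn + dd + 1) * (24 * I.numA + 24) * (Z + 1)) : BitSize.bits q ≤ W := by
  have hV : 0 < I.numV := I.s.pos
  refine (hq.bits_le hk (h₁.trans ?_) (h₂.trans ?_)).trans hW
  · calc 3 * dd * N = 3 * dd * N * 1 := by ring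
      _ ≤ 6 * dd * N * I.numV := by gcongr <;> omega
  · gcongr
    omega

omit hjob in
theorem loop_abv_time {w₁ w₂ : Fin I.numA → ℚ} (h₁ : ∀ a, Frac N Z (w₁ a))
    (h₂ : ∀ a, Frac N Z (w₂ a)) :
    (abv I.toNetwork δ w₁ w₂).time ≤ abvTime I.numV I.numA ((2 * W + 1) ^ 2)
      ((2 * Nat.size (2 * I.numV * dd + 2 * I.numV * dd * Z) + 1) ^ 2) (2 * I.numV * dd) := by
  refine abv_time hδ hdn hdd hN h₁ h₂ (le_trans ?_ hW)
  refine Nat.add_le_add (Nat.size_le_size ?_) (Nat.size_le_size ?_)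
  · gcongr
    omega
  · gcongr <;> omega

omit hδ hdn in
theorem loop_jackson_time {P : List (Fin I.numA)} (hP : I.IsPath P) :
    Frac N ((12 * I.numA + 12) * Z) (jackson I.job P).val.2 ∧
      (jackson I.job P).time ≤ jacksonTime I.numA ((2 * W + 1) ^ 2) := by
  have hV : 0 < I.numV := I.s.pos
  refine jackson_time hN hjob (le_trans ?_ hW) (by simpa using hP.nodup.length_le_card)
  refine Nat.add_le_add (Nat.size_le_size ?_) (Nat.size_le_size ?_)
  · calc N = 1 * 1 * N * 1 := by ring
      _ ≤ 6 * dd * N * I.numV := by gcongr <;> omega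
  · calc (12 * I.numA + 12) * Z = 1 * (12 * I.numA + 12) * Z := by ring
      _ ≤ (dn + dd + 1) * (24 * I.numA + 2 * I.numV + 24) * (Z + 1) := by gcongr <;> omega

/-- Nothing accumulates over the rounds: each weight is an original load or `bigM`, and each c is
the makespan of a Jackson schedule. So every round has the same cost bound. -/
theorem uarLoop_time {bigM : ℚ} (hM : Frac N Z bigM) {tot : Fin I.numA → ℚ}
    (htot : ∀ j, Frac N (2 * Z) (tot j)) (hex : ∃ P, I.IsPath P) :
    ∀ (k : ℕ) (w₁ w₂ : Fin I.numA → ℚ) (D : Fin I.numA → Bool) (P : List (Fin I.numA)) (c : ℚ)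
      (best : Solution I.numA ℚ),
      Consistent bigM (fun j => (I.job j).load 0) (fun j => (I.job j).load 1) (w₁, w₂, D) →
      I.IsPath P → Frac N ((12 * I.numA + 12) * Z) c →
      Frac N ((12 * I.numA + 12) * Z) best.cmax →
      (uarLoop I.toNetwork (jackson I.job) (2 / 3) δ bigM tot k w₁ w₂ D P c best).time ≤
        k * loopTime I.numV I.numA ((2 * W + 1) ^ 2)
          ((2 * Nat.size (2 * I.numV * dd + 2 * I.numV * dd * Z) + 1) ^ 2) (2 * I.numV * dd) := by
  have hδ0 : 0 < δ := by
    rw [hδ]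
    have : (0 : ℚ) < dn := by exact_mod_cast hdn
    have : (0 : ℚ) < dd := by exact_mod_cast hdd
    positivity
  have n₁ : N ≤ 3 * dd * N := by nlinarith
  have n₂ : 3 * N ≤ 3 * dd * N := by nlinarith
  have n₃ : 3 ≤ 3 * dd * N := by
    calc 3 = 3 * 1 * 1 := by ring
      _ ≤ 3 * dd * N := by gcongr <;> omega
  have z₁ : 2 * ((12 * I.numA + 12) * Z) ≤ (dn + dd + 1) * (24 * I.numA + 24) * (Z + 1) := by
    calc 2 * ((12 * I.numA + 12) * Z) = 1 * (24 * I.numA + 24) * Z := by ring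
      _ ≤ (dn + dd + 1) * (24 * I.numA + 24) * (Z + 1) := by gcongr <;> omega
  have z₂ : 2 * Z ≤ 2 * ((12 * I.numA + 12) * Z) := by nlinarith
  have z₃ : 2 ≤ (dn + dd + 1) * (24 * I.numA + 24) * (Z + 1) := by
    calc 2 = 1 * 2 * 1 := by ring
      _ ≤ (dn + dd + 1) * (24 * I.numA + 24) * (Z + 1) := by gcongr <;> omega
  have hρ : Frac 3 2 (2 / 3 : ℚ) := ⟨2, le_rfl, by norm_num⟩
  have bρ := bits_le_of_frac hW (by omega) hρ n₃ z₃
  have bt := fun j => bits_le_of_frac hW hN (htot j) n₁ (z₂.trans z₁)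
  have bc : ∀ {c}, Frac N ((12 * I.numA + 12) * Z) c → BitSize.bits c ≤ W := fun hc =>
    bits_le_of_frac hW hN hc n₁ (by omega)
  intro k
  induction k with
  | zero => intros; simp [uarLoop]
  | succ k ih =>
    intro w₁ w₂ D P c best hc hP hcf hbest
    have hlen : P.length ≤ I.numA := by simpa using hP.nodup.length_le_card
    have bthr := bits_le_of_frac hW (by omega) (hρ.mul hcf) n₂ z₁
    have c1 := opCost_le bρ (bc hcf)
    have hhit := Timed.any_time_le (fun j => Timed.get D j) 1 P fun _ _ => le_rfl
    have hbig := Timed.any_time_le (fun j => do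
      let x ← Timed.get tot j
      Timed.le (2 / 3 * c) x) (1 + (2 * W + 1) ^ 2) P fun j _ =>
        Nat.add_le_add_left (opCost_le bthr (bt j)) 1
    have hhit' : P.length * (1 + 1) + 1 ≤ I.numA * 2 + 1 := by gcongr
    have hbig' : P.length * (1 + (2 * W + 1) ^ 2 + 1) + 1 ≤
      I.numA * (1 + (2 * W + 1) ^ 2 + 1) + 1 := by gcongr
    have hmark := mark_time (bigM := bigM) bthr bt (w₁, w₂, D)
    have hc' := (mark_spec (thr := 2 / 3 * c) (tot := tot) hc).1
    revert hc' hmark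
    have hmul : (Timed.mul (2 / 3) c).val = 2 / 3 * c := rfl
    have hmulT : (Timed.mul (2 / 3) c).time = Timed.opCost (2 / 3) c := rfl
    rw [uarLoop_succ]
    simp only [Timed.bind_time]
    rw [hmul, hmulT]
    generalize mark (2 / 3 * c) bigM tot (w₁, w₂, D) = st
    intro hmark hc'
    rw [Nat.succ_mul]
    unfold loopTime
    rw [apply_ite Timed.time]
    split
    · have hfrac : (∀ j, Frac N Z (st.val.1 j)) ∧ ∀ j, Frac N Z (st.val.2.1 j) := by
        refine ⟨fun j => ?_, fun j => ?_⟩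
        · rw [(hc' j).1]; split_ifs; exacts [hM, hjob j 0]
        · rw [(hc' j).2]; split_ifs; exacts [hM, hjob j 1]
      have habv := loop_abv_time hδ hdn hdd hN hW hfrac.1 hfrac.2
      obtain ⟨P', hP', hpath, -⟩ := abv_approx hδ0 (hc'.nonneg hM.nonneg).1
        (hc'.nonneg hM.nonneg).2 hex
      obtain ⟨hJ, hJt⟩ := loop_jackson_time hdd hN hjob hW hpath
      have c2 := opCost_le (bc hJ) (bc hbest)
      have hnext := ih st.val.1 st.val.2.1 st.val.2.2 P' (jackson I.job P').val.2
        (if (Timed.lt (jackson I.job P').val.2 best.cmax).val = true then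
          ⟨P', (jackson I.job P').val.1, (jackson I.job P').val.2⟩ else best) hc' hpath hJ
        (by split_ifs; exacts [hJ, hbest])
      simp only [Timed.bind_time, hP']
      have hlt : (Timed.lt (jackson I.job P').val.2 best.cmax).time =
        Timed.opCost (jackson I.job P').val.2 best.cmax := rfl
      rw [hlt]
      unfold loopTime at hnext
      linarith
    · simp only [Timed.pure_time]
      generalize k * _ = kk
      omega

/-- A bound for the time of the algorithm. -/
def uarTime (V A X Y B : ℕ) : ℕ :=
  2 * (A + (A * (3 + 1 + 1) + 1)) + (A + (A * (2 + X + 1 + 1) + 1)) + abvTime V A X Y B + jacksonTime A X +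
    (A * (1 + X + 1) + 1) + 3 * X + A + A * loopTime V A X Y B

end IterationTime

/-! ### The total running time as a polynomial in the input length -/

section Total

variable {I : ShopPath ℚ} {δ : ℚ} {dn dd N Z W : ℕ}

/-- A bound for the numerators of the weights. -/
def numBound (dn dd N Z A : ℕ) : ℕ := (dd + dn) * ((2 * A + 1) * Z) + dd * N

/-- The prohibitive weight (1 + δ) * sum + 1 has denominator dd * N, so all weights are scaled to
it. Its numerator is at most (dd + dn) times that of the sum, plus dd * N, which explains
`numBound`. -/
theorem uar_time (hδ : δ = dn / dd) (hdn : 0 < dn) (hdd : 0 < dd) (hN : 0 < N)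
    (hjob : ∀ j m, Frac N Z ((I.job j).load m))
    (hW : Nat.size (6 * dd * (dd * N) * I.numV) + Nat.size ((dn + dd + 1) *
      (24 * I.numA + 2 * I.numV + 24) * (numBound dn dd N Z I.numA + 1)) ≤ W) :
    (uar I (jackson I.job) (2 / 3) δ).time ≤ uarTime I.numV I.numA ((2 * W + 1) ^ 2)
      ((2 * Nat.size (2 * I.numV * dd + 2 * I.numV * dd * numBound dn dd N Z I.numA) + 1) ^ 2)
      (2 * I.numV * dd) := by
  obtain ⟨S, hS⟩ : ∃ S, S = (2 * I.numA + 1) * Z := ⟨_, rfl⟩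
  obtain ⟨Z', hZ'⟩ : ∃ Z', Z' = (dd + dn) * S + dd * N := ⟨_, rfl⟩
  have hnum : numBound dn dd N Z I.numA = Z' := by rw [hZ', hS]; rfl
  rw [hnum] at hW ⊢
  clear hnum
  have hN' : 0 < dd * N := Nat.mul_pos hdd hN
  have hδf : Frac dd dn δ := ⟨dn, le_rfl, hδ⟩
  have hSZ : S ≤ Z' := by rw [hZ']; nlinarith
  have hZS : Z ≤ S := by rw [hS]; nlinarith
  have hddZ : dd * Z ≤ Z' := by
    rw [hZ']
    calc dd * Z ≤ (dd + dn) * S := by gcongr; omega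
      _ ≤ _ := by omega
  have hjob' : ∀ j m, Frac (dd * N) Z' ((I.job j).load m) := fun j m =>
    ((hjob j m).scale hdd).mono hddZ
  have hbits : ∀ {k z : ℕ} {q : ℚ}, 0 < k → Frac k z q → k ≤ dd * N → z ≤ Z' + dn + dd →
      BitSize.bits q ≤ W := by
    intro k z q hk hq h1 h2
    refine bits_le_of_frac hW hk hq (h1.trans ?_) (h2.trans ?_)
    · calc dd * N = 1 * 1 * (dd * N) := by ring
        _ ≤ 3 * dd * (dd * N) := by gcongr <;> omega
    · calc Z' + dn + dd ≤ (dn + dd + 1) * 1 * (Z' + 1) := by nlinarith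
        _ ≤ (dn + dd + 1) * (24 * I.numA + 24) * (Z' + 1) := by gcongr; omega
  have hNd : N ≤ dd * N := Nat.le_mul_of_pos_left N hdd
  have hdN : dd ≤ dd * N := Nat.le_mul_of_pos_right dd hN
  have htot : ∀ j, Frac N (2 * Z) ((I.job j).load 0 + (I.job j).load 1) := fun j =>
    ((hjob j 0).add (hjob j 1)).mono (by omega)
  have hsum := Timed.forEach_spec (f := fun z j => do
      let x ← Timed.get (fun j => (I.job j).load 0 + (I.job j).load 1) j
      Timed.add z x) (fun i z => Frac N (i * (2 * Z)) z) (1 + (2 * W + 1) ^ 2)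
      (List.finRange I.numA) 0 (0 : ℚ) (Frac.zero _ _) (by
    intro i z j _ _ hi hz
    rw [List.length_finRange] at hi
    have h1 := hz.add (htot j)
    constructor
    · rw [Nat.succ_mul]; exact h1
    · have hi' : i * (2 * Z) ≤ S := by
        rw [hS]
        calc i * (2 * Z) = (2 * i) * Z := by ring
          _ ≤ _ := by gcongr; omega
      have h2Z : 2 * Z ≤ S := by
        rw [hS]
        gcongr
        omega
      exact Nat.add_le_add_left (opCost_le (hbits hN hz hNd (by omega))
        (hbits hN (htot j) hNd (by omega))) 1)
  rw [zero_add, List.length_finRange] at hsum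
  obtain ⟨hsum, hsumT⟩ := hsum
  have hload : ∀ m, (Timed.tabulate 0 (fun j => loadT I.job j m)).time ≤
      I.numA + (I.numA * (3 + 1 + 1) + 1) := fun m =>
    Timed.tabulate_time_le _ _ _ fun j => le_rfl
  have hloadv : ∀ m, (Timed.tabulate 0 (fun j => loadT I.job j m)).val =
      fun j => (I.job j).load m := fun m => Timed.tabulate_spec _ _
  have htotT : (Timed.tabulate 0 (fun j => do
      let x ← Timed.get (fun j => (I.job j).load 0) j
      let y ← Timed.get (fun j => (I.job j).load 1) j
      Timed.add x y)).time ≤ I.numA + (I.numA * (2 + (2 * W + 1) ^ 2 + 1 + 1) + 1) := by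
    refine Timed.tabulate_time_le _ _ _ fun a => ?_
    have := opCost_le (hbits hN (hjob a 0) hNd (by omega)) (hbits hN (hjob a 1) hNd (by omega))
    simp only [Timed.bind_time, Timed.get, Timed.add]
    omega
  have htotv : (Timed.tabulate 0 (fun j => do
      let x ← Timed.get (fun j => (I.job j).load 0) j
      let y ← Timed.get (fun j => (I.job j).load 1) j
      Timed.add x y)).val = fun j => (I.job j).load 0 + (I.job j).load 1 :=
    Timed.tabulate_spec _ _
  have habv := loop_abv_time hδ hdn hdd hN' hW (fun j => hjob' j 0) fun j => hjob' j 1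
  have hδ0 : 0 < δ := by
    rw [hδ]
    have : (0 : ℚ) < dn := by exact_mod_cast hdn
    have : (0 : ℚ) < dd := by exact_mod_cast hdd
    positivity
  unfold uar
  simp only [Timed.bind_time]
  rw [hloadv 0, hloadv 1]
  have hload0 := hload 0
  have hload1 := hload 1
  revert htotT hload0 hload1 htotv
  generalize (Timed.tabulate 0 (fun j => do
      let x ← Timed.get (fun j => (I.job j).load 0) j
      let y ← Timed.get (fun j => (I.job j).load 1) j
      Timed.add x y)) = tt
  generalize (Timed.tabulate 0 (fun j => loadT I.job j 0)).time = t0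
  generalize (Timed.tabulate 0 (fun j => loadT I.job j 1)).time = t1
  intro htotT htotv hload0 hload1
  rw [htotv]
  unfold uarTime
  by_cases hex : ∃ P, I.IsPath P
  · obtain ⟨P, hP, hpath, -⟩ := abv_approx hδ0 (fun j => (I.job j).load_nonneg 0)
      (fun j => (I.job j).load_nonneg 1) hex
    obtain ⟨hJ, hJt⟩ := loop_jackson_time hdd hN' hjob' hW hpath
    rw [hP]
    simp only [Timed.bind_time, Timed.pure_time]
    revert hsum hsumT
    generalize (Timed.forEach (fun z j => do
      let x ← Timed.get (fun j => (I.job j).load 0 + (I.job j).load 1) j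
      Timed.add z x) (List.finRange I.numA) (0 : ℚ)) = sm
    intro hsum hsumT
    -- The number 1 is written with denominator dd to be added to δ, and below with denominator dd *
    -- N to be added to the product.
    have hone : Frac dd dd (1 : ℚ) := ⟨dd, le_rfl, by
      have : (dd : ℚ) ≠ 0 := by exact_mod_cast hdd.ne'
      field_simp⟩
    have hone' : Frac (dd * N) (dd * N) (1 : ℚ) := ⟨dd * N, le_rfl, by
      have : ((dd * N : ℕ) : ℚ) ≠ 0 := by exact_mod_cast hN'.ne'
      field_simp⟩
    have hsum' := hsum.mono (y := S) (by
      rw [hS]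
      calc I.numA * (2 * Z) = 2 * I.numA * Z := by ring
        _ ≤ _ := by gcongr; omega)
    have he := hone.add hδf
    have hm := he.mul hsum'
    have hM : Frac (dd * N) Z' ((1 + δ) * sm.val + 1) := by
      rw [hZ']
      exact hm.add hone'
    have c1 := opCost_le (hbits hdd hone hdN (by omega)) (hbits hdd hδf hdN (by omega))
    have c2 := opCost_le (hbits hdd he hdN (by omega)) (hbits hN hsum' hNd (by omega))
    have c3 := opCost_le (hbits hN' hm le_rfl (by rw [hZ']; omega))
      (hbits hN' hone' le_rfl (by rw [hZ']; omega))
    have hloop := uarLoop_time hδ hdn hdd hN' hjob' hW hM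
      (tot := fun j => (I.job j).load 0 + (I.job j).load 1)
      (fun j => ((hjob' j 0).add (hjob' j 1)).mono (by omega)) hex I.numA
      (fun j => (I.job j).load 0) (fun j => (I.job j).load 1) (fun _ => false) P
      (jackson I.job P).val.2 ⟨P, (jackson I.job P).val.1, (jackson I.job P).val.2⟩
      (fun j => by simp) hpath hJ hJ
    have e1 : (Timed.add 1 δ).time = Timed.opCost 1 δ := rfl
    have e2 : (Timed.mul (Timed.add 1 δ).val sm.val).time = Timed.opCost (1 + δ) sm.val := rfl
    have e3 : (Timed.add (Timed.mul (Timed.add 1 δ).val sm.val).val 1).time =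
      Timed.opCost ((1 + δ) * sm.val) 1 := rfl
    have e4 : (Timed.add (Timed.mul (Timed.add 1 δ).val sm.val).val 1).val =
      (1 + δ) * sm.val + 1 := rfl
    have e5 : (Timed.fill I.numA false : Timed (Fin I.numA → Bool)).time = I.numA := rfl
    have e6 : (Timed.fill I.numA false : Timed (Fin I.numA → Bool)).val = fun _ => false := rfl
    rw [e1, e2, e3, e4, e5, e6]
    linarith
  · rw [abv_none hex]
    simp only [Timed.pure_time]
    generalize I.numA * loopTime _ _ _ _ _ = T
    omega

/-- The product of the denominators of the processing times. -/
def denProd (I : ShopPath ℚ) : ℕ := ∏ a, ∏ m, ((I.job a).time m).den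

theorem denProd_pos (I : ShopPath ℚ) : 0 < denProd I :=
  Finset.prod_pos fun _ _ => Finset.prod_pos fun _ _ => Rat.den_pos _

/-- A denominator is less than 2 to its bit length, and bit lengths add up under multiplication; the
common denominator thus has linear bit length. -/
theorem denProd_le (I : ShopPath ℚ) : denProd I ≤ 2 ^ I.size := by
  have h1 : denProd I ≤ ∏ a, ∏ m, 2 ^ BitSize.bits ((I.job a).time m) := by
    refine Finset.prod_le_prod' fun a _ => Finset.prod_le_prod' fun m _ => ?_
    refine (Nat.lt_size_self _).le.trans (Nat.pow_le_pow_right (by simp) ?_)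
    exact Nat.le_add_left _ _
  refine h1.trans ?_
  simp only [Finset.prod_pow_eq_pow_sum]
  exact Nat.pow_le_pow_right (by simp) (Nat.le_add_left _ _)

/-- Scaling to the common denominator multiplies the numerator by a divisor of `denProd I`; both
factors are at most `2 ^ I.size`. -/
theorem load_frac (I : ShopPath ℚ) (j : Fin I.numA) (m : Fin 2) :
    Frac (denProd I) (2 ^ I.size * 2 ^ I.size) ((I.job j).load m) := by
  by_cases hm : m ∈ (I.job j).route
  · rw [Job.load_of_mem hm]
    have hdvd : ((I.job j).time m).den ∣ denProd I :=
      (Finset.dvd_prod_of_mem (fun m => ((I.job j).time m).den) (Finset.mem_univ m)).trans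
        (Finset.dvd_prod_of_mem (fun a => ∏ m, ((I.job a).time m).den) (Finset.mem_univ j))
    obtain ⟨k, hk⟩ := hdvd
    have hpos := denProd_pos I
    have hle := denProd_le I
    have hk0 : 0 < k := by
      rcases Nat.eq_zero_or_pos k with rfl | h
      · simp [hk] at hpos
      · exact h
    have h := (Frac.of_nonneg ((I.job j).time_nonneg m)).scale hk0
    rw [hk, mul_comm]
    refine h.mono (Nat.mul_le_mul ?_ ?_)
    · have := Nat.le_mul_of_pos_left k ((I.job j).time m).den_pos
      omega
    · refine (Nat.lt_size_self _).le.trans (Nat.pow_le_pow_right (by simp) ?_)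
      have h1 : BitSize.bits ((I.job j).time m) ≤ ∑ m, BitSize.bits ((I.job j).time m) :=
        Finset.single_le_sum (f := fun m => BitSize.bits ((I.job j).time m))
          (fun _ _ => Nat.zero_le _) (Finset.mem_univ m)
      have h2 : ∑ m, BitSize.bits ((I.job j).time m) ≤
          ∑ a, ∑ m, BitSize.bits ((I.job a).time m) :=
        Finset.single_le_sum (f := fun a => ∑ m, BitSize.bits ((I.job a).time m))
          (fun _ _ => Nat.zero_le _) (Finset.mem_univ j)
      have h3 : Nat.size ((I.job j).time m).num.natAbs ≤ BitSize.bits ((I.job j).time m) :=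
        Nat.le_add_right _ _
      unfold ShopPath.size
      omega
  · rw [Job.load_of_notMem hm]
    exact Frac.zero _ _

namespace PolyBdd

variable {V A X Y B : ShopPath ℚ → ℕ} (hV : PolyBdd V) (hA : PolyBdd A) (hX : PolyBdd X)
  (hY : PolyBdd Y) (hB : PolyBdd B)
include hA hX

theorem jacksonTime : PolyBdd fun I => jacksonTime (A I) (X I) := by
  unfold _root_.jacksonTime
  repeat' first | assumption | exact const _ | apply add | apply mul

include hV hY hB

theorem abvTime : PolyBdd fun I => abvTime (V I) (A I) (X I) (Y I) (B I) := by
  unfold _root_.abvTime bellmanFordTime tableTime selectTime toPathTime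
  repeat' first | assumption | exact const _ | apply add | apply mul

theorem loopTime : PolyBdd fun I => loopTime (V I) (A I) (X I) (Y I) (B I) := by
  have h1 := jacksonTime hA hX
  have h2 := abvTime hV hA hX hY hB
  unfold _root_.loopTime
  repeat' first | assumption | exact const _ | apply add | apply mul

theorem uarTime : PolyBdd fun I => uarTime (V I) (A I) (X I) (Y I) (B I) := by
  have h1 := jacksonTime hA hX
  have h2 := abvTime hV hA hX hY hB
  have h3 := loopTime hV hA hX hY hB
  unfold _root_.uarTime
  repeat' first | assumption | exact const _ | apply add | apply mul

end PolyBdd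

/-- For every fixed accuracy, the running time is polynomial in the length of the input. -/
theorem jjar_time {ε : ℚ} (hε : 0 < ε) : PolyBdd fun I => (jjar I ε).time := by
  obtain ⟨δ, hδ⟩ : ∃ δ, 2 / 3 * ε = δ := ⟨_, rfl⟩
  have hδ0 : 0 < δ := by rw [← hδ]; positivity
  obtain ⟨dn, dd, hdn, hdd, hδf⟩ : ∃ dn dd : ℕ, 0 < dn ∧ 0 < dd ∧ δ = dn / dd := by
    refine ⟨δ.num.natAbs, δ.den, Int.natAbs_pos.2 (Rat.num_ne_zero.2 hδ0.ne'), δ.den_pos, ?_⟩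
    have : ((δ.num.natAbs : ℕ) : ℚ) = (δ.num : ℚ) := by
      rw [← Int.cast_natCast, Int.natAbs_of_nonneg (Rat.num_nonneg.2 hδ0.le)]
    rw [this, Rat.num_div_den]
  -- Z is exponential in the input length, but it occurs in the time bound only under `Nat.size`.
  set Z : ShopPath ℚ → ℕ := fun I =>
    numBound dn dd (denProd I) (2 ^ I.size * 2 ^ I.size) I.numA
  set W : ShopPath ℚ → ℕ := fun I => Nat.size (6 * dd * (dd * denProd I) * I.numV) +
    Nat.size ((dn + dd + 1) * (24 * I.numA + 2 * I.numV + 24) * (Z I + 1)) with hW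
  have key : ∀ I, (jjar I ε).time ≤ Timed.opCost (2 / 3) ε + uarTime I.numV I.numA
      ((2 * W I + 1) ^ 2) ((2 * Nat.size (2 * I.numV * dd + 2 * I.numV * dd * Z I) + 1) ^ 2)
      (2 * I.numV * dd) := fun I => by
    have : (jjar I ε).time =
      Timed.opCost (2 / 3) ε + (uar I (jackson I.job) (2 / 3) (2 / 3 * ε)).time := rfl
    rw [this, hδ]
    exact Nat.add_le_add_left
      (uar_time hδf hdn hdd (denProd_pos I) (load_frac I) le_rfl) _
  refine PolyBdd.mono ?_ key
  have hnv := PolyBdd.numV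
  have hna := PolyBdd.numA
  have snv := PolyBdd.size_of hnv
  have sna := PolyBdd.size_of hna
  have sconst : ∀ c : ℕ, PolyBdd fun _ => Nat.size c := fun c => PolyBdd.const _
  have spow : PolyBdd fun I => Nat.size (2 ^ I.size) :=
    (PolyBdd.size.add (PolyBdd.const 1)).mono fun I => by rw [Nat.size_pow]
  have sden : PolyBdd fun I => Nat.size (denProd I) :=
    spow.mono fun I => Nat.size_le_size (denProd_le I)
  have sZ : PolyBdd fun I => Nat.size (Z I) :=
    .size_add (.size_mul (.size_add (sconst dd) (sconst dn)) (.size_mul (.size_add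
      (.size_mul (sconst 2) sna) (sconst 1)) (.size_mul spow spow))) (.size_mul (sconst dd) sden)
  have pW : PolyBdd W :=
    .add (.size_mul (.size_mul (sconst (6 * dd)) (.size_mul (sconst dd) sden)) snv)
      (.size_mul (.size_mul (sconst (dn + dd + 1)) (.size_add (.size_add (.size_mul (sconst 24) sna)
        (.size_mul (sconst 2) snv)) (sconst 24))) (.size_add sZ (sconst 1)))
  have sY : PolyBdd fun I => Nat.size (2 * I.numV * dd + 2 * I.numV * dd * Z I) :=
    .size_add (.size_mul (.size_mul (sconst 2) snv) (sconst dd))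
      (.size_mul (.size_mul (.size_mul (sconst 2) snv) (sconst dd)) sZ)
  have twice : ∀ {f}, PolyBdd f → PolyBdd fun I => (2 * f I + 1) ^ 2 := fun hf =>
    (((PolyBdd.const 2).mul hf).add (PolyBdd.const 1)).sq
  -- Only the table bound 2|V| dd enters with its value rather than its bit length. It is polynomial
  -- because ε, and with it dd, is fixed.
  exact (PolyBdd.const _).add (PolyBdd.uarTime hnv hna (twice pW) (twice sY)
    (((PolyBdd.const 2).mul hnv).mul (PolyBdd.const dd)))

end Total

theorem mainTheorem6 :
    -- the approximation guarantee
    (∀ (K : Type) [Field K] [LinearOrder K] [IsStrictOrderedRing K] [FloorSemiring K] [BitSize K]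
      (ε : K), 0 < ε → ∀ I : ShopPath K,
        ((¬ ∃ P, I.IsPath P) → (jjar I ε).val = none) ∧
        ((∃ P, I.IsPath P) → ∃ out : Solution I.numA K, (jjar I ε).val = some out ∧
          I.IsPath out.path ∧
          IsSchedule I.job out.path.toFinset out.start ∧
          makespan I.job out.path.toFinset out.start = out.cmax ∧
          ∀ (P : List (Fin I.numA)) (σ : Fin I.numA × Fin 2 → K),
            I.IsPath P → IsSchedule I.job P.toFinset σ →
              out.cmax ≤ (3 / 2 + ε) * makespan I.job P.toFinset σ)) ∧
    -- for every fixed accuracy, the running time is polynomial in the length of the input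
    (∀ ε : ℚ, 0 < ε → ∃ p : Polynomial ℕ, ∀ I : ShopPath ℚ,
      (jjar I ε).time ≤ p.eval I.size) ∧
    -- Jackson's rule compared with Johnson's rule for the two uniform machine orders
    (∀ (K : Type) [Field K] [LinearOrder K] [IsStrictOrderedRing K] [BitSize K]
      (n : ℕ) (job : Fin n → Job K) (L : List (Fin n)), L.Nodup →
        makespan job L.toFinset (jackson job L).val.1 ≤
          max
            (makespan (fun j => (job j).reroute 0) L.toFinset
              (johnson (fun j => (job j).reroute 0) 0 1 L).val.1)
            (makespan (fun j => (job j).reroute 1) L.toFinset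
              (johnson (fun j => (job j).reroute 1) 1 0 L).val.1)) := by
  refine ⟨fun K _ _ _ _ _ ε hε I => jjar_approx hε I, fun ε hε => jjar_time hε,
    fun K _ _ _ _ n job L hL => jackson_le_johnson job hL⟩
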